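/- Let $1/2<\sigma<1$ be fixed. Let $(X(p))_p$, indexed by the primes $p$, be independent random variables, each uniformly distributed on the unit circle $\{|z|=1\}\subset\mathbb{C}$, and let $$L(\sigma,X)=\prod_p\Big(1-\frac{X(p)}{p^{\sigma}}\Big)^{-1}=\lim_{y\to\infty}\prod_{p\le y}\Big(1-\frac{X(p)}{p^{\sigma}}\Big)^{-1},$$ where the limit exists almost surely. For real $\kappa>0$ put $M(\kappa)=\log\mathbb{E}\big(|L(\sigma,X)|^{\kappa}\big)$; the expectation is finite and positive, and $M$ is infinitely differentiable on $(0,\infty)$. Let $I_0(u)=\sum_{n\ge0}\frac{(u/2)^{2n}}{(n!)^2}$ and $f(u)=\log I_0(u)$, which is infinitely differentiable on $\mathbb{R}$, and for integers $m,n\ge0$ put $$a_n^{(m)}=\int_0^\infty\frac{f^{(m)}(u)\,(\log u)^n}{u^{1/\sigma+1-m}}\,du,$$ where the integral converges absolutely. Then for all integers $m\ge0$ and $N\ge0$, as $\kappa\to\infty$ through the positive reals, $$M^{(m)}(\kappa)=\frac{\kappa^{1/\sigma-m}}{\log\kappa}\left(\sum_{n=0}^{N}\frac{a_n^{(m)}}{(\log\kappa)^n}+O\!\left(\frac{1}{(\log\kappa)^{N+1}}\right)\right),$$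 where $M^{(0)}=M$, $f^{(0)}=f$, and $\sigma$, $m$, $N$ are fixed in the $O$-term. -/

import Mathlib

open MeasureTheory ProbabilityTheory Filter Topology Asymptotics
open scoped Nat

noncomputable section

namespace RandomEuler

/-- The uniform probability distribution on the unit circle of `ℂ`: the law of `exp (iθ)` for `θ`
uniformly distributed on `(0, 2π]`. -/
def uniformCircle : Measure ℂ :=
  (ProbabilityTheory.cond (volume : Measure ℝ) (Set.Ioc 0 (2 * Real.pi))).map
    (fun θ : ℝ => Complex.exp (θ * Complex.I))

/-- `(X p)`, indexed by the primes, are independent random variables, each of them uniformly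
distributed on the unit circle. -/
structure IsUniformFamily {Ω : Type*} [MeasurableSpace Ω] (P : Measure Ω)
    (X : Nat.Primes → Ω → ℂ) : Prop where
  measurable : ∀ p, Measurable (X p)
  indep : iIndepFun X P
  law : ∀ p, P.map (X p) = uniformCircle

/-- The finite set of all primes `p ≤ y`. -/
def primesUpTo (y : ℕ) : Finset Nat.Primes := (Finset.range (y + 1)).subtype Nat.Prime

/-- The partial Euler product `∏_{p ≤ y} (1 - X(p) / p ^ σ)⁻¹`. -/
def partialL {Ω : Type*} (σ : ℝ) (X : Nat.Primes → Ω → ℂ) (y : ℕ) (ω : Ω) : ℂ :=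
  ∏ p ∈ primesUpTo y, (1 - X p ω / (((p : ℕ) : ℝ) ^ σ : ℝ))⁻¹

/-- The random Euler product `L(σ, X)`, the limit of the partial products over `p ≤ y` as
`y → ∞`. -/
def randomL {Ω : Type*} (σ : ℝ) (X : Nat.Primes → Ω → ℂ) (ω : Ω) : ℂ :=
  limUnder atTop (fun y : ℕ => partialL σ X y ω)

/-- `M(κ) = log 𝔼 |L(σ, X)| ^ κ`. -/
def logMoment {Ω : Type*} [MeasurableSpace Ω] (P : Measure Ω) (σ : ℝ) (X : Nat.Primes → Ω → ℂ)
    (κ : ℝ) : ℝ :=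
  Real.log (∫ ω, ‖randomL σ X ω‖ ^ κ ∂P)

/-- The modified Bessel function of the first kind `I₀`. -/
def besselI0 (u : ℝ) : ℝ := ∑' n : ℕ, (u / 2) ^ (2 * n) / ((n ! : ℝ)) ^ 2

/-- `f = log I₀`. -/
def logI0 (u : ℝ) : ℝ := Real.log (besselI0 u)

/-- The integrand `f⁽ᵐ⁾(u) (log u)ⁿ / u ^ (1/σ + 1 - m)`. -/
def coeffIntegrand (σ : ℝ) (m n : ℕ) (u : ℝ) : ℝ :=
  iteratedDeriv m logI0 u * Real.log u ^ n / u ^ (1 / σ + 1 - (m : ℝ))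

/-- The coefficient `aₙ⁽ᵐ⁾ = ∫₀^∞ f⁽ᵐ⁾(u) (log u)ⁿ / u ^ (1/σ + 1 - m) du`. -/
def coeff (σ : ℝ) (m n : ℕ) : ℝ := ∫ u in Set.Ioi (0 : ℝ), coeffIntegrand σ m n u

end RandomEuler

end

/-! By independence, `M(κ) = ∑_p g_r(κ)` with `r = p^(-σ)`, where `g_r = eulerCgf r` is the cumulant
generating function of `-log |1 - r e^(iθ)|` for a uniform angle. That variable is `r cos θ +
O(r²)`, and `log 𝔼 exp(u cos θ) = log I₀(u) = f(u)`, so `g_r(κ)` is close to `f(rκ)`. The sums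
converge termwise together with all derivatives, so `M⁽ᵐ⁾ = ∑_p g_r⁽ᵐ⁾` exactly, and no asymptotic
formula is ever differentiated.

Replacing `g_r⁽ᵐ⁾(κ)` by `r^m f⁽ᵐ⁾(rκ)` costs a power of `κ` less than the main term
(`exists_tsum_abs_iteratedDeriv_eulerCgf_sub_le`). Derivatives of a cumulant generating function are
polynomials in the moments of the exponentially tilted law. For small `rκ` the tilted moments of the
two variables are compared directly. For large `rκ` both laws concentrate at the maximum `θ = 0`,
which bounds the cumulants of order at least two separately by `κ^(-m)`.

With `Y = log κ / σ` and `w = log p - Y`, the remaining sum is `κ^(1/σ-m) ∑_p p⁻¹ φ(log p - Y)`,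
where `φ = besselProfile σ m`. Since `u^m f⁽ᵐ⁾(u) ≪ min(u, u²)` and `1 < 1/σ < 2`, `φ` and all its
derivatives decay exponentially. Writing `1/log p = 1/(Y + w)` as a finite geometric sum produces
the powers of `1/log κ`, and the moments `∫ (-w)^n φ` are the `a_n⁽ᵐ⁾` up to `σ^(n+1)`.

Because the test function is Schwartz, the prime number theorem is only needed in smoothed form
(`tsum_vonMangoldt_schwartz`), without a zero-free region. The error in `∑ Λ(n)/n g(log n - Y) = ∫
g` is, up to a tail of `∫ g`, the Fourier transform of `ĝ · (-ζ'/ζ - 1/(s-1))` along `Re s = 1`. The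
second factor is smooth with polynomially bounded derivatives, so this transform is Schwartz in `Y`.
The quantitative input is a polynomial lower bound for `(s-1)ζ(s)` on that line, from the 3-4-1
inequality (`exists_le_norm_riemannZeta₁`).

The random product itself exists by `L²` martingale convergence, and its moments are limits of those
of the partial products by uniform integrability. -/

/-! ### Upper and lower bounds for `(s - 1) ζ(s)` near the line `Re s = 1`. -/

/-- The analytic continuation of `∫₁^∞ {t} t ^ (-s-1) dt`. -/
noncomputable def fractMellin (s : ℂ) : ℂ :=
  mellin (Set.indicator (Set.Ioi (1 : ℝ)) (fun t : ℝ => ((Int.fract t : ℝ) : ℂ))) (-s)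

lemma fractMellin_eq (s : ℂ) :
    fractMellin s = ∫ t in Set.Ioi (1 : ℝ), ((Int.fract t : ℝ) : ℂ) * (t : ℂ) ^ (-(s + 1)) := by
  have h1 : ∀ t : ℝ, (t : ℂ) ^ (-s - 1) •
      (Set.indicator (Set.Ioi (1 : ℝ)) (fun t : ℝ => ((Int.fract t : ℝ) : ℂ))) t =
      Set.indicator (Set.Ioi (1 : ℝ))
        (fun t : ℝ => ((Int.fract t : ℝ) : ℂ) * (t : ℂ) ^ (-(s + 1))) t := by
    intro t
    by_cases ht : t ∈ Set.Ioi (1 : ℝ)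
    · simp only [Set.indicator_of_mem ht, smul_eq_mul]
      rw [mul_comm]; congr 2; ring
    · simp [Set.indicator_of_notMem ht]
  unfold fractMellin mellin
  simp_rw [h1]
  rw [setIntegral_indicator measurableSet_Ioi]
  congr 2
  rw [Set.inter_eq_right]
  exact Set.Ioi_subset_Ioi zero_le_one

lemma norm_fractMellin_integrand_le {s : ℂ} {t : ℝ} (ht : 1 < t) :
    ‖((Int.fract t : ℝ) : ℂ) * (t : ℂ) ^ (-(s + 1))‖ ≤ t ^ (-(s.re + 1)) := by
  rw [norm_mul, Complex.norm_cpow_eq_rpow_re_of_pos (by linarith), Complex.norm_real,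
    Real.norm_eq_abs, abs_of_nonneg (Int.fract_nonneg t)]
  have h := (Int.fract_lt_one t).le
  have h2 : 0 ≤ t ^ (-(s.re + 1)) := Real.rpow_nonneg (by linarith) _
  simpa using mul_le_of_le_one_left h2 h

lemma measurable_fract_mul_cpow (s : ℂ) :
    Measurable (fun t : ℝ => ((Int.fract t : ℝ) : ℂ) * (t : ℂ) ^ (-(s + 1))) := by
  fun_prop

lemma integrableOn_fractMellin {s : ℂ} (hs : 0 < s.re) :
    IntegrableOn (fun t : ℝ => ((Int.fract t : ℝ) : ℂ) * (t : ℂ) ^ (-(s + 1)))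
      (Set.Ioi (1 : ℝ)) := by
  have h : IntegrableOn (fun t : ℝ => t ^ (-(s.re + 1))) (Set.Ioi (1 : ℝ)) :=
    integrableOn_Ioi_rpow_of_lt (by linarith) one_pos
  refine Integrable.mono' h (measurable_fract_mul_cpow s).aestronglyMeasurable ?_
  filter_upwards [ae_restrict_mem measurableSet_Ioi] with t ht
  exact norm_fractMellin_integrand_le ht

lemma norm_fractMellin_le {s : ℂ} (hs : 1 / 2 ≤ s.re) : ‖fractMellin s‖ ≤ 2 := by
  rw [fractMellin_eq]
  have h : IntegrableOn (fun t : ℝ => t ^ (-(s.re + 1))) (Set.Ioi (1 : ℝ)) :=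
    integrableOn_Ioi_rpow_of_lt (by linarith) one_pos
  refine (norm_integral_le_of_norm_le h ?_).trans ?_
  · filter_upwards [ae_restrict_mem measurableSet_Ioi] with t ht
    exact norm_fractMellin_integrand_le ht
  · rw [integral_Ioi_rpow_of_lt (by linarith) one_pos]
    simp only [Real.one_rpow]
    rw [div_le_iff_of_neg (by linarith)]
    linarith

lemma differentiableAt_fractMellin {s : ℂ} (hs : 0 < s.re) :
    DifferentiableAt ℂ fractMellin s := by
  unfold fractMellin
  refine DifferentiableAt.comp (g := mellin (Set.indicator (Set.Ioi (1 : ℝ))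
    (fun t : ℝ => ((Int.fract t : ℝ) : ℂ)))) s ?_ differentiableAt_id.neg
  -- Boundedness at infinity gives `a = 0`. Near `0` the function vanishes, so any `b` below the
  -- real part of `-s` would do.
  refine mellin_differentiableAt_of_isBigO_rpow (a := 0) (b := -s.re - 1) ?_ ?_ ?_ ?_ ?_
  · apply LocallyIntegrable.locallyIntegrableOn
    have : LocallyIntegrable (fun _ : ℝ => (1 : ℝ)) volume := locallyIntegrable_const _
    refine this.mono ?_ ?_
    · refine Measurable.aestronglyMeasurable ?_
      refine Measurable.indicator ?_ measurableSet_Ioi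
      fun_prop
    · refine Eventually.of_forall fun t => ?_
      refine (norm_indicator_le_norm_self _ _).trans ?_
      simp [abs_of_nonneg (Int.fract_nonneg t), (Int.fract_lt_one t).le]
  · simp only [neg_zero, Real.rpow_zero]
    refine IsBigO.of_bound 1 (Eventually.of_forall fun t => ?_)
    refine (norm_indicator_le_norm_self _ _).trans ?_
    simp [abs_of_nonneg (Int.fract_nonneg t), (Int.fract_lt_one t).le]
  · simpa using hs
  · refine IsBigO.of_bound 1 ?_
    have : ∀ᶠ t : ℝ in 𝓝[>] 0, t < 1 := nhdsWithin_le_nhds (eventually_lt_nhds one_pos)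
    filter_upwards [this] with t ht
    rw [Set.indicator_of_notMem (by simpa using ht.le)]
    simp only [norm_zero]
    positivity
  · simp

/-- Abel summation with all coefficients equal to `1`, splitting `⌊t⌋ = t - {t}`. -/
lemma riemannZeta_eq_fractMellin_of_one_lt {s : ℂ} (hs : 1 < s.re) :
    riemannZeta s = s / (s - 1) - s * fractMellin s := by
  have h := LSeries_eq_mul_integral' (1 : ℕ → ℂ) (r := 1) zero_le_one hs (by
    simp only [Pi.one_apply, norm_one, Finset.sum_const, Nat.card_Icc, nsmul_eq_mul, mul_one,
      Nat.add_sub_cancel, Real.rpow_one]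
    exact isBigO_refl _ _)
  rw [LSeries_one_eq_riemannZeta hs] at h
  have hs0 : s - 1 ≠ 0 := by
    intro h0; rw [sub_eq_zero.mp h0] at hs; simp at hs
  have h2 : ∀ t ∈ Set.Ioi (1 : ℝ), (∑ k ∈ Finset.Icc 1 ⌊t⌋₊, (1 : ℕ → ℂ) k) * (t : ℂ) ^ (-(s + 1))
      = (t : ℂ) ^ (-s) - ((Int.fract t : ℝ) : ℂ) * (t : ℂ) ^ (-(s + 1)) := by
    intro t ht
    have ht0 : (0 : ℝ) < t := lt_trans one_pos ht
    have e1 : (∑ k ∈ Finset.Icc 1 ⌊t⌋₊, (1 : ℕ → ℂ) k) = ((t - Int.fract t : ℝ) : ℂ) := by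
      simp only [Pi.one_apply, Finset.sum_const, Nat.card_Icc, nsmul_eq_mul, mul_one,
        Nat.add_sub_cancel]
      have h0 : ((⌊t⌋₊ : ℕ) : ℝ) = (⌊t⌋ : ℝ) := natCast_floor_eq_intCast_floor ht0.le
      rw [Int.self_sub_fract, ← h0, Complex.ofReal_natCast]
    rw [e1]
    push_cast
    rw [sub_mul]
    congr 1
    have : (-s : ℂ) = 1 + (-(s + 1)) := by ring
    rw [this, Complex.cpow_add _ _ (by exact_mod_cast ht0.ne'), Complex.cpow_one]
  rw [setIntegral_congr_fun measurableSet_Ioi h2, integral_sub, ← fractMellin_eq,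
    integral_Ioi_cpow_of_lt (by simpa using hs) one_pos] at h
  · rw [h]
    simp only [Complex.ofReal_one, Complex.one_cpow]
    have : -s + 1 ≠ 0 := by intro h0; apply hs0; linear_combination -h0
    field_simp
    ring
  · exact integrableOn_Ioi_cpow_of_lt (by simpa using hs) one_pos
  · exact integrableOn_fractMellin (by linarith)

/-- Both sides are analytic on `Re s > 0` and agree near `s = 2`, so the identity theorem applies.
This is what bounds the left side to the left of `Re s = 1`. -/
lemma riemannZeta₁_eq_fractMellin {s : ℂ} (hs : 0 < s.re) :
    riemannZeta₁ s = s - s * (s - 1) * fractMellin s := by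
  have hopen : IsOpen {s : ℂ | 0 < s.re} := isOpen_lt continuous_const Complex.continuous_re
  have hA : AnalyticOnNhd ℂ riemannZeta₁ {s : ℂ | 0 < s.re} :=
    (differentiable_riemannZeta₁.differentiableOn).analyticOnNhd hopen
  have hB : AnalyticOnNhd ℂ (fun s => s - s * (s - 1) * fractMellin s) {s : ℂ | 0 < s.re} := by
    refine DifferentiableOn.analyticOnNhd (fun s hs => ?_) hopen
    have := differentiableAt_fractMellin hs
    exact DifferentiableAt.differentiableWithinAt (by fun_prop)
  refine hA.eqOn_of_preconnected_of_eventuallyEq hB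
    (convex_halfSpace_re_gt 0).isPreconnected (z₀ := 2) (by simp) ?_ hs
  have h2 : ∀ᶠ s : ℂ in 𝓝 2, 1 < s.re :=
    (isOpen_lt continuous_const Complex.continuous_re).mem_nhds (by simp)
  filter_upwards [h2] with s hs
  have hs0 : s ≠ 1 := by rintro rfl; simp at hs
  have hs1 : s - 1 ≠ 0 := sub_ne_zero.mpr hs0
  have h := riemannZeta_eq_fractMellin_of_one_lt hs
  rw [riemannZeta_eq_inv_sub_mul hs0] at h
  field_simp at h
  linear_combination h

lemma norm_riemannZeta₁_le {s : ℂ} (hs : 1 / 2 ≤ s.re) :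
    ‖riemannZeta₁ s‖ ≤ 3 * (1 + ‖s‖) ^ 2 := by
  rw [riemannZeta₁_eq_fractMellin (by linarith)]
  have h1 := norm_fractMellin_le hs
  have h2 : ‖s - 1‖ ≤ ‖s‖ + 1 := by simpa using norm_sub_le s 1
  have h3 := norm_nonneg s
  calc ‖s - s * (s - 1) * fractMellin s‖ ≤ ‖s‖ + ‖s * (s - 1) * fractMellin s‖ := norm_sub_le _ _
    _ = ‖s‖ + ‖s‖ * ‖s - 1‖ * ‖fractMellin s‖ := by rw [norm_mul, norm_mul]
    _ ≤ ‖s‖ + ‖s‖ * (‖s‖ + 1) * 2 := by gcongr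
    _ ≤ 3 * (1 + ‖s‖) ^ 2 := by nlinarith

/-- Cauchy's estimate on circles of radius `1/2`, which stay in `Re s ≥ 1/2`. The exponent of growth
does not depend on `n`. -/
lemma norm_iteratedDeriv_riemannZeta₁_le (n : ℕ) :
    ∃ C : ℝ, 0 < C ∧ ∀ s : ℂ, 1 ≤ s.re → ‖iteratedDeriv n riemannZeta₁ s‖ ≤ C * (1 + ‖s‖) ^ 2 := by
  refine ⟨n ! * 12 / (1 / 2) ^ n, by positivity, fun s hs => ?_⟩
  have h := Complex.norm_iteratedDeriv_le_of_forall_mem_sphere_norm_le (c := s) (R := 1 / 2)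
    (C := 12 * (1 + ‖s‖) ^ 2) n (by norm_num)
    differentiable_riemannZeta₁.diffContOnCl (f := riemannZeta₁) ?_
  · calc _ ≤ _ := h
      _ = _ := by ring
  · intro z hz
    have hz' : ‖z - s‖ = 1 / 2 := by simpa using hz
    have h1 : |(z - s).re| ≤ 1 / 2 := hz' ▸ Complex.abs_re_le_norm _
    have h2 : 1 / 2 ≤ z.re := by
      have := (abs_le.mp h1).1
      simp only [Complex.sub_re] at this
      linarith
    have h3 : ‖z‖ ≤ ‖s‖ + 1 / 2 := by
      have : ‖z‖ ≤ ‖s‖ + ‖z - s‖ := norm_le_norm_add_norm_sub' _ _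
      linarith
    refine (norm_riemannZeta₁_le h2).trans ?_
    have := norm_nonneg s
    have := norm_nonneg z
    nlinarith

/-- The 3-4-1 inequality for `ζ` with the poles cleared: the factors `|s - 1|` contribute `x³` and
at least `|t|⁴ · |t|`. -/
lemma norm_riemannZeta₁_product_ge {x : ℝ} (hx : 0 < x) (t : ℝ) :
    x ^ 3 * |t| ^ 5 ≤ ‖riemannZeta₁ (1 + x)‖ ^ 3 * ‖riemannZeta₁ (1 + x + Complex.I * t)‖ ^ 4 *
      ‖riemannZeta₁ (1 + x + 2 * Complex.I * t)‖ := by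
  have h := DirichletCharacter.norm_LFunction_product_ge_one (N := 1) 1 hx t
  rw [one_pow, DirichletCharacter.LFunctionTrivChar, DirichletCharacter.LFunction_modOne_eq] at h
  have hne : ∀ y : ℝ, (1 + x + Complex.I * y : ℂ) ≠ 1 := by
    intro y h0
    have := congrArg Complex.re h0
    simp at this
    exact hx.ne' this
  have e0 : riemannZeta (1 + x) = (x : ℂ)⁻¹ * riemannZeta₁ (1 + x) := by
    have h0 := hne 0
    simp only [Complex.ofReal_zero, mul_zero, add_zero] at h0
    rw [riemannZeta_eq_inv_sub_mul h0]; congr 2; ring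
  have e1 : riemannZeta (1 + x + Complex.I * t) =
      (x + Complex.I * t)⁻¹ * riemannZeta₁ (1 + x + Complex.I * t) := by
    rw [riemannZeta_eq_inv_sub_mul (hne t)]; congr 2; ring
  have e2 : riemannZeta (1 + x + 2 * Complex.I * t) =
      (x + 2 * Complex.I * t)⁻¹ * riemannZeta₁ (1 + x + 2 * Complex.I * t) := by
    have h0 := hne (2 * t)
    push_cast at h0
    rw [show (1 + x + Complex.I * (2 * t) : ℂ) = 1 + x + 2 * Complex.I * t by ring] at h0
    rw [riemannZeta_eq_inv_sub_mul h0]; congr 2; ring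
  rw [e0, e1, e2] at h
  simp only [norm_mul, norm_pow, norm_inv, Complex.norm_real, Real.norm_eq_abs, abs_of_pos hx] at h
  set A := ‖riemannZeta₁ (1 + x)‖
  set B := ‖riemannZeta₁ (1 + x + Complex.I * t)‖
  set D := ‖riemannZeta₁ (1 + x + 2 * Complex.I * t)‖
  have n1 : |t| ≤ ‖(x + Complex.I * t : ℂ)‖ := by
    simpa using Complex.abs_im_le_norm (x + Complex.I * t : ℂ)
  have n2 : |t| ≤ ‖(x + 2 * Complex.I * t : ℂ)‖ := by
    have := Complex.abs_im_le_norm (x + 2 * Complex.I * t : ℂ)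
    simp [abs_mul] at this
    have h0 := abs_nonneg t
    linarith
  have p1 : 0 < ‖(x + Complex.I * t : ℂ)‖ := by
    rw [norm_pos_iff]; intro h0
    have := congrArg Complex.re h0
    simp at this
    exact hx.ne' this
  have p2 : 0 < ‖(x + 2 * Complex.I * t : ℂ)‖ := by
    rw [norm_pos_iff]; intro h0
    have := congrArg Complex.re h0
    simp at this
    exact hx.ne' this
  set a := ‖(x + Complex.I * t : ℂ)‖
  set b := ‖(x + 2 * Complex.I * t : ℂ)‖
  have h' : x ^ 3 * (a ^ 4 * b) ≤ A ^ 3 * B ^ 4 * D := by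
    have e : (x⁻¹ * A) ^ 3 * (a⁻¹ * B) ^ 4 * (b⁻¹ * D) = (A ^ 3 * B ^ 4 * D) / (x ^ 3 * (a ^ 4 * b)) := by
      field_simp
    rw [e, ge_iff_le, one_le_div (by positivity)] at h
    exact h
  refine le_trans ?_ h'
  have : |t| ^ 5 = |t| ^ 4 * |t| := by ring
  rw [this]
  gcongr

lemma norm_riemannZeta₁_sub_le :
    ∃ C : ℝ, 0 < C ∧ ∀ x y t : ℝ, 0 ≤ x → x ≤ y → y ≤ 1 →
      ‖riemannZeta₁ (1 + y + Complex.I * t) - riemannZeta₁ (1 + x + Complex.I * t)‖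
        ≤ C * (1 + |t|) ^ 2 * (y - x) := by
  obtain ⟨C, hC, h⟩ := norm_iteratedDeriv_riemannZeta₁_le 1
  refine ⟨C * 9, by positivity, fun x y t hx hxy hy => ?_⟩
  have hconv : Convex ℝ {s : ℂ | 1 ≤ s.re ∧ s.re ≤ 2 ∧ s.im = t} := by
    have e : {s : ℂ | 1 ≤ s.re ∧ s.re ≤ 2 ∧ s.im = t} =
      {s : ℂ | 1 ≤ s.re} ∩ ({s : ℂ | s.re ≤ 2} ∩ ({s : ℂ | s.im ≤ t} ∩ {s : ℂ | t ≤ s.im})) := by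
      ext s; simp [le_antisymm_iff]
    rw [e]
    exact (convex_halfSpace_re_ge 1).inter ((convex_halfSpace_re_le 2).inter
      ((convex_halfSpace_im_le t).inter (convex_halfSpace_im_ge t)))
  have := Convex.norm_image_sub_le_of_norm_deriv_le (f := riemannZeta₁)
    (s := {s : ℂ | 1 ≤ s.re ∧ s.re ≤ 2 ∧ s.im = t}) (C := C * 9 * (1 + |t|) ^ 2)
    (x := 1 + x + Complex.I * t) (y := 1 + y + Complex.I * t)
    (fun s _ => differentiable_riemannZeta₁ s) ?_ hconv ?_ ?_
  · refine this.trans_eq ?_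
    congr 1
    have : (1 + y + Complex.I * t - (1 + x + Complex.I * t) : ℂ) = ((y - x : ℝ) : ℂ) := by
      push_cast; ring
    rw [this, Complex.norm_real, Real.norm_eq_abs, abs_of_nonneg (by linarith)]
  · rintro s ⟨h1, h2, h3⟩
    have h4 := h s h1
    rw [iteratedDeriv_one] at h4
    refine h4.trans ?_
    have h5 : ‖s‖ ≤ 2 + |t| := by
      have := Complex.norm_le_abs_re_add_abs_im s
      rw [h3, abs_of_nonneg (by linarith)] at this
      linarith
    have h6 := abs_nonneg t
    have h7 : (1 + ‖s‖) ^ 2 ≤ (3 * (1 + |t|)) ^ 2 := by gcongr; linarith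
    calc C * (1 + ‖s‖) ^ 2 ≤ C * (3 * (1 + |t|)) ^ 2 := by gcongr
      _ = _ := by ring
  · simp; constructor <;> linarith
  · simp; constructor <;> linarith

/-- For `|t| ≥ 1` the 3-4-1 inequality gives a lower bound `≫ x^(3/4)` at distance `x` from the
line; the substitution `x = y⁴` avoids fractional powers. Closer to the line than `y⁴`, the
derivative bound changes the value by at most `C T² y⁴`, which is below half of `c y³` once `y` is a
small multiple of `T^(-2)`; hence the power `T⁶`. For `|t| ≤ 1` compactness and the non-vanishing of
`ζ` suffice. -/
lemma exists_le_norm_riemannZeta₁ :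
    ∃ c : ℝ, 0 < c ∧ ∀ x t : ℝ, 0 ≤ x → x ≤ 1 →
      c ≤ ‖riemannZeta₁ (1 + x + Complex.I * t)‖ * (1 + |t|) ^ 6 := by
  obtain ⟨C, hC, hder⟩ := norm_riemannZeta₁_sub_le
  -- the bound off the line, for large `t`
  obtain ⟨c, hc, hoff⟩ : ∃ c : ℝ, 0 < c ∧ ∀ y t : ℝ, 0 < y → y ≤ 1 → 1 ≤ |t| →
      c * y ^ 3 ≤ ‖riemannZeta₁ (1 + ((y ^ 4 : ℝ) : ℂ) + Complex.I * t)‖ := by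
    have hpos : (0:ℝ) < 1 / (4 * (27 ^ 3 * 48)) := by norm_num
    obtain ⟨c, hc, hc4⟩ : ∃ c : ℝ, 0 < c ∧ c ^ 4 ≤ 1 / (4 * (27 ^ 3 * 48)) := by
      exact ⟨1 / 100, by norm_num, by norm_num⟩
    refine ⟨c, hc, fun y t hy hy1 ht => ?_⟩
    have hx : 0 < y ^ 4 := by positivity
    have hx1 : y ^ 4 ≤ 1 := pow_le_one₀ hy.le hy1
    have h := norm_riemannZeta₁_product_ge hx t
    have hA : ‖riemannZeta₁ (1 + ((y ^ 4 : ℝ) : ℂ))‖ ≤ 27 := by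
      refine (norm_riemannZeta₁_le (by simp; norm_cast; linarith)).trans ?_
      have : ‖(1 + ((y ^ 4 : ℝ) : ℂ) : ℂ)‖ ≤ 2 := by
        refine (norm_add_le _ _).trans ?_
        rw [norm_one, Complex.norm_real, Real.norm_eq_abs, abs_of_pos hx]; linarith
      have := norm_nonneg (1 + ((y ^ 4 : ℝ) : ℂ) : ℂ)
      nlinarith
    have hD : ‖riemannZeta₁ (1 + ((y ^ 4 : ℝ) : ℂ) + 2 * Complex.I * t)‖ ≤ 48 * (1 + |t|) ^ 2 := by
      refine (norm_riemannZeta₁_le (by simp; norm_cast; linarith)).trans ?_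
      have : ‖(1 + ((y ^ 4 : ℝ) : ℂ) + 2 * Complex.I * t : ℂ)‖ ≤ 2 + 2 * |t| := by
        refine (norm_add_le _ _).trans ?_
        refine add_le_add ((norm_add_le _ _).trans ?_) ?_
        · rw [norm_one, Complex.norm_real, Real.norm_eq_abs, abs_of_pos hx]; linarith
        · simp
      have h0 := norm_nonneg (1 + ((y ^ 4 : ℝ) : ℂ) + 2 * Complex.I * t : ℂ)
      have h1 : (1 + ‖(1 + ((y ^ 4 : ℝ) : ℂ) + 2 * Complex.I * t : ℂ)‖) ^ 2 ≤ (4 * (1 + |t|)) ^ 2 := by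
        gcongr; linarith [abs_nonneg t]
      calc _ ≤ 3 * (4 * (1 + |t|)) ^ 2 := by gcongr
        _ = _ := by ring
    set B := ‖riemannZeta₁ (1 + ((y ^ 4 : ℝ) : ℂ) + Complex.I * t)‖
    have hB : 0 ≤ B := norm_nonneg _
    have h1 : (y ^ 4) ^ 3 * |t| ^ 5 ≤ 27 ^ 3 * B ^ 4 * (48 * (1 + |t|) ^ 2) := by
      refine h.trans ?_
      gcongr
    -- The factor `|t|⁵` from the cleared poles absorbs the growth of the bound at height `2t`.
    have h2 : (1 + |t|) ^ 2 ≤ 4 * |t| ^ 5 := by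
      have h3 : |t| ^ 2 ≤ |t| ^ 5 := pow_le_pow_right₀ ht (by norm_num)
      nlinarith
    have h5 : 0 < |t| ^ 5 := by positivity
    have h3 : (y ^ 4) ^ 3 ≤ 27 ^ 3 * B ^ 4 * (48 * 4) := by
      have : (y ^ 4) ^ 3 * |t| ^ 5 ≤ (27 ^ 3 * B ^ 4 * (48 * 4)) * |t| ^ 5 := by
        refine h1.trans ?_
        have : 27 ^ 3 * B ^ 4 * (48 * (1 + |t|) ^ 2) ≤ 27 ^ 3 * B ^ 4 * (48 * (4 * |t| ^ 5)) := by
          gcongr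
        linarith
      exact le_of_mul_le_mul_right this h5
    have h4 : (c * y ^ 3) ^ 4 ≤ B ^ 4 := by
      have e : (c * y ^ 3) ^ 4 = c ^ 4 * (y ^ 4) ^ 3 := by ring
      rw [e]
      calc c ^ 4 * (y ^ 4) ^ 3 ≤ (1 / (4 * (27 ^ 3 * 48))) * (27 ^ 3 * B ^ 4 * (48 * 4)) := by gcongr
        _ = B ^ 4 := by ring
    exact le_of_pow_le_pow_left₀ (by norm_num) hB h4
  -- bounded `t`
  obtain ⟨c', hc', hcomp⟩ : ∃ c : ℝ, 0 < c ∧ ∀ x t : ℝ, 0 ≤ x → x ≤ 1 → |t| ≤ 1 →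
      c ≤ ‖riemannZeta₁ (1 + x + Complex.I * t)‖ := by
    have hK : IsCompact (Set.Icc (0:ℝ) 1 ×ˢ Set.Icc (-1:ℝ) 1) := isCompact_Icc.prod isCompact_Icc
    have hcont : Continuous (fun p : ℝ × ℝ => ‖riemannZeta₁ (1 + p.1 + Complex.I * p.2)‖) := by
      have := differentiable_riemannZeta₁.continuous
      fun_prop
    obtain ⟨p, hp, hmin⟩ := hK.exists_isMinOn ⟨(0, 0), by simp⟩ hcont.continuousOn
    refine ⟨‖riemannZeta₁ (1 + p.1 + Complex.I * p.2)‖, ?_, fun x t hx hx1 ht => ?_⟩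
    · rw [norm_pos_iff]
      by_cases h1 : (1 + p.1 + Complex.I * p.2 : ℂ) = 1
      · rw [h1]; simp
      · intro h0
        have hz := riemannZeta_eq_inv_sub_mul h1
        rw [h0, mul_zero] at hz
        refine riemannZeta_ne_zero_of_one_le_re ?_ hz
        simpa using hp.1.1
    · exact hmin (a := (x, t)) ⟨⟨hx, hx1⟩, abs_le.mp ht⟩
  -- combination
  set δ : ℝ := min 1 (c / (2 * C)) with hδ
  have hδ0 : 0 < δ := lt_min one_pos (by positivity)
  refine ⟨min c' (c * δ ^ 3 / 2), by positivity, fun x t hx hx1 => ?_⟩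
  have hT : 1 ≤ 1 + |t| := by linarith [abs_nonneg t]
  rcases le_or_gt |t| 1 with ht | ht
  · refine (min_le_left _ _).trans ((hcomp x t hx hx1 ht).trans ?_)
    exact le_mul_of_one_le_right (norm_nonneg _) (one_le_pow₀ hT)
  · refine (min_le_right _ _).trans ?_
    set T := 1 + |t|
    have hT0 : 0 < T := by linarith
    -- The largest scale, up to a constant, at which the derivative bound still preserves the lower
    -- bound `c y³`.
    set y := δ / T ^ 2 with hy
    have hy0 : 0 < y := by positivity
    have hy1 : y ≤ 1 := by
      rw [hy, div_le_one (by positivity)]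
      exact (min_le_left _ _).trans (one_le_pow₀ hT)
    have hy3 : y ^ 3 * T ^ 6 = δ ^ 3 := by rw [hy]; field_simp
    suffices h : c * y ^ 3 / 2 ≤ ‖riemannZeta₁ (1 + x + Complex.I * t)‖ by
      calc c * δ ^ 3 / 2 = (c * y ^ 3 / 2) * T ^ 6 := by rw [← hy3]; ring
        _ ≤ _ := by gcongr
    rcases le_or_gt (y ^ 4) x with hxy | hxy
    · -- far from the line
      have hz : 0 < x := lt_of_lt_of_le (by positivity) hxy
      set z := x ^ (1 / 4 : ℝ) with hzdef
      have hz4 : z ^ 4 = x := by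
        rw [hzdef, ← Real.rpow_natCast, ← Real.rpow_mul hx]; norm_num
      have hz0 : 0 < z := Real.rpow_pos_of_pos hz _
      have hz1 : z ≤ 1 := Real.rpow_le_one hx hx1 (by norm_num)
      have hyz : y ≤ z := le_of_pow_le_pow_left₀ (by norm_num) hz0.le (hz4 ▸ hxy)
      have h := hoff z t hz0 hz1 ht.le
      rw [hz4] at h
      refine le_trans ?_ h
      have : c * y ^ 3 ≤ c * z ^ 3 := by gcongr
      have h0 : 0 ≤ c * y ^ 3 := by positivity
      linarith
    · have h := hoff y t hy0 hy1 ht.le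
      have h2 := hder x (y ^ 4) t hx hxy.le (pow_le_one₀ hy0.le hy1)
      have h3 : C * T ^ 2 * (y ^ 4 - x) ≤ c * y ^ 3 / 2 := by
        have : C * T ^ 2 * y ≤ c / 2 := by
          have : C * T ^ 2 * y = C * δ := by rw [hy]; field_simp
          rw [this]
          calc C * δ ≤ C * (c / (2 * C)) := by gcongr; exact min_le_right _ _
            _ = c / 2 := by field_simp
        calc C * T ^ 2 * (y ^ 4 - x) ≤ C * T ^ 2 * y ^ 4 := by gcongr; linarith
          _ = (C * T ^ 2 * y) * y ^ 3 := by ring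
          _ ≤ (c / 2) * y ^ 3 := by gcongr
          _ = _ := by ring
      have h4 := norm_sub_norm_le (riemannZeta₁ (1 + ((y ^ 4 : ℝ) : ℂ) + Complex.I * t))
        (riemannZeta₁ (1 + x + Complex.I * t))
      linarith

/-! ### Temperate growth of `-ζ'/ζ(s) - 1/(s - 1)` on the line `Re s = 1`. -/

/-- A function of a real variable that is bounded by a polynomial. -/
def PolyBounded (f : ℝ → ℂ) : Prop := ∃ (k : ℕ) (C : ℝ), ∀ x, ‖f x‖ ≤ C * (1 + ‖x‖) ^ k

lemma PolyBounded.mul {f g : ℝ → ℂ} (hf : PolyBounded f) (hg : PolyBounded g) :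
    PolyBounded (fun x => f x * g x) := by
  obtain ⟨k, C, hf⟩ := hf
  obtain ⟨l, D, hg⟩ := hg
  refine ⟨k + l, C * D, fun x => ?_⟩
  rw [norm_mul, pow_add]
  calc ‖f x‖ * ‖g x‖ ≤ (C * (1 + ‖x‖) ^ k) * (D * (1 + ‖x‖) ^ l) := by
        gcongr
        · exact (norm_nonneg _).trans (hf x)
        · exact hf x
        · exact hg x
    _ = _ := by ring

lemma PolyBounded.const (c : ℂ) : PolyBounded (fun _ => c) := ⟨0, ‖c‖, fun x => by simp⟩

lemma PolyBounded.add {f g : ℝ → ℂ} (hf : PolyBounded f) (hg : PolyBounded g) :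
    PolyBounded (fun x => f x + g x) := by
  obtain ⟨k, C, hf⟩ := hf
  obtain ⟨l, D, hg⟩ := hg
  refine ⟨k + l, |C| + |D|, fun x => (norm_add_le _ _).trans ?_⟩
  have hx : 1 ≤ 1 + ‖x‖ := by linarith [norm_nonneg x]
  rw [add_mul]
  refine add_le_add ((hf x).trans ?_) ((hg x).trans ?_)
  · calc C * (1 + ‖x‖) ^ k ≤ |C| * (1 + ‖x‖) ^ k := by gcongr; exact le_abs_self C
      _ ≤ _ := by gcongr; omega
  · calc D * (1 + ‖x‖) ^ l ≤ |D| * (1 + ‖x‖) ^ l := by gcongr; exact le_abs_self D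
      _ ≤ _ := by gcongr; omega

lemma PolyBounded.sum {ι : Type*} (s : Finset ι) {f : ι → ℝ → ℂ}
    (hf : ∀ i ∈ s, PolyBounded (f i)) : PolyBounded (fun x => ∑ i ∈ s, f i x) := by
  classical
  induction s using Finset.induction_on with
  | empty => simpa using PolyBounded.const 0
  | insert a s ha ih =>
    simp_rw [Finset.sum_insert ha]
    exact (hf a (by simp)).add (ih fun i hi => hf i (by simp [hi]))

lemma hasTemperateGrowth_of_iteratedDeriv {f : ℝ → ℂ} (hf : ContDiff ℝ (⊤ : ℕ∞) f)
    (h : ∀ n, PolyBounded (iteratedDeriv n f)) : f.HasTemperateGrowth := by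
  refine ⟨hf, fun n => ?_⟩
  obtain ⟨k, C, hn⟩ := h n
  exact ⟨k, C, fun x => by rw [norm_iteratedFDeriv_eq_norm_iteratedDeriv]; exact hn x⟩

lemma Function.HasTemperateGrowth.polyBounded {f : ℝ → ℂ} (hf : f.HasTemperateGrowth) (n : ℕ) :
    PolyBounded (iteratedDeriv n f) := by
  obtain ⟨k, C, hn⟩ := hf.2 n
  exact ⟨k, C, fun x => by rw [← norm_iteratedFDeriv_eq_norm_iteratedDeriv]; exact hn x⟩

/-- Leibniz's rule for `g · g⁻¹ = 1` expresses the `n`-th derivative of `g⁻¹` through its lower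
ones, so strong induction applies. The lower bound on `g` gives the polynomial bound for `g⁻¹`. -/
lemma Function.HasTemperateGrowth.inv_of_le {g : ℝ → ℂ} (hg : g.HasTemperateGrowth) {c : ℝ}
    (hc : 0 < c) (a : ℕ) (h : ∀ x, c ≤ ‖g x‖ * (1 + ‖x‖) ^ a) :
    Function.HasTemperateGrowth (fun x => (g x)⁻¹) := by
  have hne : ∀ x, g x ≠ 0 := by
    intro x h0
    have := h x
    rw [h0, norm_zero, zero_mul] at this
    linarith
  have hsm : ContDiff ℝ (⊤ : ℕ∞) (fun x => (g x)⁻¹) := hg.1.inv hne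
  have hinv : PolyBounded (fun x => (g x)⁻¹) := by
    refine ⟨a, c⁻¹, fun x => ?_⟩
    have h0 : 0 < ‖g x‖ := norm_pos_iff.mpr (hne x)
    rw [norm_inv, inv_le_iff_one_le_mul₀ h0]
    have := h x
    calc 1 = c⁻¹ * c := by field_simp
      _ ≤ c⁻¹ * (‖g x‖ * (1 + ‖x‖) ^ a) := by gcongr
      _ = _ := by ring
  refine hasTemperateGrowth_of_iteratedDeriv hsm fun n => ?_
  induction n using Nat.strong_induction_on with
  | _ n ih =>
    rcases Nat.eq_zero_or_pos n with rfl | hn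
    · simpa using hinv
    · have hL : ∀ x, iteratedDeriv n (fun x => (g x)⁻¹) x = (-1) * (g x)⁻¹ *
          ∑ i ∈ Finset.range n, (n.choose (i + 1) : ℂ) * iteratedDeriv (i + 1) g x *
            iteratedDeriv (n - (i + 1)) (fun x => (g x)⁻¹) x := by
        intro x
        have h1 := iteratedDeriv_mul (n := n) (x := x) (f := g) (g := fun x => (g x)⁻¹)
          (hg.1.contDiffAt.of_le (by exact_mod_cast le_top))
          (hsm.contDiffAt.of_le (by exact_mod_cast le_top))
        have h2 : g * (fun x => (g x)⁻¹) = fun _ => 1 := by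
          ext y; simp [hne y]
        rw [h2, Finset.sum_range_succ'] at h1
        have h3 : iteratedDeriv n (fun _ : ℝ => (1 : ℂ)) x = 0 := by
          rw [iteratedDeriv_const]; simp [hn.ne']
        rw [h3] at h1
        simp only [Nat.choose_zero_right, Nat.cast_one, one_mul, iteratedDeriv_zero,
          Nat.sub_zero] at h1
        have hI : (g x)⁻¹ * g x = 1 := inv_mul_cancel₀ (hne x)
        linear_combination (-(g x)⁻¹) * h1 - iteratedDeriv n (fun x => (g x)⁻¹) x * hI
      have e : iteratedDeriv n (fun x => (g x)⁻¹) = fun x => (-1) * (g x)⁻¹ *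
          ∑ i ∈ Finset.range n, (n.choose (i + 1) : ℂ) * iteratedDeriv (i + 1) g x *
            iteratedDeriv (n - (i + 1)) (fun x => (g x)⁻¹) x := funext hL
      rw [e]
      refine ((PolyBounded.const _).mul hinv).mul (PolyBounded.sum _ fun i hi => ?_)
      refine ((PolyBounded.const _).mul (hg.polyBounded _)).mul (ih _ ?_)
      omega

/-- A point on the vertical line `Re s = 1 + ε`. -/
noncomputable def vline (ε ξ : ℝ) : ℂ := 1 + ε - 2 * Real.pi * Complex.I * ξ

lemma vline_eq (ε ξ : ℝ) : vline ε ξ = 1 + ε + Complex.I * ((-(2 * Real.pi * ξ) : ℝ) : ℂ) := by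
  unfold vline; push_cast; ring

lemma vline_re (ε ξ : ℝ) : (vline ε ξ).re = 1 + ε := by
  rw [vline_eq]; simp

lemma norm_vline_le {ε : ℝ} (h0 : 0 ≤ ε) (h1 : ε ≤ 1) (ξ : ℝ) :
    1 + ‖vline ε ξ‖ ≤ 3 * (1 + 2 * Real.pi * |ξ|) := by
  have h := Complex.norm_le_abs_re_add_abs_im (vline ε ξ)
  rw [vline_re, abs_of_nonneg (by linarith), vline_eq] at h
  simp [abs_mul, abs_of_pos Real.pi_pos] at h
  have : 0 ≤ 2 * Real.pi * |ξ| := by positivity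
  rw [vline_eq]; simp
  linarith

lemma iteratedDeriv_comp_vline {F : ℂ → ℂ} (hF : Differentiable ℂ F) (n : ℕ) :
    iteratedDeriv n (fun ξ : ℝ => F (vline 0 ξ)) =
      fun ξ : ℝ => (-(2 * Real.pi * Complex.I)) ^ n * iteratedDeriv n F (vline 0 ξ) := by
  induction n with
  | zero => ext; simp
  | succ n ih =>
    rw [iteratedDeriv_succ, ih]
    ext ξ
    have h1 : DifferentiableAt ℂ (iteratedDeriv n F) (vline 0 ξ) :=
      (hF.contDiff (n := ⊤)).differentiable_iteratedDeriv n (by simp) _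
    have h2 : HasDerivAt (fun z : ℂ => (1 : ℂ) + (0 : ℝ) - 2 * Real.pi * Complex.I * z)
        (-(2 * Real.pi * Complex.I)) (ξ : ℂ) := by
      simpa using! ((hasDerivAt_id (ξ : ℂ)).const_mul (2 * Real.pi * Complex.I)).const_sub
        ((1 : ℂ) + (0 : ℝ))
    have h3 := (HasDerivAt.comp (ξ : ℂ) (h₂ := iteratedDeriv n F) (by exact h1.hasDerivAt)
      h2).comp_ofReal
    have h4 := h3.const_mul ((-(2 * Real.pi * Complex.I)) ^ n)
    refine h4.deriv.trans ?_
    rw [iteratedDeriv_succ, pow_succ]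
    ring

lemma hasTemperateGrowth_comp_vline {F : ℂ → ℂ} (hF : Differentiable ℂ F)
    (hb : ∀ n, ∃ C : ℝ, 0 < C ∧ ∀ s : ℂ, 1 ≤ s.re → ‖iteratedDeriv n F s‖ ≤ C * (1 + ‖s‖) ^ 2) :
    Function.HasTemperateGrowth (fun ξ : ℝ => F (vline 0 ξ)) := by
  refine hasTemperateGrowth_of_iteratedDeriv ?_ fun n => ?_
  · have h1 : ContDiff ℝ (⊤ : ℕ∞) F := (hF.contDiff (n := (⊤ : ℕ∞))).restrict_scalars ℝ
    refine h1.comp ?_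
    unfold vline
    have : ContDiff ℝ (⊤ : ℕ∞) (fun ξ : ℝ => (ξ : ℂ)) := Complex.ofRealCLM.contDiff
    fun_prop
  · rw [iteratedDeriv_comp_vline hF]
    refine (PolyBounded.const _).mul ?_
    obtain ⟨C, hC, h⟩ := hb n
    refine ⟨2, C * (3 * (2 * Real.pi)) ^ 2, fun ξ => (h _ (by rw [vline_re]; simp)).trans ?_⟩
    have h2 := norm_vline_le le_rfl zero_le_one ξ
    have hpi : 1 ≤ 2 * Real.pi := by linarith [Real.pi_gt_three]
    have h3 : 1 + ‖vline 0 ξ‖ ≤ (3 * (2 * Real.pi)) * (1 + ‖ξ‖) := by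
      rw [Real.norm_eq_abs]; nlinarith
    calc C * (1 + ‖vline 0 ξ‖) ^ 2 ≤ C * ((3 * (2 * Real.pi)) * (1 + ‖ξ‖)) ^ 2 := by gcongr
      _ = _ := by ring

/-- `-ζ'/ζ(s) - 1/(s-1)` on the line `Re s = 1 + ε`. -/
noncomputable def logDerivLine (ε ξ : ℝ) : ℂ :=
  -deriv riemannZeta₁ (vline ε ξ) * (riemannZeta₁ (vline ε ξ))⁻¹

lemma riemannZeta₁_vline_ge :
    ∃ c : ℝ, 0 < c ∧ ∀ ε ξ : ℝ, 0 ≤ ε → ε ≤ 1 →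
      c ≤ ‖riemannZeta₁ (vline ε ξ)‖ * (1 + 2 * Real.pi * |ξ|) ^ 6 := by
  obtain ⟨c, hc, h⟩ := exists_le_norm_riemannZeta₁
  refine ⟨c, hc, fun ε ξ h0 h1 => ?_⟩
  have := h ε (-(2 * Real.pi * ξ)) h0 h1
  rw [vline_eq]
  simpa [abs_mul, abs_of_pos Real.pi_pos] using this

lemma riemannZeta₁_vline_ne_zero {ε : ℝ} (h0 : 0 ≤ ε) (h1 : ε ≤ 1) (ξ : ℝ) :
    riemannZeta₁ (vline ε ξ) ≠ 0 := by
  obtain ⟨c, hc, h⟩ := riemannZeta₁_vline_ge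
  intro h2
  have := h ε ξ h0 h1
  rw [h2, norm_zero, zero_mul] at this
  linarith

/-- This makes multiplication by the logarithmic derivative on the line an operator on Schwartz
functions, which is the whole source of decay in the error term. -/
lemma hasTemperateGrowth_logDerivLine : Function.HasTemperateGrowth (logDerivLine 0) := by
  have h1 : Function.HasTemperateGrowth (fun ξ : ℝ => riemannZeta₁ (vline 0 ξ)) :=
    hasTemperateGrowth_comp_vline differentiable_riemannZeta₁ norm_iteratedDeriv_riemannZeta₁_le
  have h2 : Function.HasTemperateGrowth (fun ξ : ℝ => deriv riemannZeta₁ (vline 0 ξ)) := by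
    refine hasTemperateGrowth_comp_vline ?_ fun n => ?_
    · exact (differentiable_riemannZeta₁.contDiff (n := 2)).differentiable_deriv_two
    · obtain ⟨C, hC, h⟩ := norm_iteratedDeriv_riemannZeta₁_le (n + 1)
      refine ⟨C, hC, fun s hs => ?_⟩
      rw [← iteratedDeriv_succ']
      exact h s hs
  refine h2.neg.mul ?_
  obtain ⟨c, hc, h⟩ := riemannZeta₁_vline_ge
  have hpi : 1 ≤ 2 * Real.pi := by linarith [Real.pi_gt_three]
  refine h1.inv_of_le (c := c / (2 * Real.pi) ^ 6) (by positivity) 6 fun x => ?_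
  rw [div_le_iff₀ (by positivity)]
  refine (h 0 x le_rfl zero_le_one).trans ?_
  rw [mul_assoc ‖riemannZeta₁ (vline 0 x)‖, ← mul_pow]
  gcongr
  rw [Real.norm_eq_abs]
  nlinarith

/-- Uniformity in `ε` supplies the majorant for the passage `ε → 0`. The exponent is `2` from the
derivative plus `6` from the inverse. -/
lemma norm_logDerivLine_le :
    ∃ C : ℝ, ∀ ε ξ : ℝ, 0 ≤ ε → ε ≤ 1 → ‖logDerivLine ε ξ‖ ≤ C * (1 + 2 * Real.pi * |ξ|) ^ 8 := by
  obtain ⟨c, hc, h⟩ := riemannZeta₁_vline_ge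
  obtain ⟨C, hC, hd⟩ := norm_iteratedDeriv_riemannZeta₁_le 1
  refine ⟨C * 9 * c⁻¹, fun ε ξ h0 h1 => ?_⟩
  have h2 := norm_vline_le h0 h1 ξ
  have h3 := hd (vline ε ξ) (by rw [vline_re]; linarith)
  rw [iteratedDeriv_one] at h3
  have h4 : ‖(riemannZeta₁ (vline ε ξ))⁻¹‖ ≤ c⁻¹ * (1 + 2 * Real.pi * |ξ|) ^ 6 := by
    have hp : 0 < ‖riemannZeta₁ (vline ε ξ)‖ :=
      norm_pos_iff.mpr (riemannZeta₁_vline_ne_zero h0 h1 ξ)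
    rw [norm_inv, inv_le_iff_one_le_mul₀ hp]
    calc 1 = c⁻¹ * c := by field_simp
      _ ≤ c⁻¹ * (‖riemannZeta₁ (vline ε ξ)‖ * (1 + 2 * Real.pi * |ξ|) ^ 6) := by
        gcongr; exact h ε ξ h0 h1
      _ = _ := by ring
  unfold logDerivLine
  rw [norm_mul, norm_neg]
  calc _ ≤ (C * (1 + ‖vline ε ξ‖) ^ 2) * (c⁻¹ * (1 + 2 * Real.pi * |ξ|) ^ 6) := by gcongr
    _ ≤ (C * (3 * (1 + 2 * Real.pi * |ξ|)) ^ 2) * (c⁻¹ * (1 + 2 * Real.pi * |ξ|) ^ 6) := by gcongr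
    _ = _ := by ring

open ArithmeticFunction in
-- Logarithmic differentiation of `ζ(s) = (s-1)⁻¹ · (s-1)ζ(s)` separates the pole.
lemma LSeries_vonMangoldt_sub_eq_logDerivLine {ε : ℝ} (h0 : 0 < ε) (h1 : ε ≤ 1) (ξ : ℝ) :
    LSeries (fun n => (vonMangoldt n : ℂ)) (vline ε ξ) - (vline ε ξ - 1)⁻¹ = logDerivLine ε ξ := by
  have hre : 1 < (vline ε ξ).re := by rw [vline_re]; linarith
  rw [LSeries_vonMangoldt_eq_deriv_riemannZeta_div hre]
  set s := vline ε ξ with hs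
  have hs1 : s ≠ 1 := by intro h; rw [h] at hre; simp at hre
  have hs0 : s - 1 ≠ 0 := sub_ne_zero.mpr hs1
  have hz : riemannZeta₁ s ≠ 0 := riemannZeta₁_vline_ne_zero h0.le h1 ξ
  have hev : riemannZeta =ᶠ[𝓝 s] fun z => (z - 1)⁻¹ * riemannZeta₁ z := by
    filter_upwards [isOpen_ne.mem_nhds hs1] with z hz
    exact riemannZeta_eq_inv_sub_mul hz
  have hd : HasDerivAt (fun z : ℂ => (z - 1)⁻¹ * riemannZeta₁ z)
      (-1 / (s - 1) ^ 2 * riemannZeta₁ s + (s - 1)⁻¹ * deriv riemannZeta₁ s) s :=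
    (((hasDerivAt_id s).sub_const 1).inv hs0).mul (differentiable_riemannZeta₁ s).hasDerivAt
  rw [hev.deriv_eq, hd.deriv, riemannZeta_eq_inv_sub_mul hs1, logDerivLine, ← hs]
  field_simp
  ring

/-! ### A smoothed prime number theorem. -/

open SchwartzMap FourierTransform ArithmeticFunction in
lemma SchwartzMap.eq_integral_fourier (g : 𝓢(ℝ, ℂ)) (v : ℝ) :
    g v = ∫ ξ : ℝ, (𝓕 g) ξ * Complex.exp (2 * Real.pi * Complex.I * ξ * v) := by
  have h : g v = (𝓕⁻ (𝓕 g)) v := by rw [FourierTransform.fourierInv_fourier_eq]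
  rw [h, fourierInv_coe, Real.fourierInv_eq']
  refine integral_congr_ae (Eventually.of_forall fun ξ => ?_)
  simp only [smul_eq_mul]
  rw [mul_comm]
  congr 2
  simp
  ring

lemma norm_exp_two_pi_I (x y : ℝ) : ‖Complex.exp (2 * Real.pi * Complex.I * x * y)‖ = 1 := by
  have : (2 * Real.pi * Complex.I * x * y : ℂ) = ((2 * Real.pi * x * y : ℝ) : ℂ) * Complex.I := by
    push_cast; ring
  rw [this, Complex.norm_exp_ofReal_mul_I]

open ArithmeticFunction in
lemma summable_vonMangoldt_rpow {ε : ℝ} (h0 : 0 < ε) :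
    Summable (fun n : ℕ => vonMangoldt n * (n : ℝ) ^ (-(1 + ε))) := by
  have h := LSeriesSummable_vonMangoldt (s := ((1 + ε : ℝ) : ℂ)) (by simpa using h0)
  have h2 := h.norm
  refine h2.congr fun n => ?_
  rw [LSeries.norm_term_eq]
  rcases eq_or_ne n 0 with rfl | hn
  · simp
  · rw [if_neg hn, Complex.norm_real, Real.norm_eq_abs, abs_of_nonneg vonMangoldt_nonneg,
      Complex.ofReal_re, Real.rpow_neg (by positivity)]
    field_simp

open ArithmeticFunction in
lemma LSeries_term_vline (ε ξ : ℝ) (n : ℕ) :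
    LSeries.term (fun n => (vonMangoldt n : ℂ)) (vline ε ξ) n =
      ((vonMangoldt n * (n : ℝ) ^ (-(1 + ε)) : ℝ) : ℂ) *
        Complex.exp (2 * Real.pi * Complex.I * ξ * Real.log n) := by
  rcases eq_or_ne n 0 with rfl | hn
  · simp
  · have hn' : (n : ℂ) ≠ 0 := by exact_mod_cast hn
    have hn0 : (0 : ℝ) < n := by positivity
    rw [LSeries.term_of_ne_zero hn]
    rw [Complex.cpow_def_of_ne_zero hn', ← Complex.natCast_log, Real.rpow_def_of_pos hn0, div_eq_mul_inv,
      ← Complex.exp_neg]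
    push_cast
    rw [mul_assoc, ← Complex.exp_add]
    congr 2
    unfold vline
    ring

open SchwartzMap FourierTransform ArithmeticFunction in
-- Fourier inversion inside the sum. For `ε > 0` the series converges absolutely, and the phases
-- combine with `n^(-1-ε)` to give `n^(-s)` on the vertical line.
lemma tsum_vonMangoldt_eq_integral (g : 𝓢(ℝ, ℂ)) {ε : ℝ} (h0 : 0 < ε) (Y : ℝ) :
    ∑' n : ℕ, ((vonMangoldt n * (n : ℝ) ^ (-(1 + ε)) : ℝ) : ℂ) * g (Real.log n - Y) =
      ∫ ξ : ℝ, (𝓕 g) ξ * Complex.exp (2 * Real.pi * Complex.I * ξ * (-Y : ℝ)) *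
        LSeries (fun n => (vonMangoldt n : ℂ)) (vline ε ξ) := by
  set a : ℕ → ℝ := fun n => vonMangoldt n * (n : ℝ) ^ (-(1 + ε)) with ha
  have ha0 : ∀ n, 0 ≤ a n := fun n => mul_nonneg vonMangoldt_nonneg (by positivity)
  set F : ℕ → ℝ → ℂ := fun n ξ => (𝓕 g) ξ * Complex.exp (2 * Real.pi * Complex.I * ξ * (-Y : ℝ)) *
    ((a n : ℂ) * Complex.exp (2 * Real.pi * Complex.I * ξ * Real.log n)) with hF
  have hn : ∀ n ξ, ‖F n ξ‖ = a n * ‖(𝓕 g) ξ‖ := by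
    intro n ξ
    simp only [hF, norm_mul, norm_exp_two_pi_I, Complex.norm_real, Real.norm_eq_abs,
      abs_of_nonneg (ha0 n)]
    ring
  have hint : ∀ n, Integrable (F n) := by
    intro n
    refine Integrable.mono ((𝓕 g).integrable.norm.const_mul (a n)) ?_ ?_
    · refine Continuous.aestronglyMeasurable ?_
      have := (𝓕 g).continuous
      fun_prop
    · refine Eventually.of_forall fun ξ => ?_
      rw [hn, Real.norm_eq_abs, abs_of_nonneg (by have := ha0 n; positivity)]
  have hs : Summable fun n => ∫ ξ, ‖F n ξ‖ := by
    simp_rw [hn, integral_const_mul]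
    exact (summable_vonMangoldt_rpow h0).mul_right _
  have h := hasSum_integral_of_summable_integral_norm hint hs
  have e1 : ∀ n, ∫ ξ, F n ξ = (a n : ℂ) * g (Real.log n - Y) := by
    intro n
    rw [g.eq_integral_fourier, ← integral_const_mul]
    refine integral_congr_ae (Eventually.of_forall fun ξ => ?_)
    simp only [hF]
    have : (2 * Real.pi * Complex.I * ξ * ((Real.log n - Y : ℝ) : ℂ) : ℂ) =
      2 * Real.pi * Complex.I * ξ * (-Y : ℝ) + 2 * Real.pi * Complex.I * ξ * Real.log n := by
      push_cast; ring
    rw [this, Complex.exp_add]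
    ring
  simp_rw [e1] at h
  rw [h.tsum_eq]
  refine integral_congr_ae (Eventually.of_forall fun ξ => ?_)
  simp only [hF]
  rw [tsum_mul_left]
  congr 1
  unfold LSeries
  exact tsum_congr fun n => (LSeries_term_vline ε ξ n).symm

open SchwartzMap FourierTransform in
-- The pole term is a Laplace transform, `(s-1)⁻¹ = ∫₀^∞ e^(-(s-1)v) dv`. The main term thus takes
-- the same form as the sum, and the two singularities cancel before `ε → 0`.
lemma integral_exp_mul_schwartz_eq (g : 𝓢(ℝ, ℂ)) {ε : ℝ} (h0 : 0 < ε) (Y : ℝ) :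
    ∫ v in Set.Ioi (0 : ℝ), (Real.exp (-(ε * v)) : ℂ) * g (v - Y) =
      ∫ ξ : ℝ, (𝓕 g) ξ * Complex.exp (2 * Real.pi * Complex.I * ξ * (-Y : ℝ)) *
        (vline ε ξ - 1)⁻¹ := by
  have hexp : IntegrableOn (fun v : ℝ => (Real.exp (-(ε * v)) : ℂ)) (Set.Ioi 0) := by
    have := (integrableOn_exp_mul_Ioi (neg_lt_zero.mpr h0) 0)
    simp_rw [neg_mul] at this
    exact this.ofReal
  set G : ℝ → ℝ → ℂ := fun v ξ => (Real.exp (-(ε * v)) : ℂ) *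
    ((𝓕 g) ξ * Complex.exp (2 * Real.pi * Complex.I * ξ * (v - Y : ℝ))) with hG
  have hGint : Integrable (Function.uncurry G) ((volume.restrict (Set.Ioi (0 : ℝ))).prod volume) := by
    have hp : Integrable (fun p : ℝ × ℝ => (Real.exp (-(ε * p.1)) : ℂ) * (𝓕 g) p.2)
      ((volume.restrict (Set.Ioi (0 : ℝ))).prod volume) :=
      Integrable.mul_prod (f := fun v : ℝ => (Real.exp (-(ε * v)) : ℂ)) hexp (𝓕 g).integrable
    refine Integrable.mono hp ?_ ?_
    · refine Continuous.aestronglyMeasurable ?_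
      have := (𝓕 g).continuous
      simp only [hG, Function.uncurry_def]
      fun_prop
    · refine Eventually.of_forall fun p => ?_
      simp only [hG, Function.uncurry_def, norm_mul, norm_exp_two_pi_I, mul_one]
      exact le_rfl
  have h := integral_integral_swap hGint
  have e1 : ∀ v, ∫ ξ, G v ξ = (Real.exp (-(ε * v)) : ℂ) * g (v - Y) := by
    intro v
    rw [g.eq_integral_fourier, ← integral_const_mul]
  simp_rw [e1] at h
  rw [h]
  refine integral_congr_ae (Eventually.of_forall fun ξ => ?_)
  simp only [hG]
  have hre : (-(vline ε ξ - 1)).re < 0 := by simp [vline_re, h0]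
  have h2 := integral_exp_mul_complex_Ioi hre 0
  have e2 : ∀ v : ℝ, (Real.exp (-(ε * v)) : ℂ) *
      ((𝓕 g) ξ * Complex.exp (2 * Real.pi * Complex.I * ξ * (v - Y : ℝ))) =
      ((𝓕 g) ξ * Complex.exp (2 * Real.pi * Complex.I * ξ * (-Y : ℝ))) *
        Complex.exp (-(vline ε ξ - 1) * v) := by
    intro v
    have : (Complex.exp (2 * Real.pi * Complex.I * ξ * (-Y : ℝ))) *
        Complex.exp (-(vline ε ξ - 1) * v) = (Real.exp (-(ε * v)) : ℂ) *
         Complex.exp (2 * Real.pi * Complex.I * ξ * (v - Y : ℝ)) := by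
      push_cast
      rw [← Complex.exp_add, ← Complex.exp_add]
      congr 1
      unfold vline
      ring
    linear_combination (-((𝓕 g) ξ)) * this
  simp_rw [e2]
  rw [integral_const_mul, h2]
  congr 1
  simp only [Complex.ofReal_zero, mul_zero, Complex.exp_zero]
  rw [neg_div_neg_eq, one_div]

open SchwartzMap FourierTransform in
lemma integrable_fourier_mul_pow (g : 𝓢(ℝ, ℂ)) (k : ℕ) (a : ℝ) :
    Integrable (fun ξ : ℝ => ‖(𝓕 g) ξ‖ * (1 + a * |ξ|) ^ k) := by
  have : (fun ξ : ℝ => ‖(𝓕 g) ξ‖ * (1 + a * |ξ|) ^ k) = fun ξ : ℝ =>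
      ∑ i ∈ Finset.range (k + 1), (a ^ i * (k.choose i : ℝ)) * (‖ξ‖ ^ i * ‖(𝓕 g) ξ‖) := by
    ext ξ
    rw [add_comm, add_pow, Finset.mul_sum]
    refine Finset.sum_congr rfl fun i _ => ?_
    rw [mul_pow, one_pow, Real.norm_eq_abs]
    ring
  rw [this]
  exact integrable_finsetSum _ fun i _ => ((𝓕 g).integrable_pow_mul volume i).const_mul _

open ArithmeticFunction in
-- Exponential decay of `g` in `log n` is a factor `n^(-c)`. This gives convergence at `ε = 0`, and
-- a majorant for the limit.
lemma summable_vonMangoldt_div_mul {g : ℝ → ℂ} {C c : ℝ} (hc : 0 < c)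
    (hg : ∀ w, ‖g w‖ ≤ C * Real.exp (-(c * |w|))) (Y : ℝ) :
    Summable fun n : ℕ => vonMangoldt n * (n : ℝ) ^ (-1 : ℝ) * ‖g (Real.log n - Y)‖ := by
  have hC : 0 ≤ C := by
    have := (norm_nonneg _).trans (hg 0)
    simpa using this
  refine Summable.of_nonneg_of_le (fun n => ?_) (fun n => ?_)
    ((summable_vonMangoldt_rpow hc).mul_right (C * Real.exp (c * Y)))
  · have := vonMangoldt_nonneg (n := n)
    positivity
  · rcases eq_or_ne n 0 with rfl | hn
    · simp
    have hn0 : (0 : ℝ) < n := by positivity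
    have h1 : ‖g (Real.log n - Y)‖ ≤ C * (Real.exp (c * Y) * (n : ℝ) ^ (-c)) := by
      refine (hg _).trans ?_
      rw [Real.rpow_def_of_pos hn0, ← Real.exp_add]
      gcongr
      nlinarith [le_abs_self (Real.log n - Y)]
    have h2 := vonMangoldt_nonneg (n := n)
    calc vonMangoldt n * (n : ℝ) ^ (-1 : ℝ) * ‖g (Real.log n - Y)‖
        ≤ vonMangoldt n * (n : ℝ) ^ (-1 : ℝ) * (C * (Real.exp (c * Y) * (n : ℝ) ^ (-c))) := by
          gcongr
      _ = vonMangoldt n * ((n : ℝ) ^ (-1 : ℝ) * (n : ℝ) ^ (-c)) * (C * Real.exp (c * Y)) := by ring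
      _ = _ := by rw [← Real.rpow_add hn0]; ring_nf

open SchwartzMap FourierTransform ArithmeticFunction in
-- For `ε > 0` the identity is the difference of the two preceding formulas; all three terms pass to
-- the limit `ε → 0+` by dominated convergence.
lemma tsum_vonMangoldt_sub_integral_eq (g : 𝓢(ℝ, ℂ)) {C c : ℝ} (hc : 0 < c)
    (hg : ∀ w, ‖g w‖ ≤ C * Real.exp (-(c * |w|))) (Y : ℝ) :
    ∑' n : ℕ, ((vonMangoldt n * (n : ℝ) ^ (-1 : ℝ) : ℝ) : ℂ) * g (Real.log n - Y) -
        ∫ v in Set.Ioi (0 : ℝ), g (v - Y) =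
      ∫ ξ : ℝ, (𝓕 g) ξ * Complex.exp (2 * Real.pi * Complex.I * ξ * (-Y : ℝ)) *
        logDerivLine 0 ξ := by
  have hev : ∀ᶠ ε : ℝ in 𝓝[>] 0, 0 < ε ∧ ε ≤ 1 := by
    filter_upwards [Ioc_mem_nhdsGT (zero_lt_one' ℝ)] with ε h using h
  have T1 : Tendsto (fun ε : ℝ => ∑' n : ℕ,
      ((vonMangoldt n * (n : ℝ) ^ (-(1 + ε)) : ℝ) : ℂ) * g (Real.log n - Y)) (𝓝[>] 0)
      (𝓝 (∑' n : ℕ, ((vonMangoldt n * (n : ℝ) ^ (-1 : ℝ) : ℝ) : ℂ) * g (Real.log n - Y))) := by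
    refine tendsto_tsum_of_dominated_convergence (summable_vonMangoldt_div_mul hc hg Y) ?_ ?_
    · intro n
      rcases eq_or_ne n 0 with rfl | hn
      · simp
      have hn0 : (n : ℝ) ≠ 0 := by positivity
      have : ContinuousAt (fun ε : ℝ => (n : ℝ) ^ (-(1 + ε))) 0 := by
        refine ContinuousAt.rpow continuousAt_const (by fun_prop) (Or.inl hn0)
      have h2 : Tendsto (fun ε : ℝ => (n : ℝ) ^ (-(1 + ε))) (𝓝[>] 0) (𝓝 ((n : ℝ) ^ (-1 : ℝ))) := by
        have := this.tendsto
        simp only [add_zero] at this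
        exact this.mono_left nhdsWithin_le_nhds
      exact ((Complex.continuous_ofReal.tendsto _).comp (h2.const_mul _)).mul_const _
    · filter_upwards [hev] with ε hε n
      rcases eq_or_ne n 0 with rfl | hn
      · simp
      have hn1 : (1 : ℝ) ≤ n := by exact_mod_cast Nat.one_le_iff_ne_zero.mpr hn
      have h2 := vonMangoldt_nonneg (n := n)
      rw [norm_mul, Complex.norm_real, Real.norm_eq_abs, abs_of_nonneg (by positivity)]
      gcongr
      linarith
  have T2 : Tendsto (fun ε : ℝ => ∫ v in Set.Ioi (0 : ℝ), (Real.exp (-(ε * v)) : ℂ) * g (v - Y))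
      (𝓝[>] 0) (𝓝 (∫ v in Set.Ioi (0 : ℝ), g (v - Y))) := by
    refine tendsto_integral_filter_of_dominated_convergence (fun v => ‖g (v - Y)‖) ?_ ?_ ?_ ?_
    · refine Eventually.of_forall fun ε => Continuous.aestronglyMeasurable ?_
      have := g.continuous
      fun_prop
    · filter_upwards [hev] with ε hε
      filter_upwards [ae_restrict_mem measurableSet_Ioi] with v hv
      rw [norm_mul, Complex.norm_real, Real.norm_eq_abs, abs_of_pos (Real.exp_pos _)]
      refine mul_le_of_le_one_left (norm_nonneg _) (Real.exp_le_one_iff.mpr ?_)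
      have hv0 : (0 : ℝ) < v := hv
      nlinarith [hε.1]
    · exact (g.integrable.comp_sub_right Y).norm.integrableOn
    · refine Eventually.of_forall fun v => ?_
      have h : Continuous fun ε : ℝ => (Real.exp (-(ε * v)) : ℂ) * g (v - Y) := by fun_prop
      have := h.tendsto 0
      simp only [zero_mul, neg_zero, Real.exp_zero, Complex.ofReal_one, one_mul] at this
      exact this.mono_left nhdsWithin_le_nhds
  obtain ⟨K, hK⟩ := norm_logDerivLine_le
  have hcont : ∀ ε : ℝ, 0 ≤ ε → ε ≤ 1 → Continuous (logDerivLine ε) := by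
    intro ε h0 h1
    have hv : Continuous (vline ε) := by unfold vline; fun_prop
    have hd : Continuous (deriv riemannZeta₁) :=
      (differentiable_riemannZeta₁.contDiff (n := 1)).continuous_deriv le_rfl
    exact ((hd.comp hv).neg).mul ((differentiable_riemannZeta₁.continuous.comp hv).inv₀
      (riemannZeta₁_vline_ne_zero h0 h1))
  have hmeas : ∀ ε : ℝ, 0 ≤ ε → ε ≤ 1 → AEStronglyMeasurable (fun ξ : ℝ => (𝓕 g) ξ *
      Complex.exp (2 * Real.pi * Complex.I * ξ * (-Y : ℝ)) * logDerivLine ε ξ) volume := by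
    intro ε h0 h1
    refine Continuous.aestronglyMeasurable ?_
    have h1 := hcont ε h0 h1
    have h2 := (𝓕 g).continuous
    fun_prop
  have hbd : ∀ ε ξ : ℝ, 0 ≤ ε → ε ≤ 1 → ‖(𝓕 g) ξ *
      Complex.exp (2 * Real.pi * Complex.I * ξ * (-Y : ℝ)) * logDerivLine ε ξ‖ ≤
      K * (‖(𝓕 g) ξ‖ * (1 + 2 * Real.pi * |ξ|) ^ 8) := by
    intro ε ξ h0 h1
    rw [norm_mul, norm_mul, norm_exp_two_pi_I, mul_one]
    have := hK ε ξ h0 h1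
    calc ‖(𝓕 g) ξ‖ * ‖logDerivLine ε ξ‖ ≤ ‖(𝓕 g) ξ‖ * (K * (1 + 2 * Real.pi * |ξ|) ^ 8) := by
          gcongr
      _ = _ := by ring
  have T3 : Tendsto (fun ε : ℝ => ∫ ξ : ℝ, (𝓕 g) ξ *
      Complex.exp (2 * Real.pi * Complex.I * ξ * (-Y : ℝ)) * logDerivLine ε ξ) (𝓝[>] 0)
      (𝓝 (∫ ξ : ℝ, (𝓕 g) ξ *
      Complex.exp (2 * Real.pi * Complex.I * ξ * (-Y : ℝ)) * logDerivLine 0 ξ)) := by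
    refine tendsto_integral_filter_of_dominated_convergence
      (fun ξ => K * (‖(𝓕 g) ξ‖ * (1 + 2 * Real.pi * |ξ|) ^ 8)) ?_ ?_ ?_ ?_
    · filter_upwards [hev] with ε hε using hmeas ε hε.1.le hε.2
    · filter_upwards [hev] with ε hε
      exact Eventually.of_forall fun ξ => hbd ε ξ hε.1.le hε.2
    · exact (integrable_fourier_mul_pow g 8 (2 * Real.pi)).const_mul K
    · refine Eventually.of_forall fun ξ => ?_
      have h1 : ContinuousAt (fun ε : ℝ => logDerivLine ε ξ) 0 := by
        have hv : Continuous (fun ε => vline ε ξ) := by unfold vline; fun_prop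
        have hd : Continuous (deriv riemannZeta₁) :=
          (differentiable_riemannZeta₁.contDiff (n := 1)).continuous_deriv le_rfl
        exact ((hd.comp hv).neg.continuousAt).mul
          ((differentiable_riemannZeta₁.continuous.comp hv).continuousAt.inv₀
          (riemannZeta₁_vline_ne_zero le_rfl zero_le_one ξ))
      exact (h1.tendsto.mono_left nhdsWithin_le_nhds).const_mul _
  refine tendsto_nhds_unique (T1.sub T2) (T3.congr' ?_)
  filter_upwards [hev] with ε hε
  have hA : Integrable (fun ξ : ℝ => (𝓕 g) ξ *
      Complex.exp (2 * Real.pi * Complex.I * ξ * (-Y : ℝ)) * logDerivLine ε ξ) := by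
    refine Integrable.mono' ((integrable_fourier_mul_pow g 8 (2 * Real.pi)).const_mul K)
      (hmeas ε hε.1.le hε.2) ?_
    exact Eventually.of_forall fun ξ => hbd ε ξ hε.1.le hε.2
  have hB : Integrable (fun ξ : ℝ => (𝓕 g) ξ *
      Complex.exp (2 * Real.pi * Complex.I * ξ * (-Y : ℝ)) * (vline ε ξ - 1)⁻¹) := by
    have hre : ∀ ξ, ε ≤ ‖vline ε ξ - 1‖ := by
      intro ξ
      have h := Complex.re_le_norm (vline ε ξ - 1)
      simpa [vline_re] using h
    have hne : ∀ ξ, vline ε ξ - 1 ≠ 0 := fun ξ =>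
      norm_pos_iff.mp (lt_of_lt_of_le hε.1 (hre ξ))
    refine Integrable.mono' ((𝓕 g).integrable.norm.mul_const ε⁻¹) ?_ ?_
    · refine Continuous.aestronglyMeasurable ?_
      have hv : Continuous (fun ξ => vline ε ξ - 1) := by unfold vline; fun_prop
      have h1 := hv.inv₀ hne
      have h2 := (𝓕 g).continuous
      fun_prop
    · refine Eventually.of_forall fun ξ => ?_
      rw [norm_mul, norm_mul, norm_exp_two_pi_I, mul_one, norm_inv]
      gcongr
      · exact hε.1
      · exact hre ξ
  rw [tsum_vonMangoldt_eq_integral g hε.1, integral_exp_mul_schwartz_eq g hε.1, ← integral_sub]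
  · refine integral_congr_ae (Eventually.of_forall fun ξ => ?_)
    simp only
    rw [← LSeries_vonMangoldt_sub_eq_logDerivLine hε.1 hε.2]
    ring
  · refine (hA.add hB).congr (Eventually.of_forall fun ξ => ?_)
    simp only [Pi.add_apply]
    rw [← LSeries_vonMangoldt_sub_eq_logDerivLine hε.1 hε.2]
    ring
  · exact hB

open SchwartzMap FourierTransform ArithmeticFunction in
/-- The prime number theorem tested against a Schwartz function of exponential decay: the error
is smaller than every power of the logarithm. -/
theorem tsum_vonMangoldt_schwartz (g : 𝓢(ℝ, ℂ)) {C c : ℝ} (hc : 0 < c)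
    (hg : ∀ w, ‖g w‖ ≤ C * Real.exp (-(c * |w|))) (A : ℕ) :
    ∃ K : ℝ, ∀ Y : ℝ, 0 < Y →
      ‖∑' n : ℕ, ((vonMangoldt n * (n : ℝ) ^ (-1 : ℝ) : ℝ) : ℂ) * g (Real.log n - Y) -
        ∫ w, g w‖ ≤ K / Y ^ A := by
  -- The error is `ψ Y` up to a tail of `∫ g`, and `ψ` is Schwartz because its multiplier has
  -- temperate growth.
  set ψ : 𝓢(ℝ, ℂ) := 𝓕 (SchwartzMap.smulLeftCLM ℂ (logDerivLine 0) (𝓕 g)) with hψ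
  obtain ⟨D, hD, hdec⟩ := ψ.decay A 0
  refine ⟨D + ∫ w, ‖w‖ ^ A * ‖g w‖, fun Y hY => ?_⟩
  have hYA : 0 < Y ^ A := by positivity
  have h1 : ∫ ξ : ℝ, (𝓕 g) ξ * Complex.exp (2 * Real.pi * Complex.I * ξ * (-Y : ℝ)) *
        logDerivLine 0 ξ = ψ Y := by
    have hψY : ψ Y = 𝓕 (⇑(smulLeftCLM ℂ (logDerivLine 0) (𝓕 g))) Y := rfl
    rw [hψY, Real.fourier_real_eq_integral_exp_smul]
    refine integral_congr_ae (Eventually.of_forall fun ξ => ?_)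
    simp only [smul_eq_mul]
    rw [smulLeftCLM_apply_apply hasTemperateGrowth_logDerivLine, smul_eq_mul]
    have : (2 * Real.pi * Complex.I * ξ * ((-Y : ℝ) : ℂ)) =
      (((-2 * Real.pi * ξ * Y : ℝ) : ℂ)) * Complex.I := by push_cast; ring
    rw [this]
    ring
  have h2 : ‖ψ Y‖ ≤ D / Y ^ A := by
    rw [le_div_iff₀ hYA]
    have := hdec Y
    rw [norm_iteratedFDeriv_zero, Real.norm_eq_abs, abs_of_pos hY] at this
    linarith
  have h3 : ∫ v in Set.Ioi (0 : ℝ), g (v - Y) = ∫ w in Set.Ioi (-Y), g w := by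
    have := (measurePreserving_sub_right (volume : Measure ℝ) Y).setIntegral_preimage_emb
      (MeasurableEquiv.subRight Y).measurableEmbedding g (Set.Ioi (-Y))
    rw [← this]
    congr 2
    ext v; simp
  have h4 : ∫ w, g w = (∫ w in Set.Ioi (-Y), g w) + ∫ w in Set.Iic (-Y), g w := by
    rw [add_comm, intervalIntegral.integral_Iic_add_Ioi g.integrable.integrableOn g.integrable.integrableOn]
  -- On the missing tail `|w| ≥ Y`, so the `A`-th absolute moment pays for `Y^(-A)`.
  have h5 : ‖∫ w in Set.Iic (-Y), g w‖ ≤ (∫ w, ‖w‖ ^ A * ‖g w‖) / Y ^ A := by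
    have hint := g.integrable_pow_mul volume A
    rw [div_eq_mul_inv, ← integral_mul_const]
    refine (norm_integral_le_of_norm_le (hint.mul_const (Y ^ A)⁻¹).integrableOn ?_).trans ?_
    · filter_upwards [ae_restrict_mem measurableSet_Iic] with w hw
      have hw' : Y ≤ ‖w‖ := by
        rw [Real.norm_eq_abs, abs_of_nonpos (by simp at hw; linarith)]
        simp at hw; linarith
      rw [← div_eq_mul_inv, le_div_iff₀ hYA, mul_comm]
      gcongr
    · refine setIntegral_le_integral (hint.mul_const _) (Eventually.of_forall fun w => ?_)
      simp only [Pi.zero_apply]; positivity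
  have h6 := tsum_vonMangoldt_sub_integral_eq g hc hg Y
  rw [h1, h3] at h6
  rw [h4, ← sub_sub, h6, add_div]
  exact (norm_sub_le _ _).trans (add_le_add h2 h5)

/-! ### From prime powers to primes, and the expansion in powers of `1 / Y`. -/

lemma Nat.Primes.pow_add_two_injective :
    Function.Injective (fun q : Nat.Primes × ℕ => (q.1 : ℕ) ^ (q.2 + 2)) := by
  rintro ⟨p, k⟩ ⟨q, l⟩ h
  simp only at h
  have hp : (p : ℕ) = q := by
    have h1 : (p : ℕ) ∣ (q : ℕ) ^ (l + 2) := h ▸ dvd_pow_self _ (by omega)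
    exact (Nat.prime_dvd_prime_iff_eq p.2 q.2).mp (p.2.dvd_of_dvd_pow h1)
  have hpq : p = q := Subtype.ext hp
  subst hpq
  have := Nat.pow_right_injective p.2.two_le h
  simp at this
  simp [this]

open ArithmeticFunction in
-- Only the powers `p^(k+2)` contribute, and `log p ≤ 4 p^(1/4)` leaves `p^(-5/4)` times a geometric
-- factor. The exponent `3/4` instead of `1` leaves room for a factor `n^(1/4)`, whence the
-- restriction `c ≤ 1/4` in `ExpDecay`.
lemma summable_vonMangoldt_not_prime :
    Summable (fun n : ℕ => if n.Prime then 0 else vonMangoldt n * (n : ℝ) ^ (-(3 / 4) : ℝ)) := by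
  rw [← Nat.Primes.pow_add_two_injective.summable_iff]
  · have h1 : Summable (fun p : Nat.Primes => 4 * ((p : ℕ) : ℝ) ^ (-(5 / 4) : ℝ)) :=
      (Nat.Primes.summable_rpow.mpr (by norm_num)).mul_left 4
    have h2 : Summable (fun k : ℕ => ((2 : ℝ) ^ (-(3 / 4) : ℝ)) ^ k) :=
      summable_geometric_of_lt_one (by positivity)
        (Real.rpow_lt_one_of_one_lt_of_neg (by norm_num) (by norm_num))
    have h3 := h1.mul_of_nonneg h2 (fun p => by positivity) (fun k => by positivity)
    refine Summable.of_nonneg_of_le (fun q => ?_) (fun q => ?_) h3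
    · have := vonMangoldt_nonneg (n := (q.1 : ℕ) ^ (q.2 + 2))
      simp only [Function.comp_apply]
      split_ifs <;> positivity
    · obtain ⟨p, k⟩ := q
      have hp0 : (0 : ℝ) < (p : ℕ) := by exact_mod_cast p.2.pos
      have hp2 : (2 : ℝ) ≤ (p : ℕ) := by exact_mod_cast p.2.two_le
      simp only [Function.comp_apply]
      rw [if_neg (Nat.Prime.not_prime_pow (by omega)), vonMangoldt_apply_pow (by omega),
        vonMangoldt_apply_prime p.2]
      have hlog : Real.log (p : ℕ) ≤ 4 * ((p : ℕ) : ℝ) ^ (1 / 4 : ℝ) := by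
        refine (Real.log_le_rpow_div hp0.le (ε := 1 / 4) (by norm_num)).trans_eq ?_
        ring
      have e : (((p : ℕ) ^ (k + 2) : ℕ) : ℝ) ^ (-(3 / 4) : ℝ) =
          ((p : ℕ) : ℝ) ^ (-(3 / 2) : ℝ) * (((p : ℕ) : ℝ) ^ (-(3 / 4) : ℝ)) ^ k := by
        push_cast
        rw [← Real.rpow_natCast, ← Real.rpow_natCast, ← Real.rpow_mul hp0.le,
          ← Real.rpow_mul hp0.le, ← Real.rpow_add hp0]
        congr 1
        push_cast
        ring
      rw [e]
      calc Real.log (p : ℕ) * (((p : ℕ) : ℝ) ^ (-(3 / 2) : ℝ) * (((p : ℕ) : ℝ) ^ (-(3 / 4) : ℝ)) ^ k)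
          ≤ (4 * ((p : ℕ) : ℝ) ^ (1 / 4 : ℝ)) *
            (((p : ℕ) : ℝ) ^ (-(3 / 2) : ℝ) * ((2 : ℝ) ^ (-(3 / 4) : ℝ)) ^ k) := by
            have h4 : ((p : ℕ) : ℝ) ^ (-(3 / 4) : ℝ) ≤ (2 : ℝ) ^ (-(3 / 4) : ℝ) := by
              exact Real.rpow_le_rpow_of_nonpos (by norm_num) hp2 (by norm_num)
            gcongr
        _ = 4 * (((p : ℕ) : ℝ) ^ (1 / 4 : ℝ) * ((p : ℕ) : ℝ) ^ (-(3 / 2) : ℝ)) *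
            ((2 : ℝ) ^ (-(3 / 4) : ℝ)) ^ k := by ring
        _ = _ := by
          rw [← Real.rpow_add hp0]; norm_num
  · intro n hn
    split_ifs with hp
    · rfl
    · have : vonMangoldt n = 0 := by
        rw [vonMangoldt_eq_zero_iff]
        intro hpp
        obtain ⟨p, k, hp', hk, rfl⟩ := (isPrimePow_nat_iff n).mp hpp
        rcases Nat.lt_or_ge k 2 with hk2 | hk2
        · have : k = 1 := by omega
          subst this
          exact hp (by simpa using hp')
        · exact hn ⟨(⟨p, hp'⟩, k - 2), by simp only; congr 1; omega⟩
      rw [this, zero_mul]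

/-- A function bounded by `C exp (-c |w|)` for some `C` and some `c > 0`. -/
def ExpDecay (g : ℝ → ℂ) : Prop :=
  ∃ C c : ℝ, 0 < c ∧ c ≤ 1 / 4 ∧ ∀ w, ‖g w‖ ≤ C * Real.exp (-(c * |w|))

lemma exp_neg_le_factorial_div_pow {y : ℝ} (hy : 0 < y) (A : ℕ) :
    Real.exp (-y) ≤ A ! / y ^ A := by
  rw [Real.exp_neg, inv_le_comm₀ (Real.exp_pos _) (by positivity), inv_div]
  exact Real.pow_div_factorial_le_exp y hy.le A

lemma ExpDecay.pow_mul {g : ℝ → ℂ} (hg : ExpDecay g) (n : ℕ) :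
    ExpDecay (fun w => (-(w : ℂ)) ^ n * g w) := by
  obtain ⟨C, c, hc, hc4, h⟩ := hg
  have hC : 0 ≤ C := by simpa using (norm_nonneg _).trans (h 0)
  refine ⟨n ! / (c / 2) ^ n * C, c / 2, by positivity, by linarith, fun w => ?_⟩
  rw [norm_mul, norm_pow, norm_neg, Complex.norm_real, Real.norm_eq_abs]
  have h1 : |w| ^ n ≤ n ! / (c / 2) ^ n * Real.exp (c / 2 * |w|) := by
    have := Real.pow_div_factorial_le_exp (c / 2 * |w|) (by positivity) n
    rw [mul_pow, div_le_iff₀ (by positivity)] at this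
    rw [div_mul_eq_mul_div, le_div_iff₀ (by positivity)]
    linarith
  calc |w| ^ n * ‖g w‖ ≤ (n ! / (c / 2) ^ n * Real.exp (c / 2 * |w|)) * (C * Real.exp (-(c * |w|))) := by
        gcongr; exact h w
    _ = n ! / (c / 2) ^ n * C * (Real.exp (c / 2 * |w|) * Real.exp (-(c * |w|))) := by ring
    _ = _ := by rw [← Real.exp_add]; ring_nf

open ArithmeticFunction in
-- The sum is `-ζ'/ζ(1+ε)`, which is `1/ε` plus a bounded quantity: the bound for the logarithmic
-- derivative at `ξ = 0`.
lemma tsum_vonMangoldt_rpow_le :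
    ∃ K : ℝ, 0 ≤ K ∧ ∀ ε : ℝ, 0 < ε → ε ≤ 1 →
      ∑' n : ℕ, vonMangoldt n * (n : ℝ) ^ (-(1 + ε)) ≤ K + 1 / ε := by
  obtain ⟨K, hK⟩ := norm_logDerivLine_le
  refine ⟨|K|, abs_nonneg K, fun ε h0 h1 => ?_⟩
  have h2 := LSeries_vonMangoldt_sub_eq_logDerivLine h0 h1 0
  have h3 : LSeries (fun n => (vonMangoldt n : ℂ)) (vline ε 0) =
      ((∑' n : ℕ, vonMangoldt n * (n : ℝ) ^ (-(1 + ε)) : ℝ) : ℂ) := by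
    rw [Complex.ofReal_tsum]
    unfold LSeries
    refine tsum_congr fun n => ?_
    rw [LSeries_term_vline]
    simp
  have h4 : (vline ε 0 - 1)⁻¹ = ((1 / ε : ℝ) : ℂ) := by simp [vline]
  rw [h3, h4, ← Complex.ofReal_sub] at h2
  have h5 := hK ε 0 h0.le h1
  rw [← h2, Complex.norm_real, Real.norm_eq_abs] at h5
  rw [abs_zero, mul_zero, add_zero, one_pow, mul_one] at h5
  have := (le_abs_self _).trans h5
  have := le_abs_self K
  linarith

open ArithmeticFunction in
-- Rankin's trick with `ε = c / Y`: since `Y ≥ 1`, the decay of `g` gives a factor `e^c n^(-c/Y)`.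
-- The bound loses a factor `Y`, but it serves only for a remainder that can be expanded further.
lemma tsum_vonMangoldt_mul_norm_le {g : ℝ → ℂ} (hg : ExpDecay g) :
    ∃ K : ℝ, 0 ≤ K ∧ ∀ Y : ℝ, 1 ≤ Y →
      ∑' n : ℕ, vonMangoldt n * (n : ℝ) ^ (-1 : ℝ) * ‖g (Real.log n - Y)‖ ≤ K * Y := by
  obtain ⟨C, c, hc, hc4, h⟩ := hg
  have hC : 0 ≤ C := by simpa using (norm_nonneg _).trans (h 0)
  obtain ⟨K, hK0, hK⟩ := tsum_vonMangoldt_rpow_le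
  refine ⟨C * Real.exp c * (K + 1 / c), by positivity, fun Y hY => ?_⟩
  have hY0 : 0 < Y := by linarith
  have hε : 0 < c / Y := by positivity
  have hε1 : c / Y ≤ c := div_le_self hc.le hY
  have hs := (summable_vonMangoldt_rpow hε).mul_left (C * Real.exp c)
  calc ∑' n : ℕ, vonMangoldt n * (n : ℝ) ^ (-1 : ℝ) * ‖g (Real.log n - Y)‖
      ≤ ∑' n : ℕ, C * Real.exp c * (vonMangoldt n * (n : ℝ) ^ (-(1 + c / Y))) := by
        refine Summable.tsum_le_tsum (fun n => ?_) (summable_vonMangoldt_div_mul hc h Y) hs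
        rcases eq_or_ne n 0 with rfl | hn
        · simp
        have hn0 : (0 : ℝ) < n := by positivity
        have h2 := vonMangoldt_nonneg (n := n)
        have h3 : ‖g (Real.log n - Y)‖ ≤ C * (Real.exp c * (n : ℝ) ^ (-(c / Y))) := by
          refine (h _).trans ?_
          rw [Real.rpow_def_of_pos hn0, ← Real.exp_add]
          gcongr
          have e : c + Real.log n * -(c / Y) = -((c / Y) * (Real.log n - Y)) := by
            field_simp; ring
          rw [e, neg_le_neg_iff]
          calc c / Y * (Real.log n - Y) ≤ c / Y * |Real.log n - Y| := by gcongr; exact le_abs_self _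
            _ ≤ c * |Real.log n - Y| := by gcongr
        calc vonMangoldt n * (n : ℝ) ^ (-1 : ℝ) * ‖g (Real.log n - Y)‖
            ≤ vonMangoldt n * (n : ℝ) ^ (-1 : ℝ) * (C * (Real.exp c * (n : ℝ) ^ (-(c / Y)))) := by
              gcongr
          _ = C * Real.exp c * (vonMangoldt n * ((n : ℝ) ^ (-1 : ℝ) * (n : ℝ) ^ (-(c / Y)))) := by
              ring
          _ = _ := by rw [← Real.rpow_add hn0]; ring_nf
    _ = C * Real.exp c * ∑' n : ℕ, (vonMangoldt n * (n : ℝ) ^ (-(1 + c / Y))) := tsum_mul_left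
    _ ≤ C * Real.exp c * (K + 1 / (c / Y)) := by
        gcongr; exact hK _ hε (by linarith)
    _ ≤ C * Real.exp c * ((K + 1 / c) * Y) := by
        gcongr
        have : 1 / (c / Y) = 1 / c * Y := by field_simp
        rw [this, add_mul]
        gcongr
        nlinarith
    _ = _ := by ring

/-- `(log p / p) g (log p - Y)`. -/
noncomputable def primeTerm (g : ℝ → ℂ) (Y : ℝ) (p : Nat.Primes) : ℂ :=
  ((Real.log (p : ℕ) * ((p : ℕ) : ℝ) ^ (-1 : ℝ) : ℝ) : ℂ) * g (Real.log (p : ℕ) - Y)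

open ArithmeticFunction in
lemma norm_primeTerm (g : ℝ → ℂ) (Y : ℝ) (p : Nat.Primes) : ‖primeTerm g Y p‖ =
    vonMangoldt (p : ℕ) * ((p : ℕ) : ℝ) ^ (-1 : ℝ) * ‖g (Real.log (p : ℕ) - Y)‖ := by
  unfold primeTerm
  rw [norm_mul, Complex.norm_real, vonMangoldt_apply_prime p.2, Real.norm_eq_abs,
    abs_of_nonneg (mul_nonneg (Real.log_nonneg (by exact_mod_cast p.2.one_le)) (by positivity))]

open ArithmeticFunction in
lemma ExpDecay.summable_norm_primeTerm {g : ℝ → ℂ} (hg : ExpDecay g) (Y : ℝ) :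
    Summable fun p => ‖primeTerm g Y p‖ := by
  obtain ⟨C, c, hc, hc4, h⟩ := hg
  simp_rw [norm_primeTerm]
  exact (summable_vonMangoldt_div_mul hc h Y).comp_injective Subtype.val_injective

open ArithmeticFunction in
lemma tsum_norm_primeTerm_le {g : ℝ → ℂ} (hg : ExpDecay g) :
    ∃ K : ℝ, 0 ≤ K ∧ ∀ Y : ℝ, 1 ≤ Y → ∑' p, ‖primeTerm g Y p‖ ≤ K * Y := by
  obtain ⟨K, hK0, hK⟩ := tsum_vonMangoldt_mul_norm_le hg
  obtain ⟨C, c, hc, hc4, h⟩ := hg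
  refine ⟨K, hK0, fun Y hY => le_trans ?_ (hK Y hY)⟩
  simp_rw [norm_primeTerm]
  exact tsum_comp_le_tsum_of_inj (summable_vonMangoldt_div_mul hc h Y)
    (fun n => by have := vonMangoldt_nonneg (n := n); positivity) Subtype.val_injective

open ArithmeticFunction in
-- Since `c ≤ 1/4`, `|g (log n - Y)| ≪ e^(-cY) n^(1/4)`. The higher prime powers therefore
-- contribute `O(e^(-cY))`.
lemma tsum_vonMangoldt_sub_tsum_primeTerm {g : ℝ → ℂ} (hg : ExpDecay g) (A : ℕ) :
    ∃ K : ℝ, ∀ Y : ℝ, 0 < Y →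
      ‖∑' n : ℕ, ((vonMangoldt n * (n : ℝ) ^ (-1 : ℝ) : ℝ) : ℂ) * g (Real.log n - Y) -
        ∑' p, primeTerm g Y p‖ ≤ K / Y ^ A := by
  obtain ⟨C, c, hc, hc4, h⟩ := hg
  have hC : 0 ≤ C := by simpa using (norm_nonneg _).trans (h 0)
  set S := ∑' n : ℕ, if n.Prime then 0 else vonMangoldt n * (n : ℝ) ^ (-(3 / 4) : ℝ) with hS
  have hS0 : 0 ≤ S := tsum_nonneg fun n => by
    have := vonMangoldt_nonneg (n := n)
    split_ifs <;> positivity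
  refine ⟨C * S * (A ! / c ^ A), fun Y hY => ?_⟩
  set f : ℕ → ℂ := fun n => ((vonMangoldt n * (n : ℝ) ^ (-1 : ℝ) : ℝ) : ℂ) * g (Real.log n - Y)
    with hf
  have hfn : ∀ n, ‖f n‖ = vonMangoldt n * (n : ℝ) ^ (-1 : ℝ) * ‖g (Real.log n - Y)‖ := by
    intro n
    have := vonMangoldt_nonneg (n := n)
    rw [hf, norm_mul, Complex.norm_real, Real.norm_eq_abs, abs_of_nonneg (by positivity)]
  have hfs : Summable f := by
    refine Summable.of_norm ?_
    simp_rw [hfn]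
    exact summable_vonMangoldt_div_mul hc h Y
  have h1 : ∑' p, primeTerm g Y p = ∑' n : {n : ℕ | n.Prime}, f n := by
    refine tsum_congr fun p => ?_
    simp only [hf, primeTerm]
    rw [vonMangoldt_apply_prime p.2]
  rw [h1, ← hfs.tsum_subtype_add_tsum_subtype_compl {n : ℕ | n.Prime}, add_sub_cancel_left,
    tsum_subtype]
  have hb : ∀ n, ‖Set.indicator {n : ℕ | n.Prime}ᶜ f n‖ ≤
      C * Real.exp (-(c * Y)) *
        (if n.Prime then 0 else vonMangoldt n * (n : ℝ) ^ (-(3 / 4) : ℝ)) := by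
    intro n
    by_cases hn : n.Prime
    · rw [Set.indicator_of_notMem (by simpa using hn), if_pos hn]; simp
    · rw [Set.indicator_of_mem (by simpa using hn), if_neg hn, hfn]
      rcases eq_or_ne n 0 with rfl | hn1
      · simp
      have hn0 : (0 : ℝ) < n := by positivity
      have hn1 : (1 : ℝ) ≤ n := by exact_mod_cast Nat.one_le_iff_ne_zero.mpr hn1
      have h2 := vonMangoldt_nonneg (n := n)
      have h3 : ‖g (Real.log n - Y)‖ ≤ C * (Real.exp (-(c * Y)) * (n : ℝ) ^ (1 / 4 : ℝ)) := by
        refine (h _).trans ?_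
        rw [Real.rpow_def_of_pos hn0, ← Real.exp_add]
        gcongr
        have h4 := neg_abs_le (Real.log n - Y)
        have h5 := Real.log_nonneg hn1
        nlinarith
      calc vonMangoldt n * (n : ℝ) ^ (-1 : ℝ) * ‖g (Real.log n - Y)‖
          ≤ vonMangoldt n * (n : ℝ) ^ (-1 : ℝ) *
            (C * (Real.exp (-(c * Y)) * (n : ℝ) ^ (1 / 4 : ℝ))) := by gcongr
        _ = C * Real.exp (-(c * Y)) * (vonMangoldt n * ((n : ℝ) ^ (-1 : ℝ) * (n : ℝ) ^ (1 / 4 : ℝ))) := by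
            ring
        _ = _ := by rw [← Real.rpow_add hn0]; norm_num
  refine (tsum_of_norm_bounded (summable_vonMangoldt_not_prime.mul_left _).hasSum hb).trans ?_
  rw [tsum_mul_left, ← hS]
  have h6 := exp_neg_le_factorial_div_pow (y := c * Y) (by positivity) A
  calc C * Real.exp (-(c * Y)) * S ≤ C * (A ! / (c * Y) ^ A) * S := by gcongr
    _ = _ := by rw [mul_pow]; field_simp

open SchwartzMap in
lemma tsum_primeTerm_sub_integral (g : 𝓢(ℝ, ℂ)) (hg : ExpDecay g) (A : ℕ) :
    ∃ K : ℝ, ∀ Y : ℝ, 0 < Y → ‖∑' p, primeTerm g Y p - ∫ w, g w‖ ≤ K / Y ^ A := by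
  obtain ⟨K1, h1⟩ := tsum_vonMangoldt_sub_tsum_primeTerm hg A
  obtain ⟨C, c, hc, hc4, h⟩ := hg
  obtain ⟨K2, h2⟩ := tsum_vonMangoldt_schwartz g hc h A
  refine ⟨K1 + K2, fun Y hY => ?_⟩
  have h3 := h1 Y hY
  have h4 := h2 Y hY
  rw [norm_sub_rev] at h3
  rw [add_div]
  refine le_trans ?_ (add_le_add h3 h4)
  refine le_trans (le_of_eq ?_) (norm_add_le _ _)
  congr 1
  ring

/-- A geometric sum with its exact remainder: `w / Y` need not be small, so it can be used at every
prime. -/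
lemma one_div_add_eq_sum {Y w : ℂ} (hY : Y ≠ 0) (hYw : Y + w ≠ 0) (M : ℕ) :
    1 / (Y + w) = ∑ n ∈ Finset.range M, (-w) ^ n / Y ^ (n + 1) +
      (-w) ^ M / (Y ^ M * (Y + w)) := by
  induction M with
  | zero => simp
  | succ M ih =>
    rw [Finset.sum_range_succ, ih, add_assoc]
    congr 1
    field_simp
    ring

open SchwartzMap in
/-- The asymptotic expansion of a sum over primes `∑ p⁻¹ g (log p - Y)` in powers of `1 / Y`. -/
theorem tsum_primes_expansion (g : 𝓢(ℝ, ℂ)) (hg : ExpDecay g) (N : ℕ) :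
    ∃ K : ℝ, ∀ Y : ℝ, 1 ≤ Y →
      ‖∑' p : Nat.Primes, ((((p : ℕ) : ℝ) ^ (-1 : ℝ) : ℝ) : ℂ) * g (Real.log (p : ℕ) - Y) -
        ∑ n ∈ Finset.range (N + 1), (∫ w : ℝ, (-(w : ℂ)) ^ n * g w) / (Y : ℂ) ^ (n + 1)‖
        ≤ K / Y ^ (N + 2) := by
  have hpow : ∀ n : ℕ, Function.HasTemperateGrowth (fun w : ℝ => (-(w : ℂ)) ^ n) := fun n =>
    (Function.HasTemperateGrowth.neg Function.Complex.hasTemperateGrowth_ofReal).pow n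
  set G : ℕ → 𝓢(ℝ, ℂ) := fun n => smulLeftCLM ℂ (fun w : ℝ => (-(w : ℂ)) ^ n) g with hG
  have hGw : ∀ n w, G n w = (-(w : ℂ)) ^ n * g w := by
    intro n w
    rw [hG]
    simp only
    rw [smulLeftCLM_apply_apply (hpow n), smul_eq_mul]
  have hGe : ∀ n, ExpDecay (G n) := by
    intro n
    have : (G n : ℝ → ℂ) = fun w : ℝ => (-(w : ℂ)) ^ n * g w := funext (hGw n)
    rw [this]
    exact hg.pow_mul n
  -- The remainder is `O(Y · Y^(-M))`, as the crude bound loses a factor `Y`; this choice makes it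
  -- `O(Y^(-N-2))`.
  set M := N + 3 with hM
  choose K hK using fun n => tsum_primeTerm_sub_integral (G n) (hGe n) (N + 2)
  obtain ⟨R, hR0, hR⟩ := tsum_norm_primeTerm_le (hGe M)
  have hK0 : ∀ n, 0 ≤ K n := fun n => by
    have := (norm_nonneg _).trans (hK n 1 one_pos)
    simpa using this
  set I : ℕ → ℂ := fun n => ∫ w : ℝ, G n w with hI
  refine ⟨∑ n ∈ Finset.range M, K n + (‖I (N + 1)‖ + ‖I (N + 2)‖) + R / Real.log 2, fun Y hY => ?_⟩
  have hY0 : 0 < Y := by linarith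
  have hYc : (Y : ℂ) ≠ 0 := by exact_mod_cast hY0.ne'
  have hl2 : 0 < Real.log 2 := Real.log_pos (by norm_num)
  set Rm : Nat.Primes → ℂ := fun p => primeTerm (G M) Y p / ((Y : ℂ) ^ M * Real.log (p : ℕ)) with hRm
  -- The weight is `p⁻¹ = (log p / p) · (1 / log p)` with `log p = Y + w`, where `w = log p - Y` is
  -- the argument of `g`. Powers of `w` are absorbed into the test functions `G n`.
  have hterm : ∀ p : Nat.Primes,
      ((((p : ℕ) : ℝ) ^ (-1 : ℝ) : ℝ) : ℂ) * g (Real.log (p : ℕ) - Y) =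
      ∑ n ∈ Finset.range M, primeTerm (G n) Y p / (Y : ℂ) ^ (n + 1) + Rm p := by
    intro p
    have hlp : 0 < Real.log (p : ℕ) := Real.log_pos (by exact_mod_cast p.2.one_lt)
    have hlc : (Real.log (p : ℕ) : ℂ) ≠ 0 := by exact_mod_cast hlp.ne'
    have e : (Y : ℂ) + ((Real.log (p : ℕ) - Y : ℝ) : ℂ) = Real.log (p : ℕ) := by
      push_cast; ring
    have h := one_div_add_eq_sum (w := ((Real.log (p : ℕ) - Y : ℝ) : ℂ)) hYc (by rwa [e]) M
    rw [e] at h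
    have h2 : ((((p : ℕ) : ℝ) ^ (-1 : ℝ) : ℝ) : ℂ) * g (Real.log (p : ℕ) - Y) =
        primeTerm g Y p * (1 / (Real.log (p : ℕ) : ℂ)) := by
      unfold primeTerm
      rw [Complex.ofReal_mul]
      field_simp
    rw [h2, h, mul_add, Finset.mul_sum]
    congr 1
    · refine Finset.sum_congr rfl fun n _ => ?_
      unfold primeTerm
      rw [hGw]
      ring
    · simp only [hRm]
      unfold primeTerm
      rw [hGw]
      ring
  have hRn : ∀ p, ‖Rm p‖ ≤ ‖primeTerm (G M) Y p‖ * (1 / (Y ^ M * Real.log 2)) := by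
    intro p
    have hlp : Real.log 2 ≤ Real.log (p : ℕ) :=
      Real.log_le_log (by norm_num) (by exact_mod_cast p.2.two_le)
    simp only [hRm]
    rw [norm_div, norm_mul, norm_pow, Complex.norm_real, Complex.norm_real, Real.norm_eq_abs,
      Real.norm_eq_abs, abs_of_pos hY0, abs_of_pos (by linarith), div_eq_mul_one_div]
    gcongr
  have hRs : Summable Rm :=
    Summable.of_norm_bounded (((hGe M).summable_norm_primeTerm Y).mul_right _) hRn
  have hRt : ‖∑' p, Rm p‖ ≤ R / Real.log 2 / Y ^ (N + 2) := by
    refine (tsum_of_norm_bounded (((hGe M).summable_norm_primeTerm Y).mul_right _).hasSum hRn).trans ?_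
    rw [tsum_mul_right]
    calc _ ≤ R * Y * (1 / (Y ^ M * Real.log 2)) := by gcongr; exact hR Y hY
      _ = _ := by rw [hM]; field_simp; ring
  have hsn : ∀ n ∈ Finset.range M, Summable fun p => primeTerm (G n) Y p / (Y : ℂ) ^ (n + 1) :=
    fun n _ => ((hGe n).summable_norm_primeTerm Y).of_norm.div_const _
  simp_rw [hterm]
  rw [(summable_sum hsn).tsum_add hRs, Summable.tsum_finsetSum hsn]
  simp_rw [tsum_div_const]
  have hIe : ∀ n, ∫ w : ℝ, (-(w : ℂ)) ^ n * g w = I n := fun n => by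
    simp only [hI]; simp_rw [hGw]
  simp_rw [hIe]
  have hsplit : ∑ n ∈ Finset.range M, (∑' p, primeTerm (G n) Y p) / (Y : ℂ) ^ (n + 1) + ∑' p, Rm p -
      ∑ n ∈ Finset.range (N + 1), I n / (Y : ℂ) ^ (n + 1) =
      ∑ n ∈ Finset.range M, (∑' p, primeTerm (G n) Y p - I n) / (Y : ℂ) ^ (n + 1) +
      (I (N + 1) / (Y : ℂ) ^ (N + 2) + I (N + 2) / (Y : ℂ) ^ (N + 3)) + ∑' p, Rm p := by
    have : ∑ n ∈ Finset.range M, I n / (Y : ℂ) ^ (n + 1) =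
        ∑ n ∈ Finset.range (N + 1), I n / (Y : ℂ) ^ (n + 1) +
        I (N + 1) / (Y : ℂ) ^ (N + 2) + I (N + 2) / (Y : ℂ) ^ (N + 3) := by
      rw [hM, Finset.sum_range_succ, Finset.sum_range_succ]
    simp_rw [sub_div]
    rw [Finset.sum_sub_distrib, this]
    ring
  rw [hsplit, add_div, add_div]
  refine (norm_add_le _ _).trans (add_le_add ((norm_add_le _ _).trans (add_le_add ?_ ?_)) hRt)
  · refine (norm_sum_le _ _).trans ?_
    rw [Finset.sum_div]
    refine Finset.sum_le_sum fun n _ => ?_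
    rw [norm_div, norm_pow, Complex.norm_real, Real.norm_eq_abs, abs_of_pos hY0]
    refine (div_le_self (norm_nonneg _) (one_le_pow₀ hY)).trans (hK n Y hY0)
  · rw [add_div]
    refine (norm_add_le _ _).trans (add_le_add ?_ ?_)
    · rw [norm_div, norm_pow, Complex.norm_real, Real.norm_eq_abs, abs_of_pos hY0]
    · rw [norm_div, norm_pow, Complex.norm_real, Real.norm_eq_abs, abs_of_pos hY0]
      gcongr
      omega

/-! ### Cumulants of bounded variables through moments of the tilted law. -/

/-- The recursion that links a sequence `k` of cumulants to the sequence `μ` of moments. -/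
def CumulantRec (k μ : ℕ → ℝ) : Prop :=
  ∀ m, k (m + 1) = μ (m + 1) - ∑ i ∈ Finset.range m, (m.choose i : ℝ) * k (i + 1) * μ (m - i)

/-- The recursion is homogeneous when `k j` and `μ j` have weight `j`, so a scale `s` passes from
moments to cumulants, with a constant depending only on `B` and `m`. -/
lemma CumulantRec.abs_le (B : ℕ → ℝ) (m : ℕ) : ∃ C : ℝ, 0 ≤ C ∧ ∀ (k μ : ℕ → ℝ) (s : ℝ),
    CumulantRec k μ → 0 ≤ s → (∀ j, |μ j| ≤ B j * s ^ j) → |k (m + 1)| ≤ C * s ^ (m + 1) := by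
  induction m using Nat.strong_induction_on with
  | _ m ih =>
    choose! C hC0 hC using ih
    refine ⟨|B (m + 1)| + ∑ i ∈ Finset.range m, (m.choose i : ℝ) * |C i| * |B (m - i)|,
      by positivity, fun k μ s hk hs hμ => ?_⟩
    rw [hk m, add_mul, Finset.sum_mul]
    refine (abs_sub _ _).trans (add_le_add ((hμ _).trans ?_)
      ((Finset.abs_sum_le_sum_abs _ _).trans (Finset.sum_le_sum fun i hi => ?_)))
    · gcongr; exact le_abs_self _
    · have hi' : i < m := Finset.mem_range.mp hi
      have h1 := hC i hi' k μ s hk hs hμ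
      have h2 := hμ (m - i)
      rw [abs_mul, abs_mul, Nat.abs_cast]
      have e : s ^ (m + 1) = s ^ (i + 1) * s ^ (m - i) := by rw [← pow_add]; congr 1; omega
      calc (m.choose i : ℝ) * |k (i + 1)| * |μ (m - i)|
          ≤ (m.choose i : ℝ) * (|C i| * s ^ (i + 1)) * (|B (m - i)| * s ^ (m - i)) := by
            gcongr
            · exact h1.trans (by gcongr; exact le_abs_self _)
            · exact h2.trans (by gcongr; exact le_abs_self _)
        _ = _ := by rw [e]; ring

/-- The Lipschitz version: each product in the recursion is changed one factor at a time, so a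
relative error `ε` in the moments persists in the cumulants. -/
lemma CumulantRec.abs_sub_le (B : ℕ → ℝ) (m : ℕ) : ∃ C : ℝ, 0 ≤ C ∧ ∀ (k μ k' μ' : ℕ → ℝ) (s ε : ℝ),
    CumulantRec k μ → CumulantRec k' μ' → 0 ≤ s → 0 ≤ ε → (∀ j, |μ j| ≤ B j * s ^ j) →
    (∀ j, |μ' j| ≤ B j * s ^ j) → (∀ j, |μ j - μ' j| ≤ B j * s ^ j * ε) →
    |k (m + 1) - k' (m + 1)| ≤ C * s ^ (m + 1) * ε := by
  induction m using Nat.strong_induction_on with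
  | _ m ih =>
    choose! C hC0 hC using ih
    choose D hD0 hD using fun m => CumulantRec.abs_le B m
    refine ⟨|B (m + 1)| + ∑ i ∈ Finset.range m, (m.choose i : ℝ) * (|C i| + D i) * |B (m - i)|,
      ?_, fun k μ k' μ' s ε hk hk' hs hε hμ hμ' hd => ?_⟩
    · refine add_nonneg (abs_nonneg (B (m + 1))) (Finset.sum_nonneg fun i _ => ?_)
      have := hD0 i
      positivity
    have e0 : k (m + 1) - k' (m + 1) = (μ (m + 1) - μ' (m + 1)) -
        ∑ i ∈ Finset.range m, (m.choose i : ℝ) *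
          ((k (i + 1) - k' (i + 1)) * μ (m - i) + k' (i + 1) * (μ (m - i) - μ' (m - i))) := by
      have : ∑ i ∈ Finset.range m, (m.choose i : ℝ) *
          ((k (i + 1) - k' (i + 1)) * μ (m - i) + k' (i + 1) * (μ (m - i) - μ' (m - i))) =
          ∑ i ∈ Finset.range m, (m.choose i : ℝ) * k (i + 1) * μ (m - i) -
          ∑ i ∈ Finset.range m, (m.choose i : ℝ) * k' (i + 1) * μ' (m - i) := by
        rw [← Finset.sum_sub_distrib]
        exact Finset.sum_congr rfl fun i _ => by ring
      rw [hk m, hk' m, this]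
      ring
    rw [e0, add_mul, add_mul, Finset.sum_mul, Finset.sum_mul]
    refine (abs_sub _ _).trans (add_le_add ((hd _).trans ?_)
      ((Finset.abs_sum_le_sum_abs _ _).trans (Finset.sum_le_sum fun i hi => ?_)))
    · gcongr; exact le_abs_self _
    · have hi' : i < m := Finset.mem_range.mp hi
      have h1 := hC i hi' k μ k' μ' s ε hk hk' hs hε hμ hμ' hd
      have h2 := hμ (m - i)
      have h3 := hD i k' μ' s hk' hs hμ'
      have h4 := hd (m - i)
      rw [abs_mul, Nat.abs_cast]
      have e : s ^ (m + 1) = s ^ (i + 1) * s ^ (m - i) := by rw [← pow_add]; congr 1; omega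
      have h5 : |(k (i + 1) - k' (i + 1)) * μ (m - i) + k' (i + 1) * (μ (m - i) - μ' (m - i))| ≤
          (|C i| * s ^ (i + 1) * ε) * (|B (m - i)| * s ^ (m - i)) +
          (D i * s ^ (i + 1)) * (|B (m - i)| * s ^ (m - i) * ε) := by
        refine (abs_add_le _ _).trans ?_
        rw [abs_mul, abs_mul]
        have := hD0 i
        gcongr
        · exact h1.trans (by gcongr; exact le_abs_self _)
        · exact h2.trans (by gcongr; exact le_abs_self _)
        · exact h4.trans (by gcongr; exact le_abs_self _)
      refine (mul_le_mul_of_nonneg_left h5 (Nat.cast_nonneg _)).trans_eq ?_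
      rw [e]
      ring

lemma abs_integral_le_of_abs_le {Ω : Type*} [MeasurableSpace Ω] {μ : Measure Ω}
    {f g : Ω → ℝ} (hg : Integrable g μ) (h : ∀ ω, |f ω| ≤ g ω) :
    |∫ ω, f ω ∂μ| ≤ ∫ ω, g ω ∂μ :=
  (Real.norm_eq_abs _).symm.trans_le (norm_integral_le_of_norm_le hg (Eventually.of_forall h))

section BoundedMgf

variable {Ω : Type*} [MeasurableSpace Ω] {μ : Measure Ω} [IsProbabilityMeasure μ] {Y : Ω → ℝ}
  {B : ℝ}

/-- The moments of `Y` under the exponentially tilted measure. -/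
noncomputable def tiltedMoment (Y : Ω → ℝ) (μ : Measure Ω) (t : ℝ) (j : ℕ) : ℝ :=
  (∫ ω, Y ω ^ j * Real.exp (t * Y ω) ∂μ) / mgf Y μ t

lemma integrable_exp_mul_of_abs_le (hY : Measurable Y) (hB : ∀ ω, |Y ω| ≤ B) (t : ℝ) :
    Integrable (fun ω => Real.exp (t * Y ω)) μ :=
  integrable_exp_mul_of_mem_Icc (a := -B) (b := B) hY.aemeasurable
    (Eventually.of_forall fun ω => abs_le.mp (hB ω))

lemma integrable_pow_mul_exp_of_abs_le (hY : Measurable Y) (hB : ∀ ω, |Y ω| ≤ B) (t : ℝ) (j : ℕ) :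
    Integrable (fun ω => Y ω ^ j * Real.exp (t * Y ω)) μ := by
  refine Integrable.mono' ((integrable_exp_mul_of_abs_le (μ := μ) hY hB t).const_mul (B ^ j)) ?_ ?_
  · exact Measurable.aestronglyMeasurable (by fun_prop)
  · refine Eventually.of_forall fun ω => ?_
    rw [norm_mul, norm_pow, Real.norm_eq_abs, Real.norm_eq_abs, abs_of_pos (Real.exp_pos _)]
    gcongr
    exact hB ω

lemma interior_integrableExpSet_of_abs_le (hY : Measurable Y) (hB : ∀ ω, |Y ω| ≤ B) :
    interior (integrableExpSet Y μ) = Set.univ := by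
  have : integrableExpSet Y μ = Set.univ :=
    Set.eq_univ_of_forall fun t => integrable_exp_mul_of_abs_le hY hB t
  rw [this, interior_univ]

lemma mgf_pos_of_abs_le (hY : Measurable Y) (hB : ∀ ω, |Y ω| ≤ B) (t : ℝ) : 0 < mgf Y μ t :=
  mgf_pos (integrable_exp_mul_of_abs_le hY hB t)

lemma contDiff_mgf_of_abs_le (hY : Measurable Y) (hB : ∀ ω, |Y ω| ≤ B) :
    ContDiff ℝ (⊤ : ℕ∞) (mgf Y μ) := by
  rw [contDiff_iff_contDiffAt]
  exact fun t => (analyticAt_mgf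
    (by rw [interior_integrableExpSet_of_abs_le hY hB]; trivial)).contDiffAt

lemma contDiff_cgf_of_abs_le (hY : Measurable Y) (hB : ∀ ω, |Y ω| ≤ B) :
    ContDiff ℝ (⊤ : ℕ∞) (cgf Y μ) := by
  rw [contDiff_iff_contDiffAt]
  exact fun t => (analyticAt_cgf
    (by rw [interior_integrableExpSet_of_abs_le hY hB]; trivial)).contDiffAt

/-- Differentiate `mgf' = cgf' · mgf` by Leibniz's rule `m` times and divide by `mgf`. -/
lemma cumulantRec_cgf (hY : Measurable Y) (hB : ∀ ω, |Y ω| ≤ B) (t : ℝ) :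
    CumulantRec (fun m => iteratedDeriv m (cgf Y μ) t) (tiltedMoment Y μ t) := by
  intro m
  have hpos := mgf_pos_of_abs_le (μ := μ) hY hB
  have hK := contDiff_cgf_of_abs_le (μ := μ) hY hB
  have hG := contDiff_mgf_of_abs_le (μ := μ) hY hB
  have hder : deriv (mgf Y μ) = deriv (cgf Y μ) * mgf Y μ := by
    ext s
    have hc : cgf Y μ = fun s => Real.log (mgf Y μ s) := rfl
    rw [Pi.mul_apply, hc, deriv.log ((hG.differentiable (by simp)) s) (hpos s).ne']
    have := (hpos s).ne'
    field_simp
  have hit : ∀ n s, iteratedDeriv n (mgf Y μ) s = tiltedMoment Y μ s n * mgf Y μ s := by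
    intro n s
    rw [iteratedDeriv_mgf (by rw [interior_integrableExpSet_of_abs_le hY hB]; trivial),
      tiltedMoment, div_mul_cancel₀ _ (hpos s).ne']
  have hdc : ContDiff ℝ (⊤ : ℕ∞) (deriv (cgf Y μ)) := ((contDiff_infty_iff_deriv).mp hK).2
  have h1 : iteratedDeriv (m + 1) (mgf Y μ) t = ∑ i ∈ Finset.range (m + 1),
      (m.choose i : ℝ) * iteratedDeriv (i + 1) (cgf Y μ) t * iteratedDeriv (m - i) (mgf Y μ) t := by
    rw [iteratedDeriv_succ', hder, iteratedDeriv_mul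
      (hdc.contDiffAt.of_le (by exact_mod_cast le_top))
      (hG.contDiffAt.of_le (by exact_mod_cast le_top))]
    simp_rw [← iteratedDeriv_succ']
  simp_rw [hit] at h1
  rw [Finset.sum_range_succ] at h1
  have h0 : tiltedMoment Y μ t 0 = 1 := by
    rw [tiltedMoment, div_eq_one_iff_eq (hpos t).ne']
    simp [mgf]
  simp only [Nat.choose_self, Nat.cast_one, one_mul, Nat.sub_self, h0] at h1
  have h2 : ∑ i ∈ Finset.range m, (m.choose i : ℝ) * iteratedDeriv (i + 1) (cgf Y μ) t *
      (tiltedMoment Y μ t (m - i) * mgf Y μ t) = (∑ i ∈ Finset.range m, (m.choose i : ℝ) *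
      iteratedDeriv (i + 1) (cgf Y μ) t * tiltedMoment Y μ t (m - i)) * mgf Y μ t := by
    rw [Finset.sum_mul]
    exact Finset.sum_congr rfl fun i _ => by ring
  rw [h2, ← add_mul] at h1
  have h3 := mul_right_cancel₀ (hpos t).ne' h1
  simp only
  linarith

lemma abs_tiltedMoment_le (hY : Measurable Y) (hB : ∀ ω, |Y ω| ≤ B) (t : ℝ) (j : ℕ) :
    |tiltedMoment Y μ t j| ≤ B ^ j := by
  have hpos := mgf_pos_of_abs_le (μ := μ) hY hB t
  rw [tiltedMoment, abs_div, abs_of_pos hpos, div_le_iff₀ hpos, mgf, ← integral_const_mul]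
  refine abs_integral_le_of_abs_le ((integrable_exp_mul_of_abs_le hY hB t).const_mul _)
    fun ω => ?_
  rw [abs_mul, abs_pow, abs_of_pos (Real.exp_pos _)]
  gcongr
  exact hB ω

lemma exists_abs_iteratedDeriv_cgf_le (m : ℕ) : ∃ C : ℝ, 0 ≤ C ∧
    ∀ {Ω : Type} [MeasurableSpace Ω] (μ : Measure Ω) [IsProbabilityMeasure μ] (Y : Ω → ℝ) (B : ℝ),
      Measurable Y → (∀ ω, |Y ω| ≤ B) → 0 ≤ B → ∀ t : ℝ,
        |iteratedDeriv (m + 1) (cgf Y μ) t| ≤ C * B ^ (m + 1) := by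
  obtain ⟨C, hC0, hC⟩ := CumulantRec.abs_le (fun _ => 1) m
  refine ⟨C, hC0, ?_⟩
  intro Ω _ μ _ Y B hY hB hB0 t
  exact hC _ _ B (cumulantRec_cgf (μ := μ) hY hB t) hB0
    (fun j => by rw [one_mul]; exact abs_tiltedMoment_le (μ := μ) hY hB t j)

lemma abs_exp_sub_one_le_of_le {x a : ℝ} (h : |x| ≤ a) : |Real.exp x - 1| ≤ a * Real.exp a := by
  have ha : 0 ≤ a := (abs_nonneg x).trans h
  have h1 : Real.exp a - 1 ≤ a * Real.exp a := by
    have := Real.add_one_le_exp (-a)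
    have h2 : Real.exp (-a) * Real.exp a = 1 := by rw [← Real.exp_add]; simp
    nlinarith [Real.exp_pos a]
  rw [abs_le] at h ⊢
  constructor
  · have := Real.add_one_le_exp x
    have h3 : a ≤ a * Real.exp a := le_mul_of_one_le_right ha (Real.one_le_exp ha)
    linarith
  · have := Real.exp_le_exp.mpr h.2
    linarith

lemma abs_pow_sub_pow_le_of_abs_le {x y B d : ℝ} (hx : |x| ≤ B) (hy : |y| ≤ B) (h : |x - y| ≤ B * d) (j : ℕ) :
    |x ^ j - y ^ j| ≤ j * B ^ j * d := by
  have hB : 0 ≤ B := (abs_nonneg x).trans hx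
  induction j with
  | zero => simp
  | succ j ih =>
    have e : x ^ (j + 1) - y ^ (j + 1) = x * (x ^ j - y ^ j) + (x - y) * y ^ j := by ring
    rw [e]
    refine (abs_add_le _ _).trans ?_
    rw [abs_mul, abs_mul, abs_pow]
    have h2 : |y| ^ j ≤ B ^ j := by gcongr
    have h3 := (abs_nonneg (x - y)).trans h
    calc |x| * |x ^ j - y ^ j| + |x - y| * |y| ^ j
        ≤ B * (j * B ^ j * d) + B * d * B ^ j := by gcongr
      _ = _ := by push_cast; ring

/-- Comparison of the tilted moments of two bounded random variables that are close. -/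
lemma abs_tiltedMoment_sub_le {Z : Ω → ℝ} (hY : Measurable Y) (hZ : Measurable Z)
    (hYB : ∀ ω, |Y ω| ≤ B) (hZB : ∀ ω, |Z ω| ≤ B) {d t : ℝ} (hB : 0 ≤ B) (hd : 0 ≤ d) (ht : 0 ≤ t)
    (hYZ : ∀ ω, |Y ω - Z ω| ≤ B * d) (hone : t * (B * d) ≤ 4) (j : ℕ) :
    |tiltedMoment Y μ t j - tiltedMoment Z μ t j| ≤
      (j * Real.exp 4 + 2 * Real.exp 4) * B ^ j * (d + t * (B * d)) := by
  set a := t * (B * d) with ha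
  have ha0 : 0 ≤ a := by positivity
  have hDZ := mgf_pos_of_abs_le (μ := μ) hZ hZB t
  have hDY := mgf_pos_of_abs_le (μ := μ) hY hYB t
  set NY := ∫ ω, Y ω ^ j * Real.exp (t * Y ω) ∂μ with hNY
  set NZ := ∫ ω, Z ω ^ j * Real.exp (t * Z ω) ∂μ with hNZ
  have hea : a * Real.exp a ≤ Real.exp 4 * a := by
    rw [mul_comm]; gcongr
  have hex : ∀ ω, |Real.exp (t * Y ω) - Real.exp (t * Z ω)| ≤
      Real.exp 4 * a * Real.exp (t * Z ω) := by
    intro ω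
    have e : Real.exp (t * Y ω) = Real.exp (t * (Y ω - Z ω)) * Real.exp (t * Z ω) := by
      rw [← Real.exp_add]; ring_nf
    rw [e, ← sub_one_mul, abs_mul, abs_of_pos (Real.exp_pos (t * Z ω))]
    refine mul_le_mul_of_nonneg_right ?_ (Real.exp_pos _).le
    refine (abs_exp_sub_one_le_of_le (a := a) ?_).trans hea
    rw [abs_mul, abs_of_nonneg ht]
    exact mul_le_mul_of_nonneg_left (hYZ ω) ht
  have h1 : |mgf Y μ t - mgf Z μ t| ≤ Real.exp 4 * a * mgf Z μ t := by
    rw [mgf, mgf, ← integral_sub (integrable_exp_mul_of_abs_le hY hYB t)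
      (integrable_exp_mul_of_abs_le hZ hZB t), ← integral_const_mul]
    exact abs_integral_le_of_abs_le ((integrable_exp_mul_of_abs_le hZ hZB t).const_mul _) hex
  have h2 : |NY - NZ| ≤ (B ^ j * (Real.exp 4 * a) + j * B ^ j * d) * mgf Z μ t := by
    rw [hNY, hNZ, ← integral_sub (integrable_pow_mul_exp_of_abs_le hY hYB t j)
      (integrable_pow_mul_exp_of_abs_le hZ hZB t j), mgf, ← integral_const_mul]
    refine abs_integral_le_of_abs_le ((integrable_exp_mul_of_abs_le hZ hZB t).const_mul _)
      fun ω => ?_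
    have e : Y ω ^ j * Real.exp (t * Y ω) - Z ω ^ j * Real.exp (t * Z ω) =
        Y ω ^ j * (Real.exp (t * Y ω) - Real.exp (t * Z ω)) +
        (Y ω ^ j - Z ω ^ j) * Real.exp (t * Z ω) := by ring
    rw [e, add_mul]
    refine (abs_add_le _ _).trans (add_le_add ?_ ?_)
    · rw [abs_mul, abs_pow, mul_assoc (B ^ j)]
      gcongr
      · exact hYB ω
      · exact hex ω
    · rw [abs_mul, abs_of_pos (Real.exp_pos (t * Z ω))]
      gcongr
      exact abs_pow_sub_pow_le_of_abs_le (hYB ω) (hZB ω) (hYZ ω) j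
  have h3 := abs_tiltedMoment_le (μ := μ) hY hYB t j
  -- The difference of quotients is arranged so that both numerator differences are measured against
  -- `mgf Z`.
  have e : tiltedMoment Y μ t j - tiltedMoment Z μ t j =
      (NY - NZ) / mgf Z μ t - tiltedMoment Y μ t j * ((mgf Y μ t - mgf Z μ t) / mgf Z μ t) := by
    simp only [tiltedMoment, ← hNY, ← hNZ]
    field_simp
    ring
  rw [e]
  refine (abs_sub _ _).trans ?_
  have h4 : |(NY - NZ) / mgf Z μ t| ≤ B ^ j * (Real.exp 4 * a) + j * B ^ j * d := by
    rw [abs_div, abs_of_pos hDZ, div_le_iff₀ hDZ]; exact h2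
  have h5 : |(mgf Y μ t - mgf Z μ t) / mgf Z μ t| ≤ Real.exp 4 * a := by
    rw [abs_div, abs_of_pos hDZ, div_le_iff₀ hDZ]; exact h1
  rw [abs_mul]
  have h6 : |tiltedMoment Y μ t j| * |(mgf Y μ t - mgf Z μ t) / mgf Z μ t| ≤
      B ^ j * (Real.exp 4 * a) := by gcongr
  have h7 : (j : ℝ) * B ^ j * d ≤ (j * Real.exp 4 + 2 * Real.exp 4) * B ^ j * d := by
    have : (1 : ℝ) ≤ Real.exp 4 := Real.one_le_exp (by norm_num)
    gcongr
    nlinarith [Nat.cast_nonneg (α := ℝ) j]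
  have h8 : 0 ≤ (j : ℝ) * Real.exp 4 * B ^ j * a := by positivity
  nlinarith
end BoundedMgf

/-! ### The uniform angle: concentration at a maximum, and `I₀` as a moment generating function. -/

/-- The uniform probability measure on `(0, 2π]`. -/
noncomputable def arcMeasure : Measure ℝ :=
  ProbabilityTheory.cond (volume : Measure ℝ) (Set.Ioc 0 (2 * Real.pi))

instance : IsProbabilityMeasure arcMeasure := by
  refine cond_isProbabilityMeasure_of_finite ?_ ?_
  · rw [Real.volume_Ioc]
    simp [Real.pi_pos]
  · rw [Real.volume_Ioc]; exact ENNReal.ofReal_ne_top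

lemma integral_arcMeasure (g : ℝ → ℝ) :
    ∫ θ, g θ ∂arcMeasure = (2 * Real.pi)⁻¹ * ∫ θ in (0 : ℝ)..(2 * Real.pi), g θ := by
  have hpi : 0 ≤ 2 * Real.pi := by positivity
  rw [arcMeasure, ProbabilityTheory.cond, integral_smul_measure, Real.volume_Ioc, sub_zero,
    intervalIntegral.integral_of_le hpi, ENNReal.toReal_inv, ENNReal.toReal_ofReal hpi, smul_eq_mul]

lemma integral_arcMeasure_of_periodic {g : ℝ → ℝ} (hg : Function.Periodic g (2 * Real.pi)) :
    ∫ θ, g θ ∂arcMeasure = (2 * Real.pi)⁻¹ * ∫ θ in (-Real.pi)..Real.pi, g θ := by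
  rw [integral_arcMeasure]
  congr 1
  have := hg.intervalIntegral_add_eq 0 (-Real.pi)
  rw [zero_add] at this
  rw [this]
  congr 1
  ring

/-- The hypothesis on `W (θ / 100)` is a scale-free substitute for a quadratic minimum at `0`.
Halving `W` is paid for by the substitution `θ ↦ θ / 100`, whose Jacobian is the factor `100`,
whatever `t` is. -/
lemma integral_exp_neg_half_le {W : ℝ → ℝ} (hc : Continuous W)
    (hper : Function.Periodic W (2 * Real.pi))
    (hW : ∀ θ, |θ| ≤ Real.pi → W (θ / 100) ≤ W θ / 2) {t : ℝ} (ht : 0 ≤ t) :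
    ∫ θ, Real.exp (-(t * W θ / 2)) ∂arcMeasure ≤ 100 * ∫ θ, Real.exp (-(t * W θ)) ∂arcMeasure := by
  have hpi := Real.pi_pos
  rw [integral_arcMeasure_of_periodic (fun θ => by simp only [hper θ]),
    integral_arcMeasure_of_periodic (fun θ => by simp only [hper θ]), mul_left_comm]
  gcongr
  have hcont : Continuous fun θ => Real.exp (-(t * W θ)) := by fun_prop
  calc ∫ θ in (-Real.pi)..Real.pi, Real.exp (-(t * W θ / 2))
      ≤ ∫ θ in (-Real.pi)..Real.pi, Real.exp (-(t * W (θ / 100))) := by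
        refine intervalIntegral.integral_mono_on (by linarith)
          (Continuous.intervalIntegrable (by fun_prop) _ _)
          (Continuous.intervalIntegrable (by fun_prop) _ _) fun θ hθ => ?_
        have := hW θ (abs_le.mpr hθ)
        gcongr
        nlinarith
    _ = 100 * ∫ θ in (-Real.pi / 100)..(Real.pi / 100), Real.exp (-(t * W θ)) := by
        rw [intervalIntegral.integral_comp_div (fun θ => Real.exp (-(t * W θ))) (by norm_num)]
        simp
    _ ≤ 100 * ∫ θ in (-Real.pi)..Real.pi, Real.exp (-(t * W θ)) := by
        gcongr
        refine intervalIntegral.integral_mono_interval (by linarith) (by linarith) (by linarith)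
          (Eventually.of_forall fun θ => (Real.exp_pos _).le) (hcont.intervalIntegrable _ _)

lemma pow_mul_exp_neg_le {x : ℝ} (hx : 0 ≤ x) (j : ℕ) :
    x ^ j * Real.exp (-x) ≤ 2 ^ j * j ! * Real.exp (-(x / 2)) := by
  have h := Real.pow_div_factorial_le_exp (x / 2) (by positivity) j
  rw [div_pow, div_div, div_le_iff₀ (by positivity)] at h
  have e : Real.exp (-x) = Real.exp (-(x / 2)) * Real.exp (-(x / 2)) := by
    rw [← Real.exp_add]; ring_nf
  have e2 : Real.exp (x / 2) * Real.exp (-(x / 2)) = 1 := by rw [← Real.exp_add]; simp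
  rw [e, ← mul_assoc]
  refine mul_le_mul_of_nonneg_right ?_ (Real.exp_pos _).le
  calc x ^ j * Real.exp (-(x / 2)) ≤ (Real.exp (x / 2) * (2 ^ j * j !)) * Real.exp (-(x / 2)) := by
        gcongr
    _ = (2 ^ j * j !) * (Real.exp (x / 2) * Real.exp (-(x / 2))) := by ring
    _ = _ := by rw [e2, mul_one]

/-- Half of the exponential absorbs the power, `W^j e^(-tW) ≪ t^(-j) e^(-tW/2)`, and the loss of
that half costs only a constant. The bound depends neither on `B` nor on `W`. -/
lemma abs_tiltedMoment_neg_le {W : ℝ → ℝ} {B : ℝ} (hc : Continuous W)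
    (hper : Function.Periodic W (2 * Real.pi)) (h0 : ∀ θ, 0 ≤ W θ) (hB : ∀ θ, W θ ≤ B)
    (hW : ∀ θ, |θ| ≤ Real.pi → W (θ / 100) ≤ W θ / 2) {t : ℝ} (ht : 0 < t) (j : ℕ) :
    |tiltedMoment (fun θ => -W θ) arcMeasure t j| ≤ (100 * (2 ^ j * j !)) * t⁻¹ ^ j := by
  have hYB : ∀ θ, |(-W θ)| ≤ B := fun θ => by rw [abs_neg, abs_of_nonneg (h0 θ)]; exact hB θ
  have hm : Measurable fun θ => -W θ := hc.neg.measurable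
  have hpos := mgf_pos_of_abs_le (μ := arcMeasure) hm hYB t
  rw [tiltedMoment, abs_div, abs_of_pos hpos, div_le_iff₀ hpos]
  have hmgf : mgf (fun θ => -W θ) arcMeasure t = ∫ θ, Real.exp (-(t * W θ)) ∂arcMeasure := by
    simp [mgf]
  have hhalf := integral_exp_neg_half_le hc hper hW ht.le
  rw [← hmgf] at hhalf
  have hint : Integrable (fun θ => Real.exp (-(t * W θ / 2))) arcMeasure := by
    have := integrable_exp_mul_of_abs_le (μ := arcMeasure) hm hYB (t / 2)
    refine this.congr (Eventually.of_forall fun θ => ?_)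
    simp only; ring_nf
  calc _ ≤ ∫ θ, (2 ^ j * j ! * t⁻¹ ^ j) * Real.exp (-(t * W θ / 2)) ∂arcMeasure := by
        refine abs_integral_le_of_abs_le (hint.const_mul _) fun θ => ?_
        rw [abs_mul, abs_pow, abs_neg, abs_of_nonneg (h0 θ), abs_of_pos (Real.exp_pos _), mul_neg]
        have h1 := pow_mul_exp_neg_le (x := t * W θ) (mul_nonneg ht.le (h0 θ)) j
        have e : W θ ^ j = t⁻¹ ^ j * (t * W θ) ^ j := by
          rw [← mul_pow]; congr 1; field_simp
        rw [e, mul_assoc, mul_comm (2 ^ j * (j ! : ℝ)), mul_assoc]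
        gcongr
    _ = (2 ^ j * j ! * t⁻¹ ^ j) * ∫ θ, Real.exp (-(t * W θ / 2)) ∂arcMeasure :=
        integral_const_mul _ _
    _ ≤ (2 ^ j * j ! * t⁻¹ ^ j) * (100 * mgf (fun θ => -W θ) arcMeasure t) := by gcongr
    _ = _ := by ring

/-- Cumulants of order at least two of a variable with a quadratic maximum. -/
lemma exists_abs_iteratedDeriv_cgf_le_inv_pow (m : ℕ) : ∃ C : ℝ, 0 ≤ C ∧
    ∀ (Y : ℝ → ℝ) (a B : ℝ), Continuous Y → Function.Periodic Y (2 * Real.pi) →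
      (∀ θ, Y θ ≤ a) → (∀ θ, |Y θ| ≤ B) →
      (∀ θ, |θ| ≤ Real.pi → a - Y (θ / 100) ≤ (a - Y θ) / 2) → ∀ t : ℝ, 0 < t →
        |iteratedDeriv (m + 2) (cgf Y arcMeasure) t| ≤ C * t⁻¹ ^ (m + 2) := by
  obtain ⟨C, hC0, hC⟩ := CumulantRec.abs_le (fun j => 100 * (2 ^ j * j !)) (m + 1)
  refine ⟨C, hC0, fun Y a B hc hper ha hB hW t ht => ?_⟩
  set W : ℝ → ℝ := fun θ => a - Y θ with hWdef
  have hWc : Continuous W := by fun_prop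
  have hWper : Function.Periodic W (2 * Real.pi) := fun θ => by simp only [hWdef, hper θ]
  have hW0 : ∀ θ, 0 ≤ W θ := fun θ => sub_nonneg.mpr (ha θ)
  have hWB : ∀ θ, W θ ≤ |a| + B := fun θ => by
    have := neg_abs_le (Y θ)
    have := hB θ
    have := le_abs_self a
    simp only [hWdef]; linarith
  have hYB : ∀ θ, |(-W θ)| ≤ |a| + B := fun θ => by
    rw [abs_neg, abs_of_nonneg (hW0 θ)]; exact hWB θ
  have hm : Measurable fun θ => -W θ := hWc.neg.measurable
  -- Centring at the maximum adds a linear function, which derivatives of order at least two do not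
  -- see.
  have hcg : cgf Y arcMeasure = (fun t => t * a) + cgf (fun θ => -W θ) arcMeasure := by
    ext s
    have hpos := mgf_pos_of_abs_le (μ := arcMeasure) hm hYB s
    have e : Y = fun θ => a + -W θ := by ext θ; simp only [hWdef]; ring
    conv_lhs => rw [e]
    rw [Pi.add_apply, cgf, cgf, mgf_const_add, Real.log_mul (Real.exp_pos _).ne' hpos.ne',
      Real.log_exp]
  have hlin : iteratedDeriv (m + 2) (fun t : ℝ => t * a) t = 0 := by
    rw [iteratedDeriv_succ', show deriv (fun t : ℝ => t * a) = fun _ => a by ext; simp,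
      iteratedDeriv_const]
    simp
  have hsm : ContDiffAt ℝ ((m + 2 : ℕ) : WithTop ℕ∞) (cgf (fun θ => -W θ) arcMeasure) t :=
    (contDiff_infty.mp (contDiff_cgf_of_abs_le hm hYB) (m + 2)).contDiffAt
  rw [hcg, iteratedDeriv_add (by fun_prop) hsm, hlin, zero_add]
  exact hC _ _ t⁻¹ (cumulantRec_cgf hm hYB t) (by positivity)
    fun j => abs_tiltedMoment_neg_le hWc hWper hW0 hWB hW ht j

lemma integral_cos_pow_two_pi (n : ℕ) :
    (∫ θ in (0 : ℝ)..(2 * Real.pi), Real.cos θ ^ (2 * n) =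
      2 * Real.pi * ((2 * n)! / (4 ^ n * (n ! : ℝ) ^ 2))) ∧
    ∫ θ in (0 : ℝ)..(2 * Real.pi), Real.cos θ ^ (2 * n + 1) = 0 := by
  induction n with
  | zero => simp
  | succ n ih =>
    constructor
    · rw [show 2 * (n + 1) = 2 * n + 2 by ring, integral_cos_pow, ih.1, Nat.factorial_succ,
        Nat.factorial_succ, Nat.factorial_succ]
      simp only [Real.sin_two_pi, Real.sin_zero]
      push_cast
      field_simp
      ring
    · rw [show 2 * (n + 1) + 1 = (2 * n + 1) + 2 by ring, integral_cos_pow, ih.2]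
      simp

/-- Expand `exp (u cos θ)` and integrate termwise: odd moments of the cosine vanish, and the even
ones give the coefficients of `I₀`. -/
lemma RandomEuler.besselI0_eq_mgf : RandomEuler.besselI0 = mgf Real.cos arcMeasure := by
  ext u
  have hm : ∀ k : ℕ, Continuous fun θ => (u * Real.cos θ) ^ k / (k ! : ℝ) := fun k => by fun_prop
  have hb : ∀ (k : ℕ) θ, ‖(u * Real.cos θ) ^ k / (k ! : ℝ)‖ ≤ |u| ^ k / k ! := by
    intro k θ
    rw [norm_div, norm_pow, norm_mul, Real.norm_eq_abs, Real.norm_eq_abs, Real.norm_eq_abs,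
      Nat.abs_cast]
    gcongr
    exact mul_le_of_le_one_right (abs_nonneg u) (Real.abs_cos_le_one θ)
  have hint : ∀ k : ℕ, Integrable (fun θ => (u * Real.cos θ) ^ k / (k ! : ℝ)) arcMeasure := fun k =>
    Integrable.mono' (integrable_const _) (hm k).aestronglyMeasurable (Eventually.of_forall (hb k))
  have hs : Summable fun k : ℕ => ∫ θ, ‖(u * Real.cos θ) ^ k / (k ! : ℝ)‖ ∂arcMeasure := by
    refine Summable.of_nonneg_of_le (fun k => integral_nonneg fun θ => norm_nonneg _) (fun k => ?_)
      (Real.summable_pow_div_factorial |u|)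
    refine (integral_mono (hint k).norm (integrable_const _) (hb k)).trans ?_
    simp
  have h := hasSum_integral_of_summable_integral_norm hint hs
  have e1 : ∀ θ, ∑' k : ℕ, (u * Real.cos θ) ^ k / (k ! : ℝ) = Real.exp (u * Real.cos θ) := by
    intro θ
    rw [Real.exp_eq_exp_ℝ, NormedSpace.exp_eq_tsum_div]
  simp_rw [e1] at h
  have e2 : ∀ k : ℕ, ∫ θ, (u * Real.cos θ) ^ k / (k ! : ℝ) ∂arcMeasure =
      (2 * Real.pi)⁻¹ * (u ^ k / k ! * ∫ θ in (0 : ℝ)..(2 * Real.pi), Real.cos θ ^ k) := by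
    intro k
    rw [integral_arcMeasure, ← intervalIntegral.integral_const_mul (u ^ k / (k ! : ℝ))]
    congr 1
    exact intervalIntegral.integral_congr fun θ _ => by rw [mul_pow]; ring
  simp_rw [e2] at h
  have hinj : Function.Injective fun n : ℕ => 2 * n := fun a b h => by simpa using h
  rw [← hinj.hasSum_iff] at h
  · rw [RandomEuler.besselI0, mgf, ← h.tsum_eq]
    refine tsum_congr fun n => ?_
    simp only [Function.comp_apply]
    rw [(integral_cos_pow_two_pi n).1, div_pow, pow_mul 2 2 n]
    have := Real.pi_pos
    field_simp
    norm_num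
  · intro k hk
    rcases Nat.even_or_odd' k with ⟨n, rfl | rfl⟩
    · exact absurd ⟨n, rfl⟩ hk
    · rw [(integral_cos_pow_two_pi n).2]; simp

lemma RandomEuler.logI0_eq_cgf : RandomEuler.logI0 = cgf Real.cos arcMeasure := by
  ext u
  rw [RandomEuler.logI0, RandomEuler.besselI0_eq_mgf, cgf]

lemma contDiff_logI0 : ContDiff ℝ (⊤ : ℕ∞) RandomEuler.logI0 := by
  rw [RandomEuler.logI0_eq_cgf]
  exact contDiff_cgf_of_abs_le Real.continuous_cos.measurable Real.abs_cos_le_one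

/-! ### The logarithm of an Euler factor. -/

/-- `-log |1 - r e ^ (iθ)|`. -/
noncomputable def eulerLog (r θ : ℝ) : ℝ := -Real.log ‖1 - (r : ℂ) * Complex.exp (θ * Complex.I)‖

lemma norm_one_sub_mul_exp_sq (r θ : ℝ) :
    ‖1 - (r : ℂ) * Complex.exp (θ * Complex.I)‖ ^ 2 = (1 - r) ^ 2 + 2 * r * (1 - Real.cos θ) := by
  rw [← Complex.normSq_eq_norm_sq, Complex.normSq_apply]
  have h := Real.sin_sq_add_cos_sq θ
  simp [Complex.exp_ofReal_mul_I_re, Complex.exp_ofReal_mul_I_im]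
  linear_combination r ^ 2 * h

lemma eulerLog_eq (r θ : ℝ) :
    eulerLog r θ = -(1 / 2) * Real.log ((1 - r) ^ 2 + 2 * r * (1 - Real.cos θ)) := by
  rw [← norm_one_sub_mul_exp_sq, Real.log_pow, eulerLog]
  push_cast
  ring

section

variable {r : ℝ} (hr0 : 0 ≤ r) (hr : r ≤ 3 / 4)
include hr0 hr

lemma one_sub_sq_add_pos (θ : ℝ) : 0 < (1 - r) ^ 2 + 2 * r * (1 - Real.cos θ) := by
  have h1 : 0 < (1 - r) ^ 2 := by
    have : 0 < 1 - r := by linarith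
    positivity
  have h2 : 0 ≤ 1 - Real.cos θ := by linarith [Real.cos_le_one θ]
  positivity

lemma continuous_eulerLog : Continuous (eulerLog r) := by
  have : eulerLog r = fun θ => -(1 / 2) * Real.log ((1 - r) ^ 2 + 2 * r * (1 - Real.cos θ)) :=
    funext (eulerLog_eq r)
  rw [this]
  refine continuous_const.mul (Continuous.log (by fun_prop) fun θ => ?_)
  exact (one_sub_sq_add_pos hr0 hr θ).ne'

/-- Second-order Taylor bound for the complex logarithm, taking real parts. The range `r ≤ 3/4`
contains every `p^(-σ)`, because `2^(-1/2) < 3/4`. -/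
lemma abs_eulerLog_sub_le (θ : ℝ) : |eulerLog r θ - r * Real.cos θ| ≤ 2 * r ^ 2 := by
  set z : ℂ := (r : ℂ) * Complex.exp (θ * Complex.I) with hz
  have hzn : ‖z‖ = r := by
    rw [hz, norm_mul, Complex.norm_exp_ofReal_mul_I, mul_one, Complex.norm_real, Real.norm_eq_abs,
      abs_of_nonneg hr0]
  have h := Complex.norm_log_one_add_sub_self_le (z := -z) (by rw [norm_neg, hzn]; linarith)
  rw [norm_neg, hzn] at h
  have h2 : eulerLog r θ - r * Real.cos θ = -(Complex.log (1 + -z) - -z).re := by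
    rw [eulerLog, Complex.sub_re, Complex.log_re, ← hz, ← sub_eq_add_neg]
    simp [hz, Complex.exp_ofReal_mul_I_re]
    ring
  rw [h2, abs_neg]
  refine (Complex.abs_re_le_norm _).trans (h.trans ?_)
  have h3 : (1 - r)⁻¹ ≤ 4 := by
    rw [inv_le_comm₀ (by linarith) (by norm_num)]
    linarith
  nlinarith [sq_nonneg r]

lemma abs_eulerLog_le (θ : ℝ) : |eulerLog r θ| ≤ 3 * r := by
  have h := abs_eulerLog_sub_le hr0 hr θ
  have h2 : |r * Real.cos θ| ≤ r := by
    rw [abs_mul, abs_of_nonneg hr0]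
    exact mul_le_of_le_one_right hr0 (Real.abs_cos_le_one θ)
  have h3 : |eulerLog r θ| ≤ |eulerLog r θ - r * Real.cos θ| + |r * Real.cos θ| := by
    have := abs_add_le (eulerLog r θ - r * Real.cos θ) (r * Real.cos θ)
    simpa using this
  nlinarith

end

lemma periodic_eulerLog (r : ℝ) : Function.Periodic (eulerLog r) (2 * Real.pi) := fun θ => by
  rw [eulerLog_eq, eulerLog_eq, Real.cos_add_two_pi]

/-- Both sides are comparable to `θ²` on `[-π, π]`. The ratio `6/10000` is far below `1/2`, which
leaves room for the factor `49` lost for the Euler factors. -/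
lemma one_sub_cos_div_le {θ : ℝ} (hθ : |θ| ≤ Real.pi) :
    10000 * (1 - Real.cos (θ / 100)) ≤ 6 * (1 - Real.cos θ) := by
  have h1 := Real.one_sub_sq_div_two_le_cos (x := θ / 100)
  have h2 := Real.cos_le_one_sub_mul_cos_sq hθ
  have hpi : Real.pi ^ 2 ≤ 12 := by nlinarith [Real.pi_lt_d2, Real.pi_pos]
  have h3 : θ ^ 2 / 6 ≤ 2 / Real.pi ^ 2 * θ ^ 2 := by
    rw [div_mul_eq_mul_div, div_le_div_iff₀ (by norm_num) (by positivity)]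
    nlinarith [sq_nonneg θ]
  nlinarith

lemma exists_abs_iteratedDeriv_logI0_le_inv_pow (m : ℕ) : ∃ C : ℝ, 0 ≤ C ∧
    ∀ u : ℝ, 0 < u → |iteratedDeriv (m + 2) RandomEuler.logI0 u| ≤ C * u⁻¹ ^ (m + 2) := by
  obtain ⟨C, hC0, hC⟩ := exists_abs_iteratedDeriv_cgf_le_inv_pow m
  refine ⟨C, hC0, fun u hu => ?_⟩
  rw [RandomEuler.logI0_eq_cgf]
  refine hC Real.cos 1 1 Real.continuous_cos Real.cos_periodic Real.cos_le_one Real.abs_cos_le_one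
    (fun θ hθ => ?_) u hu
  have := one_sub_cos_div_le hθ
  have := Real.cos_le_one (θ / 100)
  linarith

/-- The maximum `-log (1 - r)` is attained at `θ = 0`, and the deficit is `½ log (1 + b (1 - cos
θ))` with `b = 2r/(1-r)² ≤ 24`. Its argument stays bounded, so the logarithm is comparable to `b (1
- cos θ)`, and the contraction property of the cosine carries over uniformly in `r`. -/
lemma exists_abs_iteratedDeriv_cgf_eulerLog_le_inv_pow (m : ℕ) : ∃ C : ℝ, 0 ≤ C ∧
    ∀ r t : ℝ, 0 ≤ r → r ≤ 3 / 4 → 0 < t →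
      |iteratedDeriv (m + 2) (cgf (eulerLog r) arcMeasure) t| ≤ C * t⁻¹ ^ (m + 2) := by
  obtain ⟨C, hC0, hC⟩ := exists_abs_iteratedDeriv_cgf_le_inv_pow m
  refine ⟨C, hC0, fun r t hr0 hr ht => ?_⟩
  have hr1 : 0 < 1 - r := by linarith
  -- the distance to the maximum, up to a factor
  have hW : ∀ θ, -Real.log (1 - r) - eulerLog r θ =
      1 / 2 * Real.log (1 + 2 * r * (1 - Real.cos θ) / (1 - r) ^ 2) := by
    intro θ
    have e : (1 - r) ^ 2 + 2 * r * (1 - Real.cos θ) =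
        (1 - r) ^ 2 * (1 + 2 * r * (1 - Real.cos θ) / (1 - r) ^ 2) := by field_simp
    have hp := one_sub_sq_add_pos hr0 hr θ
    rw [e] at hp
    have h1 : 0 < 1 + 2 * r * (1 - Real.cos θ) / (1 - r) ^ 2 :=
      pos_of_mul_pos_right hp (by positivity)
    rw [eulerLog_eq, e, Real.log_mul (by positivity) h1.ne', Real.log_pow]
    push_cast
    ring
  refine hC (eulerLog r) (-Real.log (1 - r)) (3 * r) (continuous_eulerLog hr0 hr)
    (periodic_eulerLog r) (fun θ => ?_) (abs_eulerLog_le hr0 hr) (fun θ hθ => ?_) t ht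
  · have h1 : 0 ≤ 2 * r * (1 - Real.cos θ) / (1 - r) ^ 2 := by
      have : 0 ≤ 1 - Real.cos θ := by linarith [Real.cos_le_one θ]
      positivity
    have h2 := Real.log_nonneg (x := 1 + 2 * r * (1 - Real.cos θ) / (1 - r) ^ 2) (by linarith)
    have := hW θ
    linarith
  · rw [hW, hW]
    set b := 2 * r / (1 - r) ^ 2 with hb
    have hb0 : 0 ≤ b := by positivity
    have hb24 : b ≤ 24 := by
      rw [hb, div_le_iff₀ (by positivity)]
      nlinarith
    have e : ∀ θ, 2 * r * (1 - Real.cos θ) / (1 - r) ^ 2 = b * (1 - Real.cos θ) := fun θ => by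
      rw [hb]; ring
    rw [e, e]
    have hc0 : 0 ≤ 1 - Real.cos θ := by linarith [Real.cos_le_one θ]
    have hc0' : 0 ≤ 1 - Real.cos (θ / 100) := by linarith [Real.cos_le_one (θ / 100)]
    have hc2 : 1 - Real.cos θ ≤ 2 := by linarith [Real.neg_one_le_cos θ]
    set x := b * (1 - Real.cos θ) with hx
    have hx0 : 0 ≤ x := by positivity
    have hx48 : x ≤ 48 := by nlinarith
    have h1 : Real.log (1 + b * (1 - Real.cos (θ / 100))) ≤ b * (1 - Real.cos (θ / 100)) := by
      have := Real.log_le_sub_one_of_pos (x := 1 + b * (1 - Real.cos (θ / 100))) (by positivity)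
      linarith
    have h2 : x / 49 ≤ Real.log (1 + x) := by
      have := Real.one_sub_inv_le_log_of_pos (x := 1 + x) (by positivity)
      refine le_trans ?_ this
      have e3 : 1 - (1 + x)⁻¹ = x / (1 + x) := by field_simp; ring
      rw [e3]
      gcongr
      linarith
    have h3 : 10000 * (b * (1 - Real.cos (θ / 100))) ≤ 6 * x := by
      have := one_sub_cos_div_le hθ
      rw [hx]; nlinarith
    nlinarith

/-! ### Comparison of the Euler factor with `log I₀`. -/

section CgfBounds

variable {Ω : Type*} [MeasurableSpace Ω] {μ : Measure Ω} [IsProbabilityMeasure μ] {Y : Ω → ℝ}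
  {B : ℝ}

lemma abs_deriv_cgf_le (hY : Measurable Y) (hB : ∀ ω, |Y ω| ≤ B) (t : ℝ) :
    |deriv (cgf Y μ) t| ≤ B := by
  have h := cumulantRec_cgf (μ := μ) hY hB t 0
  simp only [zero_add, Finset.range_zero, Finset.sum_empty, sub_zero, iteratedDeriv_one] at h
  rw [h]
  simpa using abs_tiltedMoment_le (μ := μ) hY hB t 1

lemma abs_cgf_le (hY : Measurable Y) (hB : ∀ ω, |Y ω| ≤ B) {t : ℝ} (ht : 0 ≤ t) :
    |cgf Y μ t| ≤ B * t := by
  have hs := contDiff_cgf_of_abs_le (μ := μ) hY hB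
  have h := convex_univ.norm_image_sub_le_of_norm_deriv_le (f := cgf Y μ) (x := 0) (y := t) (C := B)
    (fun x _ => (hs.differentiable (by simp)) x) (fun x _ => abs_deriv_cgf_le hY hB x) trivial trivial
  simpa [abs_of_nonneg ht] using h

lemma abs_deriv_deriv_cgf_le (hY : Measurable Y) (hB : ∀ ω, |Y ω| ≤ B) (t : ℝ) :
    |deriv (deriv (cgf Y μ)) t| ≤ 2 * B ^ 2 := by
  have h := cumulantRec_cgf (μ := μ) hY hB t 1
  have h0 := cumulantRec_cgf (μ := μ) hY hB t 0
  simp only [zero_add, Finset.range_zero, Finset.sum_empty, sub_zero] at h0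
  simp only [Finset.range_one, Finset.sum_singleton, zero_add, Nat.choose_zero_right, Nat.cast_one,
    one_mul, Nat.sub_zero, h0] at h
  have e : iteratedDeriv (1 + 1) (cgf Y μ) t = deriv (deriv (cgf Y μ)) t := by
    rw [iteratedDeriv_succ, iteratedDeriv_one]
  rw [← e, h]
  have h1 := abs_tiltedMoment_le (μ := μ) hY hB t 1
  have h2 := abs_tiltedMoment_le (μ := μ) hY hB t 2
  refine (abs_sub _ _).trans ?_
  rw [abs_mul]
  rw [pow_one] at h1
  nlinarith [abs_nonneg (tiltedMoment Y μ t 1)]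

/-- The derivative at `0` is the mean, and the second derivative is `O(B²)`. For Euler factors the
mean is `O(r²)`, so this improves the trivial `O(r)` to an `O(r²)` that is summable over primes. -/
lemma abs_deriv_cgf_le_add (hY : Measurable Y) (hB : ∀ ω, |Y ω| ≤ B) {t : ℝ} (ht : 0 ≤ t) :
    |deriv (cgf Y μ) t| ≤ |∫ ω, Y ω ∂μ| + 2 * B ^ 2 * t := by
  have hs := contDiff_cgf_of_abs_le (μ := μ) hY hB
  have hd : ContDiff ℝ (⊤ : ℕ∞) (deriv (cgf Y μ)) := ((contDiff_infty_iff_deriv).mp hs).2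
  have h := convex_univ.norm_image_sub_le_of_norm_deriv_le (f := deriv (cgf Y μ)) (x := 0) (y := t)
    (C := 2 * B ^ 2) (fun x _ => (hd.differentiable (by simp)) x)
    (fun x _ => abs_deriv_deriv_cgf_le hY hB x) trivial trivial
  have h0 : deriv (cgf Y μ) 0 = ∫ ω, Y ω ∂μ := by
    have h := cumulantRec_cgf (μ := μ) hY hB 0 0
    simp only [zero_add, Finset.range_zero, Finset.sum_empty, sub_zero, iteratedDeriv_one] at h
    rw [h, tiltedMoment]
    simp [mgf]
  rw [h0, Real.norm_eq_abs, Real.norm_eq_abs, sub_zero, abs_of_nonneg ht] at h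
  have := abs_add_le (deriv (cgf Y μ) t - ∫ ω, Y ω ∂μ) (∫ ω, Y ω ∂μ)
  rw [sub_add_cancel] at this
  linarith

lemma abs_cgf_le_add (hY : Measurable Y) (hB : ∀ ω, |Y ω| ≤ B) {t : ℝ} (ht : 0 ≤ t) :
    |cgf Y μ t| ≤ (|∫ ω, Y ω ∂μ| + 2 * B ^ 2 * t) * t := by
  have hs := contDiff_cgf_of_abs_le (μ := μ) hY hB
  have h := (convex_Icc 0 t).norm_image_sub_le_of_norm_deriv_le (f := cgf Y μ) (x := 0) (y := t)
    (C := |∫ ω, Y ω ∂μ| + 2 * B ^ 2 * t) (fun x _ => (hs.differentiable (by simp)) x)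
    (fun x hx => (abs_deriv_cgf_le_add hY hB hx.1).trans
      (add_le_add_right (mul_le_mul_of_nonneg_left hx.2 (by positivity)) _))
    ⟨le_rfl, ht⟩ ⟨ht, le_rfl⟩
  simpa [abs_of_nonneg ht] using h

lemma abs_cgf_sub_le {Z : Ω → ℝ} {C d t : ℝ} (hY : Measurable Y) (hZ : Measurable Z)
    (hB : ∀ ω, |Y ω| ≤ B) (hC : ∀ ω, |Z ω| ≤ C) (h : ∀ ω, |Y ω - Z ω| ≤ d) (ht : 0 ≤ t) :
    |cgf Y μ t - cgf Z μ t| ≤ t * d := by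
  have key : ∀ {Y Z : Ω → ℝ} {B C : ℝ}, Measurable Y → Measurable Z → (∀ ω, |Y ω| ≤ B) →
      (∀ ω, |Z ω| ≤ C) → (∀ ω, |Y ω - Z ω| ≤ d) → cgf Y μ t ≤ t * d + cgf Z μ t := by
    intro Y Z B C hY hZ hB hC h
    have hpY := mgf_pos_of_abs_le (μ := μ) hY hB t
    have hpZ := mgf_pos_of_abs_le (μ := μ) hZ hC t
    rw [cgf, cgf, ← Real.log_exp (t * d), ← Real.log_mul (Real.exp_pos _).ne' hpZ.ne']
    refine Real.log_le_log hpY ?_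
    rw [mgf, mgf, ← integral_const_mul]
    refine integral_mono (integrable_exp_mul_of_abs_le hY hB t)
      ((integrable_exp_mul_of_abs_le hZ hC t).const_mul _) fun ω => ?_
    simp only
    rw [← Real.exp_add]
    have := (abs_le.mp (h ω)).2
    gcongr
    nlinarith
  rw [abs_le]
  have h1 := key hY hZ hB hC h
  have h2 := key hZ hY hC hB fun ω => by rw [abs_sub_comm]; exact h ω
  constructor <;> linarith

end CgfBounds

lemma integral_cos_arcMeasure : ∫ θ, Real.cos θ ∂arcMeasure = 0 := by
  rw [integral_arcMeasure]; simp

lemma integrable_arcMeasure_of_abs_le {g : ℝ → ℝ} {B : ℝ} (hg : Continuous g)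
    (hB : ∀ θ, |g θ| ≤ B) : Integrable g arcMeasure :=
  Integrable.mono' (integrable_const B) hg.aestronglyMeasurable (Eventually.of_forall hB)

lemma abs_integral_eulerLog_le {r : ℝ} (hr0 : 0 ≤ r) (hr : r ≤ 3 / 4) :
    |∫ θ, eulerLog r θ ∂arcMeasure| ≤ 2 * r ^ 2 := by
  have h1 := integrable_arcMeasure_of_abs_le (continuous_eulerLog hr0 hr) (abs_eulerLog_le hr0 hr)
  have h2 := integrable_arcMeasure_of_abs_le Real.continuous_cos Real.abs_cos_le_one
  have e : ∫ θ, eulerLog r θ ∂arcMeasure = ∫ θ, (eulerLog r θ - r * Real.cos θ) ∂arcMeasure := by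
    rw [integral_sub h1 (h2.const_mul r), integral_const_mul, integral_cos_arcMeasure]
    simp
  rw [e]
  refine (abs_integral_le_of_abs_le (integrable_const (2 * r ^ 2))
    (abs_eulerLog_sub_le hr0 hr)).trans ?_
  simp

/-- The logarithmic moment generating function of `-log |1 - r X|`, for `X` uniformly distributed
on the unit circle. -/
noncomputable def eulerCgf (r : ℝ) : ℝ → ℝ := cgf (eulerLog r) arcMeasure

section

variable {r : ℝ} (hr0 : 0 ≤ r) (hr : r ≤ 3 / 4)
include hr0 hr

lemma contDiff_eulerCgf : ContDiff ℝ (⊤ : ℕ∞) (eulerCgf r) :=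
  contDiff_cgf_of_abs_le (continuous_eulerLog hr0 hr).measurable (abs_eulerLog_le hr0 hr)

lemma abs_eulerCgf_le {t : ℝ} (ht : 0 ≤ t) : |eulerCgf r t| ≤ 18 * (1 + t) * t * r ^ 2 := by
  have h := abs_cgf_le_add (μ := arcMeasure) (continuous_eulerLog hr0 hr).measurable
    (abs_eulerLog_le hr0 hr) ht
  have h2 := abs_integral_eulerLog_le hr0 hr
  refine h.trans ?_
  calc _ ≤ (2 * r ^ 2 + 2 * (3 * r) ^ 2 * t) * t := by gcongr
    _ ≤ (18 * r ^ 2 + 2 * (3 * r) ^ 2 * t) * t := by gcongr; norm_num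
    _ = _ := by ring

lemma abs_deriv_eulerCgf_le {t : ℝ} (ht : 0 ≤ t) : |deriv (eulerCgf r) t| ≤ 18 * (1 + t) * r ^ 2 := by
  have h := abs_deriv_cgf_le_add (μ := arcMeasure) (continuous_eulerLog hr0 hr).measurable
    (abs_eulerLog_le hr0 hr) ht
  have h2 := abs_integral_eulerLog_le hr0 hr
  refine h.trans ?_
  calc _ ≤ 2 * r ^ 2 + 2 * (3 * r) ^ 2 * t := by gcongr
    _ ≤ 18 * r ^ 2 + 2 * (3 * r) ^ 2 * t := by gcongr; norm_num
    _ = _ := by ring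

end

lemma exists_abs_iteratedDeriv_eulerCgf_le (m : ℕ) : ∃ C : ℝ, 0 ≤ C ∧ ∀ r t : ℝ, 0 ≤ r → r ≤ 3 / 4 →
    |iteratedDeriv (m + 1) (eulerCgf r) t| ≤ C * r ^ (m + 1) := by
  obtain ⟨C, hC0, hC⟩ := exists_abs_iteratedDeriv_cgf_le m
  refine ⟨C * 3 ^ (m + 1), by positivity, fun r t hr0 hr => ?_⟩
  refine (hC arcMeasure (eulerLog r) (3 * r) (continuous_eulerLog hr0 hr).measurable
    (abs_eulerLog_le hr0 hr) (by positivity) t).trans_eq ?_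
  ring

/-- A bound for the derivatives of `eulerCgf r` that is summable over `r = p ^ (-σ)`. -/
lemma exists_abs_iteratedDeriv_eulerCgf_le_sq (m : ℕ) (K : ℝ) : ∃ C : ℝ, 0 ≤ C ∧
    ∀ r t : ℝ, 0 ≤ r → r ≤ 3 / 4 → 0 ≤ t → t ≤ K → |iteratedDeriv m (eulerCgf r) t| ≤ C * r ^ 2 := by
  rcases m with _ | _ | m
  · refine ⟨|18 * (1 + K) * K|, abs_nonneg _, fun r t hr0 hr ht htK => ?_⟩
    rw [iteratedDeriv_zero]
    refine (abs_eulerCgf_le hr0 hr ht).trans ?_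
    refine mul_le_mul_of_nonneg_right (le_trans ?_ (le_abs_self _)) (by positivity)
    have : 0 ≤ K := ht.trans htK
    gcongr
  · refine ⟨|18 * (1 + K)|, abs_nonneg _, fun r t hr0 hr ht htK => ?_⟩
    rw [zero_add, iteratedDeriv_one]
    refine (abs_deriv_eulerCgf_le hr0 hr ht).trans ?_
    refine mul_le_mul_of_nonneg_right (le_trans ?_ (le_abs_self _)) (by positivity)
    gcongr
  · obtain ⟨C, hC0, hC⟩ := exists_abs_iteratedDeriv_eulerCgf_le (m + 1)
    refine ⟨C, hC0, fun r t hr0 hr _ _ => (hC r t hr0 hr).trans ?_⟩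
    refine mul_le_mul_of_nonneg_left ?_ hC0
    exact pow_le_pow_of_le_one hr0 (by linarith) (by omega)

/-- Bounds for the derivatives of `f = log I₀`. -/
lemma exists_abs_pow_mul_iteratedDeriv_logI0_le (m : ℕ) : ∃ C : ℝ, 0 ≤ C ∧ ∀ u : ℝ, 0 < u →
    |u ^ m * iteratedDeriv m RandomEuler.logI0 u| ≤ C * min u (u ^ 2) := by
  have hm := Real.continuous_cos.measurable
  have h1 := fun u hu => abs_cgf_le (μ := arcMeasure) (t := u) hm Real.abs_cos_le_one hu
  have h2 := fun u hu => abs_cgf_le_add (μ := arcMeasure) (t := u) hm Real.abs_cos_le_one hu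
  have h3 := fun u => abs_deriv_cgf_le (μ := arcMeasure) hm Real.abs_cos_le_one u
  have h4 := fun u hu => abs_deriv_cgf_le_add (μ := arcMeasure) (t := u) hm Real.abs_cos_le_one hu
  rw [integral_cos_arcMeasure] at h2 h4
  simp only [abs_zero, zero_add, one_pow, mul_one, one_mul] at h1 h2 h4
  -- Concentration only controls orders at least two; orders `0` and `1` rest on the boundedness and
  -- vanishing mean of the cosine.
  rcases m with _ | _ | m
  · refine ⟨2, by norm_num, fun u hu => ?_⟩
    rw [pow_zero, one_mul, iteratedDeriv_zero, RandomEuler.logI0_eq_cgf, mul_min_of_nonneg _ _ (by norm_num)]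
    refine le_min ((h1 u hu.le).trans (by linarith)) ((h2 u hu.le).trans (by nlinarith))
  · refine ⟨2, by norm_num, fun u hu => ?_⟩
    rw [zero_add, pow_one, iteratedDeriv_one, RandomEuler.logI0_eq_cgf,
      mul_min_of_nonneg _ _ (by norm_num), abs_mul, abs_of_pos hu]
    have := h3 u
    have := h4 u hu.le
    refine le_min (by nlinarith) (by nlinarith)
  · obtain ⟨C, hC0, hC⟩ := exists_abs_iteratedDeriv_logI0_le_inv_pow m
    obtain ⟨D, hD0, hD⟩ := exists_abs_iteratedDeriv_cgf_le (m + 1)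
    refine ⟨C + D, by positivity, fun u hu => ?_⟩
    have e := hC u hu
    have e' := hD arcMeasure Real.cos 1 hm Real.abs_cos_le_one zero_le_one u
    rw [← RandomEuler.logI0_eq_cgf, one_pow, mul_one] at e'
    rw [abs_mul, abs_of_pos (pow_pos hu _)]
    -- For `u ≤ 1` a bounded derivative suffices, as `u^(m+2) ≤ u²`; for `u ≥ 1` the decay
    -- `u^(-m-2)` from concentration is used.
    rcases le_total u 1 with h | h
    · have hu2 : u ^ 2 ≤ u := by nlinarith
      rw [min_eq_right hu2]
      calc _ ≤ u ^ 2 * D := by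
            exact mul_le_mul (pow_le_pow_of_le_one hu.le h (show 2 ≤ m + 1 + 1 by omega)) e'
              (abs_nonneg _) (sq_nonneg u)
        _ ≤ _ := by nlinarith [sq_nonneg u]
    · have hu2 : u ≤ u ^ 2 := by nlinarith
      rw [min_eq_left hu2]
      calc _ ≤ u ^ (m + 2) * (C * u⁻¹ ^ (m + 2)) := by gcongr
        _ = C := by rw [mul_left_comm, ← mul_pow, mul_inv_cancel₀ hu.ne']; simp
        _ ≤ _ := by nlinarith

lemma cgf_const_mul_cos (r : ℝ) :
    cgf (fun θ => r * Real.cos θ) arcMeasure = fun t => RandomEuler.logI0 (r * t) := by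
  ext t
  rw [RandomEuler.logI0_eq_cgf, cgf, cgf, mgf_const_mul]

lemma iteratedDeriv_cgf_const_mul_cos (m : ℕ) (r t : ℝ) :
    iteratedDeriv m (cgf (fun θ => r * Real.cos θ) arcMeasure) t =
      r ^ m * iteratedDeriv m RandomEuler.logI0 (r * t) := by
  have hsm : ContDiff ℝ (m : WithTop ℕ∞) RandomEuler.logI0 :=
    contDiff_infty.mp contDiff_logI0 m
  rw [cgf_const_mul_cos, iteratedDeriv_comp_const_mul hsm]

/-- The tilted moments of `eulerLog r` and `r cos θ` are compared at scale `B = 3r` with relative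
distance `d = 2r/3`, so that `B d = 2r²`. The condition `t r² ≤ 2` keeps the ratio of the two
exponential weights bounded. -/
lemma exists_abs_iteratedDeriv_eulerCgf_sub_le (m : ℕ) : ∃ C : ℝ, 0 ≤ C ∧ ∀ r t : ℝ, 0 ≤ r →
    r ≤ 3 / 4 → 0 ≤ t → t * r ^ 2 ≤ 2 →
    |iteratedDeriv (m + 1) (eulerCgf r) t - r ^ (m + 1) * iteratedDeriv (m + 1) RandomEuler.logI0 (r * t)|
      ≤ C * r ^ (m + 1) * (r + t * r ^ 2) := by
  obtain ⟨C, hC0, hC⟩ := CumulantRec.abs_sub_le (fun j => j * Real.exp 4 + 2 * Real.exp 4) m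
  refine ⟨C * 3 ^ (m + 1) * 2, by positivity, fun r t hr0 hr ht htr => ?_⟩
  have hY := (continuous_eulerLog hr0 hr).measurable
  have hYB := abs_eulerLog_le hr0 hr
  have hZ : Measurable fun θ => r * Real.cos θ := (Real.continuous_cos.const_mul r).measurable
  have hZB : ∀ θ, |r * Real.cos θ| ≤ 3 * r := fun θ => by
    rw [abs_mul, abs_of_nonneg hr0]
    have := Real.abs_cos_le_one θ
    nlinarith
  have e : 3 * r * (2 / 3 * r) = 2 * r ^ 2 := by ring
  have hsub := fun j => abs_tiltedMoment_sub_le (μ := arcMeasure) (d := 2 / 3 * r) (t := t) hY hZ hYB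
    hZB (by positivity) (by positivity) ht (fun θ => by rw [e]; exact abs_eulerLog_sub_le hr0 hr θ)
    (by rw [e]; linarith) j
  have h1 : (1 : ℝ) ≤ Real.exp 4 := Real.one_le_exp (by norm_num)
  have hone : ∀ j : ℕ, (3 * r) ^ j ≤ (j * Real.exp 4 + 2 * Real.exp 4) * (3 * r) ^ j := fun j => by
    refine le_mul_of_one_le_left (by positivity) ?_
    have : 0 ≤ (j : ℝ) * Real.exp 4 := by positivity
    linarith
  have := hC _ _ _ _ (3 * r) (2 / 3 * r + t * (3 * r * (2 / 3 * r)))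
    (cumulantRec_cgf (μ := arcMeasure) hY hYB t) (cumulantRec_cgf (μ := arcMeasure) hZ hZB t)
    (by positivity) (by positivity) (fun j => (abs_tiltedMoment_le hY hYB t j).trans (hone j))
    (fun j => (abs_tiltedMoment_le hZ hZB t j).trans (hone j)) hsub
  rw [iteratedDeriv_cgf_const_mul_cos] at this
  refine this.trans ?_
  calc _ ≤ C * (3 * r) ^ (m + 1) * (2 * r + t * (2 * r ^ 2)) := by
        rw [e]
        gcongr
        norm_num
    _ = _ := by ring

/-- No cancellation is used: in this range each of the two terms is bounded on its own, the first
derivative trivially and the higher ones by concentration. -/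
lemma exists_abs_iteratedDeriv_eulerCgf_sub_le_of_one_le (m : ℕ) : ∃ C : ℝ, 0 ≤ C ∧ ∀ r t : ℝ,
    0 < r → r ≤ 3 / 4 → 0 < t → 1 ≤ r * t →
    |iteratedDeriv (m + 1) (eulerCgf r) t - r ^ (m + 1) * iteratedDeriv (m + 1) RandomEuler.logI0 (r * t)|
      ≤ C * t⁻¹ ^ (m + 1) * (r * t) := by
  obtain ⟨D, hD0, hD⟩ := exists_abs_pow_mul_iteratedDeriv_logI0_le (m + 1)
  have hE : ∃ C : ℝ, 0 ≤ C ∧ ∀ r t : ℝ, 0 < r → r ≤ 3 / 4 → 0 < t → 1 ≤ r * t →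
      |iteratedDeriv (m + 1) (eulerCgf r) t| ≤ C * t⁻¹ ^ (m + 1) * (r * t) := by
    rcases m with _ | m
    · refine ⟨3, by norm_num, fun r t hr0 hr ht _ => ?_⟩
      rw [zero_add, iteratedDeriv_one, pow_one]
      refine (abs_deriv_cgf_le (continuous_eulerLog hr0.le hr).measurable
        (abs_eulerLog_le hr0.le hr) t).trans_eq ?_
      field_simp
    · obtain ⟨C, hC0, hC⟩ := exists_abs_iteratedDeriv_cgf_eulerLog_le_inv_pow m
      refine ⟨C, hC0, fun r t hr0 hr ht hu => (hC r t hr0.le hr ht).trans ?_⟩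
      exact le_mul_of_one_le_right (by positivity) hu
  obtain ⟨E, hE0, hE⟩ := hE
  refine ⟨E + D, by positivity, fun r t hr0 hr ht hu => ?_⟩
  refine (abs_sub _ _).trans ?_
  have h1 := hE r t hr0 hr ht hu
  have h2 := (hD (r * t) (by positivity)).trans (mul_le_mul_of_nonneg_left (min_le_left _ _) hD0)
  have e : r ^ (m + 1) * iteratedDeriv (m + 1) RandomEuler.logI0 (r * t) =
      t⁻¹ ^ (m + 1) * ((r * t) ^ (m + 1) * iteratedDeriv (m + 1) RandomEuler.logI0 (r * t)) := by
    rw [← mul_assoc, ← mul_pow]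
    congr 2
    field_simp
  rw [e, abs_mul, abs_of_pos (a := t⁻¹ ^ (m + 1)) (by positivity), add_mul, add_mul]
  refine add_le_add h1 ?_
  rw [mul_comm D, mul_assoc]
  gcongr

/-- Comparison of `eulerCgf r` with its leading term `t ↦ f (r t)`. -/
lemma exists_abs_iteratedDeriv_eulerCgf_sub_le_rpow (m : ℕ) {γ : ℝ} (hγ1 : 1 < γ) (hγ2 : γ ≤ 2) :
    ∃ C : ℝ, 0 ≤ C ∧ ∀ r t : ℝ, 0 < r → r ≤ 3 / 4 → 1 ≤ t →
    |iteratedDeriv m (eulerCgf r) t - r ^ m * iteratedDeriv m RandomEuler.logI0 (r * t)|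
      ≤ C * t⁻¹ ^ m * t ^ (-((γ - 1) / (m + 2))) * (r * t) ^ γ := by
  rcases m with _ | m
  · refine ⟨2, by norm_num, fun r t hr0 hr ht => ?_⟩
    have ht0 : 0 < t := by linarith
    set u := r * t with hu
    have hu0 : 0 < u := by positivity
    have h := abs_cgf_sub_le (μ := arcMeasure) (t := t) (continuous_eulerLog hr0.le hr).measurable
      (Real.continuous_cos.const_mul r).measurable (abs_eulerLog_le hr0.le hr)
      (C := r) (fun θ => by
        rw [abs_mul, abs_of_pos hr0]
        exact mul_le_of_le_one_right hr0.le (Real.abs_cos_le_one θ))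
      (abs_eulerLog_sub_le hr0.le hr) ht0.le
    rw [cgf_const_mul_cos] at h
    simp only [pow_zero, one_mul, iteratedDeriv_zero, mul_one]
    refine h.trans ?_
    have e1 : t * (2 * r ^ 2) = 2 * (t⁻¹ * u ^ (2 : ℝ)) := by
      rw [hu, Real.rpow_two]; field_simp
    rw [e1, mul_assoc]
    refine mul_le_mul_of_nonneg_left ?_ (by norm_num)
    have e2 : u ^ (2 : ℝ) = u ^ (2 - γ) * u ^ γ := by
      rw [← Real.rpow_add hu0]; ring_nf
    rw [e2, ← mul_assoc]
    gcongr
    calc t⁻¹ * u ^ (2 - γ) ≤ t ^ (-1 : ℝ) * t ^ (2 - γ) := by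
          rw [Real.rpow_neg_one]
          gcongr
          nlinarith
      _ = t ^ (1 - γ) := by rw [← Real.rpow_add ht0]; ring_nf
      _ ≤ _ := by
          apply Real.rpow_le_rpow_of_exponent_le ht
          push_cast
          linarith
  · obtain ⟨C, hC0, hC⟩ := exists_abs_iteratedDeriv_eulerCgf_sub_le m
    obtain ⟨D, hD0, hD⟩ := exists_abs_iteratedDeriv_eulerCgf_sub_le_of_one_le m
    refine ⟨2 * C + D, by positivity, fun r t hr0 hr ht => ?_⟩
    have ht0 : 0 < t := by linarith
    set u := r * t with hu
    have hu0 : 0 < u := by positivity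
    have hm3 : (0 : ℝ) < (m + 1 : ℕ) + 2 := by positivity
    set a : ℝ := ((m + 1 : ℕ) : ℝ) + 2 with ha
    have ha2 : (2 : ℝ) < a := by rw [ha]; push_cast; have := Nat.cast_nonneg (α := ℝ) m; linarith
    -- The threshold is `u = t^(1/a)` with `a = m + 3`. Below it the comparison gains `t⁻¹` against
    -- at most `u^a`; above it `γ > 1` turns the separate bounds into a gain `u^(1-γ)`. Either way
    -- the saving is at least `t^(-(γ-1)/a)`.
    rcases le_total (u ^ (m + 3)) t with h | h
    · have hua : u ≤ t ^ (1 / a) := by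
        have h' : u ^ a ≤ t := by
          have e : a = ((m + 3 : ℕ) : ℝ) := by rw [ha]; push_cast; ring
          rw [e, Real.rpow_natCast]; exact h
        rw [one_div]
        exact (Real.le_rpow_inv_iff_of_pos hu0.le ht0.le hm3).mpr h'
      have hcond : t * r ^ 2 ≤ 2 := by
        have e : t * r ^ 2 = u ^ 2 / t := by rw [hu]; field_simp
        rw [e, div_le_iff₀ ht0]
        rcases le_total u 1 with h1 | h1
        · nlinarith
        · have : u ^ 2 ≤ u ^ (m + 3) := pow_le_pow_right₀ h1 (by omega)
          linarith
      refine (hC r t hr0.le hr ht0.le hcond).trans ?_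
      have e1 : C * r ^ (m + 1) * (r + t * r ^ 2) =
          C * t⁻¹ ^ (m + 1) * (t⁻¹ * (u ^ (m + 2) + u ^ (m + 3))) := by
        have : r = t⁻¹ * u := by rw [hu]; field_simp
        rw [this]
        field_simp
        ring
      have key : ∀ k : ℕ, γ ≤ k → (k : ℝ) ≤ a →
          t⁻¹ * u ^ k ≤ t ^ (-((γ - 1) / a)) * u ^ γ := by
        intro k hk hka
        have e2 : u ^ k = u ^ ((k : ℝ) - γ) * u ^ γ := by
          rw [← Real.rpow_add hu0, sub_add_cancel, Real.rpow_natCast]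
        rw [e2, ← mul_assoc]
        gcongr
        calc t⁻¹ * u ^ ((k : ℝ) - γ) ≤ t ^ (-1 : ℝ) * (t ^ (1 / a)) ^ ((k : ℝ) - γ) := by
              rw [Real.rpow_neg_one]
              gcongr
          _ = t ^ (-1 + 1 / a * (k - γ)) := by rw [← Real.rpow_mul ht0.le, ← Real.rpow_add ht0]
          _ ≤ _ := by
              apply Real.rpow_le_rpow_of_exponent_le ht
              rw [← sub_nonneg]
              have : -((γ - 1) / a) - (-1 + 1 / a * (k - γ)) = (a - k + 1) / a := by
                field_simp; ring
              rw [this]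
              apply div_nonneg <;> linarith
      rw [e1, mul_add]
      have k1 := key (m + 2) (by push_cast; have := Nat.cast_nonneg (α := ℝ) m; linarith)
        (by rw [ha]; push_cast; linarith)
      have k2 := key (m + 3) (by push_cast; have := Nat.cast_nonneg (α := ℝ) m; linarith)
        (by rw [ha]; push_cast; linarith)
      calc _ ≤ C * t⁻¹ ^ (m + 1) * (t ^ (-((γ - 1) / a)) * u ^ γ + t ^ (-((γ - 1) / a)) * u ^ γ) := by
            gcongr
        _ = 2 * C * t⁻¹ ^ (m + 1) * t ^ (-((γ - 1) / a)) * u ^ γ := by ring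
        _ ≤ _ := by
            gcongr
            linarith
    · have hua : t ^ (1 / a) ≤ u := by
        have h' : t ≤ u ^ a := by
          have e : a = ((m + 3 : ℕ) : ℝ) := by rw [ha]; push_cast; ring
          rw [e, Real.rpow_natCast]; exact h
        rw [one_div]
        exact (Real.rpow_inv_le_iff_of_pos ht0.le hu0.le hm3).mpr h'
      have hu1 : 1 ≤ u := (Real.one_le_rpow ht (by positivity)).trans hua
      refine (hD r t hr0 hr ht0 hu1).trans ?_
      have e2 : u = u ^ (1 - γ) * u ^ γ := by
        rw [← Real.rpow_add hu0, sub_add_cancel, Real.rpow_one]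
      have k1 : u ^ (1 - γ) ≤ t ^ (-((γ - 1) / a)) := by
        calc u ^ (1 - γ) ≤ (t ^ (1 / a)) ^ (1 - γ) :=
              Real.rpow_le_rpow_of_nonpos (by positivity) hua (by linarith)
          _ = _ := by rw [← Real.rpow_mul ht0.le]; congr 1; ring
      calc D * t⁻¹ ^ (m + 1) * u = D * t⁻¹ ^ (m + 1) * u ^ (1 - γ) * u ^ γ := by
            conv_lhs => rw [e2]
            ring
        _ ≤ D * t⁻¹ ^ (m + 1) * t ^ (-((γ - 1) / a)) * u ^ γ := by gcongr
        _ ≤ _ := by gcongr; linarith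

/-! ### Summing the comparison over primes. -/

lemma prime_rpow_neg_le {σ : ℝ} (hσ : 1 / 2 < σ) (p : Nat.Primes) :
    ((p : ℕ) : ℝ) ^ (-σ) ≤ 3 / 4 := by
  have hp : (2 : ℝ) ≤ ((p : ℕ) : ℝ) := by exact_mod_cast p.2.two_le
  calc ((p : ℕ) : ℝ) ^ (-σ) ≤ ((p : ℕ) : ℝ) ^ (-(1 / 2) : ℝ) :=
        Real.rpow_le_rpow_of_exponent_le (by linarith) (by linarith)
    _ ≤ (2 : ℝ) ^ (-(1 / 2) : ℝ) := Real.rpow_le_rpow_of_nonpos (by norm_num) hp (by norm_num)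
    _ ≤ 3 / 4 := by
        rw [Real.rpow_neg (by norm_num), ← Real.sqrt_eq_rpow, inv_le_comm₀ (by positivity) (by norm_num)]
        apply Real.le_sqrt_of_sq_le
        norm_num

lemma prime_rpow_pos (s : ℝ) (p : Nat.Primes) : 0 < ((p : ℕ) : ℝ) ^ s :=
  Real.rpow_pos_of_pos (by exact_mod_cast p.2.pos) _

lemma summable_prime_rpow_sq {σ : ℝ} (hσ : 1 / 2 < σ) :
    Summable fun p : Nat.Primes => (((p : ℕ) : ℝ) ^ (-σ)) ^ 2 := by
  have h := Nat.Primes.summable_rpow.mpr (show -(2 * σ) < -1 by linarith)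
  refine h.congr fun p => ?_
  rw [← Real.rpow_natCast, ← Real.rpow_mul (Nat.cast_nonneg _)]
  congr 1
  push_cast
  ring

/-- The sum over primes of the `m`-th derivatives of the Euler factors, up to a power saving. -/
lemma exists_tsum_abs_iteratedDeriv_eulerCgf_sub_le {σ : ℝ} (hσ : 1 / 2 < σ) (hσ' : σ < 1) (m : ℕ) :
    ∃ C δ : ℝ, 0 < δ ∧ ∀ t : ℝ, 1 ≤ t →
      Summable (fun p : Nat.Primes => |iteratedDeriv m (eulerCgf (((p : ℕ) : ℝ) ^ (-σ))) t -
        (((p : ℕ) : ℝ) ^ (-σ)) ^ m *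
          iteratedDeriv m RandomEuler.logI0 ((((p : ℕ) : ℝ) ^ (-σ)) * t)|) ∧
      ∑' p : Nat.Primes, |iteratedDeriv m (eulerCgf (((p : ℕ) : ℝ) ^ (-σ))) t -
        (((p : ℕ) : ℝ) ^ (-σ)) ^ m *
          iteratedDeriv m RandomEuler.logI0 ((((p : ℕ) : ℝ) ^ (-σ)) * t)| ≤
        C * t ^ (1 / σ - m - δ) := by
  have hσ0 : 0 < σ := by linarith
  set b := 1 / σ with hb
  have hb1 : 1 < b := by rw [hb, lt_div_iff₀ hσ0]; linarith
  have hb2 : b < 2 := by rw [hb, div_lt_iff₀ hσ0]; linarith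
  have hm2 : (0 : ℝ) < m + 2 := by positivity
  set δ := (b - 1) / (m + 2) / 2 with hδ
  have hδ0 : 0 < δ := by
    have : 0 < b - 1 := by linarith
    positivity
  -- Any `γ > 1/σ` makes `∑ p^(-σγ)` converge. The saving is at least `2δ`, and raising the exponent
  -- from `b` to `γ` costs at most `δ`.
  set γ := min (b + δ) 2 with hγ
  have hbγ : b < γ := lt_min (by linarith) hb2
  have hγb : γ ≤ b + δ := min_le_left _ _
  obtain ⟨C, hC0, hC⟩ := exists_abs_iteratedDeriv_eulerCgf_sub_le_rpow m (γ := γ) (by linarith)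
    (min_le_right _ _)
  have hs : Summable fun p : Nat.Primes => ((p : ℕ) : ℝ) ^ (-(σ * γ)) := by
    refine Nat.Primes.summable_rpow.mpr ?_
    have : σ * b = 1 := by rw [hb]; field_simp
    nlinarith
  refine ⟨C * ∑' p : Nat.Primes, ((p : ℕ) : ℝ) ^ (-(σ * γ)), δ, hδ0, fun t ht => ?_⟩
  have ht0 : 0 < t := by linarith
  have hbound : ∀ p : Nat.Primes, |iteratedDeriv m (eulerCgf (((p : ℕ) : ℝ) ^ (-σ))) t -
        (((p : ℕ) : ℝ) ^ (-σ)) ^ m *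
          iteratedDeriv m RandomEuler.logI0 ((((p : ℕ) : ℝ) ^ (-σ)) * t)| ≤
      C * t ^ (b - m - δ) * ((p : ℕ) : ℝ) ^ (-(σ * γ)) := by
    intro p
    refine (hC _ t (prime_rpow_pos _ p) (prime_rpow_neg_le hσ p) ht).trans ?_
    rw [Real.mul_rpow (prime_rpow_pos _ p).le ht0.le, ← Real.rpow_mul (Nat.cast_nonneg _), neg_mul]
    have e : C * t⁻¹ ^ m * t ^ (-((γ - 1) / (m + 2))) * (((p : ℕ) : ℝ) ^ (-(σ * γ)) * t ^ γ) =
        C * t ^ (-(m : ℝ) + -((γ - 1) / (m + 2)) + γ) * ((p : ℕ) : ℝ) ^ (-(σ * γ)) := by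
      rw [Real.rpow_add ht0, Real.rpow_add ht0, Real.rpow_neg ht0.le (m : ℝ), Real.rpow_natCast,
        inv_pow]
      ring
    rw [e]
    have h1 : (b - 1) / (m + 2) ≤ (γ - 1) / (m + 2) := by gcongr
    have h2 : (b - 1) / (m + 2) = 2 * δ := by rw [hδ]; ring
    gcongr
    linarith
  have hs2 := hs.mul_left (C * t ^ (b - m - δ))
  have hsum := Summable.of_nonneg_of_le (fun p => abs_nonneg _) hbound hs2
  refine ⟨hsum, (hsum.tsum_le_tsum hbound hs2).trans_eq ?_⟩
  rw [tsum_mul_left]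
  ring

/-! ### The profile in the logarithmic variable, the coefficients, and the expansion of the prime
sum. -/

/-- The function `u ^ (j - 1/σ) f⁽ʲ⁾(u)` in the variable `w = -log u / σ`. -/
noncomputable def besselProfile (σ : ℝ) (j : ℕ) (w : ℝ) : ℝ :=
  Real.exp w * (Real.exp (-(σ * w)) ^ j * iteratedDeriv j RandomEuler.logI0 (Real.exp (-(σ * w))))

/-- The exponential rate of decay of `besselProfile`. -/
noncomputable def profileRate (σ : ℝ) : ℝ := min (min (1 - σ) (2 * σ - 1)) (1 / 4)

lemma profileRate_pos {σ : ℝ} (hσ : 1 / 2 < σ) (hσ' : σ < 1) : 0 < profileRate σ :=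
  lt_min (lt_min (by linarith) (by linarith)) (by norm_num)

/-- For `w ≥ 0` the bound `u²` leaves `e^(-(2σ-1)w)`, and for `w ≤ 0` the bound `u` leaves
`e^((1-σ)w)`: both ends of `1/2 < σ < 1` are needed for decay. The cap `1/4` in the rate is the one
from the prime powers. -/
lemma exp_mul_min_le (σ w : ℝ) :
    Real.exp w * min (Real.exp (-(σ * w))) (Real.exp (-(σ * w)) ^ 2) ≤
      Real.exp (-(profileRate σ * |w|)) := by
  have h1 : profileRate σ ≤ 1 - σ := (min_le_left _ _).trans (min_le_left _ _)
  have h2 : profileRate σ ≤ 2 * σ - 1 := (min_le_left _ _).trans (min_le_right _ _)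
  rcases le_total 0 w with hw | hw
  · calc _ ≤ Real.exp w * Real.exp (-(σ * w)) ^ 2 := by gcongr; exact min_le_right _ _
      _ = Real.exp (-((2 * σ - 1) * w)) := by
          rw [← Real.exp_nat_mul, ← Real.exp_add]; push_cast; ring_nf
      _ ≤ _ := by rw [abs_of_nonneg hw]; gcongr
  · calc _ ≤ Real.exp w * Real.exp (-(σ * w)) := by gcongr; exact min_le_left _ _
      _ = Real.exp ((1 - σ) * w) := by rw [← Real.exp_add]; ring_nf
      _ ≤ _ := by
          rw [abs_of_nonpos hw]
          gcongr
          nlinarith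

lemma exists_abs_besselProfile_le (σ : ℝ) (j : ℕ) : ∃ C : ℝ, ∀ w,
    |besselProfile σ j w| ≤ C * Real.exp (-(profileRate σ * |w|)) := by
  obtain ⟨C, hC0, hC⟩ := exists_abs_pow_mul_iteratedDeriv_logI0_le j
  refine ⟨C, fun w => ?_⟩
  rw [besselProfile, abs_mul, abs_of_pos (Real.exp_pos w)]
  calc _ ≤ Real.exp w * (C * min (Real.exp (-(σ * w))) (Real.exp (-(σ * w)) ^ 2)) := by
        gcongr; exact hC _ (Real.exp_pos _)
    _ = C * (Real.exp w * min (Real.exp (-(σ * w))) (Real.exp (-(σ * w)) ^ 2)) := by ring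
    _ ≤ _ := by gcongr; exact exp_mul_min_le σ w

lemma contDiff_iteratedDeriv_logI0 (j : ℕ) :
    ContDiff ℝ (⊤ : ℕ∞) (iteratedDeriv j RandomEuler.logI0) := by
  induction j with
  | zero => rw [iteratedDeriv_zero]; exact contDiff_logI0
  | succ j ih => rw [iteratedDeriv_succ]; exact ((contDiff_infty_iff_deriv).mp ih).2

lemma contDiff_besselProfile (σ : ℝ) (j : ℕ) : ContDiff ℝ (⊤ : ℕ∞) (besselProfile σ j) := by
  have h := contDiff_iteratedDeriv_logI0 j
  unfold besselProfile
  fun_prop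

/-- The profiles are closed under differentiation up to linear combinations, so decay of each
profile yields decay of all derivatives. -/
lemma deriv_besselProfile (σ : ℝ) (j : ℕ) : deriv (besselProfile σ j) =
    fun w => (1 - σ * j) * besselProfile σ j w + -σ * besselProfile σ (j + 1) w := by
  ext w
  have hg : HasDerivAt (iteratedDeriv j RandomEuler.logI0)
      (iteratedDeriv (j + 1) RandomEuler.logI0 (Real.exp (-(σ * w)))) (Real.exp (-(σ * w))) := by
    rw [iteratedDeriv_succ]
    exact ((contDiff_iteratedDeriv_logI0 j).differentiable (by simp) _).hasDerivAt
  have hu : HasDerivAt (fun w => Real.exp (-(σ * w))) (Real.exp (-(σ * w)) * -(σ * 1)) w :=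
    ((hasDerivAt_id w).const_mul σ).neg.exp
  have h := (Real.hasDerivAt_exp w).mul ((hu.pow j).mul (hg.comp w hu))
  refine (HasDerivAt.deriv (f := besselProfile σ j) h).trans ?_
  simp only [besselProfile, Function.comp_apply, Pi.mul_apply, Pi.pow_apply]
  rcases j with _ | j
  · simp; ring
  · push_cast
    ring

lemma exists_abs_iteratedDeriv_besselProfile_le (σ : ℝ) (n : ℕ) : ∀ j : ℕ, ∃ C : ℝ, ∀ w,
    |iteratedDeriv n (besselProfile σ j) w| ≤ C * Real.exp (-(profileRate σ * |w|)) := by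
  induction n with
  | zero => intro j; rw [iteratedDeriv_zero]; exact exists_abs_besselProfile_le σ j
  | succ n ih =>
    intro j
    obtain ⟨C, hC⟩ := ih j
    obtain ⟨D, hD⟩ := ih (j + 1)
    have hs : ∀ j, ContDiff ℝ n (besselProfile σ j) := fun j =>
      contDiff_infty.mp (contDiff_besselProfile σ j) n
    refine ⟨|1 - σ * j| * C + |(-σ)| * D, fun w => ?_⟩
    have e : iteratedDeriv (n + 1) (besselProfile σ j) w =
        (1 - σ * j) * iteratedDeriv n (besselProfile σ j) w +
          -σ * iteratedDeriv n (besselProfile σ (j + 1)) w := by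
      rw [iteratedDeriv_succ', deriv_besselProfile,
        iteratedDeriv_fun_add (contDiff_const.mul (hs j)).contDiffAt
          (contDiff_const.mul (hs (j + 1))).contDiffAt,
        iteratedDeriv_const_mul_field, iteratedDeriv_const_mul_field]
    rw [e, add_mul, mul_assoc, mul_assoc]
    refine (abs_add_le _ _).trans ?_
    rw [abs_mul, abs_mul]
    gcongr
    · exact hC w
    · exact hD w

open SchwartzMap in
/-- `besselProfile` as a Schwartz function. -/
noncomputable def besselSchwartz {σ : ℝ} (hσ : 1 / 2 < σ) (hσ' : σ < 1) (j : ℕ) : 𝓢(ℝ, ℝ) where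
  toFun := besselProfile σ j
  smooth' := contDiff_besselProfile σ j
  decay' k n := by
    obtain ⟨C, hC⟩ := exists_abs_iteratedDeriv_besselProfile_le σ n j
    have hc := profileRate_pos hσ hσ'
    set c := profileRate σ
    have hC0 : 0 ≤ C := by simpa using (abs_nonneg _).trans (hC 0)
    refine ⟨k ! / c ^ k * C, fun w => ?_⟩
    rw [norm_iteratedFDeriv_eq_norm_iteratedDeriv, Real.norm_eq_abs, Real.norm_eq_abs]
    have h1 : |w| ^ k ≤ k ! / c ^ k * Real.exp (c * |w|) := by
      have := Real.pow_div_factorial_le_exp (c * |w|) (by positivity) k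
      rw [mul_pow, div_le_iff₀ (by positivity)] at this
      rw [div_mul_eq_mul_div, le_div_iff₀ (by positivity)]
      linarith
    calc _ ≤ (k ! / c ^ k * Real.exp (c * |w|)) * (C * Real.exp (-(c * |w|))) := by
          gcongr; exact hC w
      _ = k ! / c ^ k * C * (Real.exp (c * |w|) * Real.exp (-(c * |w|))) := by ring
      _ = _ := by rw [← Real.exp_add]; simp

lemma integrable_pow_mul_besselProfile {σ : ℝ} (hσ : 1 / 2 < σ) (hσ' : σ < 1) (j n : ℕ) :
    Integrable fun w => (-w) ^ n * besselProfile σ j w := by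
  have h := (besselSchwartz hσ hσ' j).integrable_pow_mul volume n
  have hc := (contDiff_besselProfile σ j).continuous
  refine h.mono' (by fun_prop) (Eventually.of_forall fun w => ?_)
  rw [norm_mul, norm_pow, norm_neg]
  rfl

section

variable {σ : ℝ} (hσ0 : 0 < σ)
include hσ0

lemma image_exp_neg_mul : (fun w => Real.exp (-(σ * w))) '' Set.univ = Set.Ioi (0 : ℝ) := by
  ext u
  simp only [Set.image_univ, Set.mem_range, Set.mem_Ioi]
  constructor
  · rintro ⟨w, rfl⟩; exact Real.exp_pos _
  · intro hu
    refine ⟨-(Real.log u / σ), ?_⟩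
    rw [mul_neg, neg_neg, mul_div_cancel₀ _ hσ0.ne', Real.exp_log hu]

lemma abs_deriv_smul_coeffIntegrand (m n : ℕ) (w : ℝ) :
    |Real.exp (-(σ * w)) * -(σ * 1)| • RandomEuler.coeffIntegrand σ m n (Real.exp (-(σ * w))) =
      σ ^ (n + 1) * ((-w) ^ n * besselProfile σ m w) := by
  rw [RandomEuler.coeffIntegrand, besselProfile, Real.log_exp, smul_eq_mul, abs_mul,
    abs_of_pos (Real.exp_pos _), mul_one, abs_neg, abs_of_pos hσ0, ← Real.exp_mul]
  have e : Real.exp (-(σ * w) * (1 / σ + 1 - m)) =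
      Real.exp (-(σ * w)) / (Real.exp w * Real.exp (-(σ * w)) ^ m) := by
    rw [← Real.exp_nat_mul, ← Real.exp_add, ← Real.exp_sub]
    congr 1
    field_simp
    ring
  rw [e, show (-(σ * w)) ^ n = (σ * -w) ^ n by ring, mul_pow]
  field_simp
  ring

lemma injOn_exp_neg_mul : Set.InjOn (fun w => Real.exp (-(σ * w))) Set.univ := by
  intro a _ b _ h
  simpa [hσ0.ne'] using h

omit hσ0 in
lemma hasDerivWithinAt_exp_neg_mul (w : ℝ) : HasDerivWithinAt (fun w => Real.exp (-(σ * w)))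
    (Real.exp (-(σ * w)) * -(σ * 1)) Set.univ w :=
  (((hasDerivAt_id w).const_mul σ).neg.exp).hasDerivWithinAt

/-- Substitution `u = e^(-σw)`: `σ^n` comes from `log u = -σw`, and one more `σ` from the Jacobian.
-/
lemma coeff_eq_integral_besselProfile (m n : ℕ) : RandomEuler.coeff σ m n =
    σ ^ (n + 1) * ∫ w, (-w) ^ n * besselProfile σ m w := by
  rw [RandomEuler.coeff, ← image_exp_neg_mul hσ0, integral_image_eq_integral_abs_deriv_smul
    MeasurableSet.univ (fun w _ => hasDerivWithinAt_exp_neg_mul w) (injOn_exp_neg_mul hσ0)]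
  simp_rw [abs_deriv_smul_coeffIntegrand hσ0]
  rw [integral_const_mul, setIntegral_univ]

end

lemma integrableOn_coeffIntegrand {σ : ℝ} (hσ : 1 / 2 < σ) (hσ' : σ < 1) (m n : ℕ) :
    IntegrableOn (RandomEuler.coeffIntegrand σ m n) (Set.Ioi 0) := by
  have hσ0 : 0 < σ := by linarith
  rw [← image_exp_neg_mul hσ0, integrableOn_image_iff_integrableOn_abs_deriv_smul
    MeasurableSet.univ (fun w _ => hasDerivWithinAt_exp_neg_mul w) (injOn_exp_neg_mul hσ0)]
  simp_rw [abs_deriv_smul_coeffIntegrand hσ0]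
  exact ((integrable_pow_mul_besselProfile hσ hσ' m n).const_mul _).integrableOn

open SchwartzMap in
lemma exists_abs_tsum_besselProfile_sub_le {σ : ℝ} (hσ : 1 / 2 < σ) (hσ' : σ < 1) (m N : ℕ) :
    ∃ K : ℝ, ∀ Y : ℝ, 1 ≤ Y →
      |∑' p : Nat.Primes, ((p : ℕ) : ℝ) ^ (-1 : ℝ) * besselProfile σ m (Real.log (p : ℕ) - Y) -
        ∑ n ∈ Finset.range (N + 1), RandomEuler.coeff σ m n / (σ * Y) ^ (n + 1)| ≤ K / Y ^ (N + 2) := by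
  have hσ0 : 0 < σ := by linarith
  set g : 𝓢(ℝ, ℂ) := (besselSchwartz hσ hσ' m).postcompCLM Complex.ofRealCLM with hg
  have hgw : ∀ w, g w = (besselProfile σ m w : ℂ) := fun w => rfl
  have hdec : ExpDecay g := by
    obtain ⟨C, hC⟩ := exists_abs_besselProfile_le σ m
    refine ⟨C, profileRate σ, profileRate_pos hσ hσ', min_le_right _ _, fun w => ?_⟩
    rw [hgw, Complex.norm_real]
    exact hC w
  obtain ⟨K, hK⟩ := tsum_primes_expansion g hdec N
  refine ⟨K, fun Y hY => ?_⟩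
  have h := hK Y hY
  have hY0 : 0 < Y := by linarith
  refine le_trans (le_of_eq ?_) h
  rw [← Real.norm_eq_abs, ← Complex.norm_real]
  congr 1
  push_cast
  refine congrArg₂ (· - ·) ?_ ?_
  · refine tsum_congr fun p => ?_
    rw [hgw]
  · refine Finset.sum_congr rfl fun n _ => ?_
    have e : ∫ w : ℝ, (-(w : ℂ)) ^ n * g w = ((∫ w, (-w) ^ n * besselProfile σ m w : ℝ) : ℂ) := by
      refine Eq.trans ?_ integral_complex_ofReal
      refine integral_congr_ae (Eventually.of_forall fun w => ?_)
      simp only [hgw]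
      push_cast
      rfl
    rw [e, coeff_eq_integral_besselProfile hσ0, mul_pow]
    push_cast
    have : (σ : ℂ) ≠ 0 := by exact_mod_cast hσ0.ne'
    rw [mul_div_mul_left _ _ (pow_ne_zero _ this)]

/-- With `u = p^(-σ) t` the logarithmic variable is `w = log p - log t / σ`, so `e^w = p t^(-1/σ)`,
which produces both the weight `p⁻¹` and the leading power of `t`. -/
lemma pow_mul_iteratedDeriv_logI0_eq {σ : ℝ} (hσ0 : 0 < σ) (m : ℕ) {t : ℝ} (ht : 0 < t)
    (p : Nat.Primes) :
    (((p : ℕ) : ℝ) ^ (-σ)) ^ m * iteratedDeriv m RandomEuler.logI0 ((((p : ℕ) : ℝ) ^ (-σ)) * t) =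
      t ^ (1 / σ - m) * (((p : ℕ) : ℝ) ^ (-1 : ℝ) *
        besselProfile σ m (Real.log (p : ℕ) - Real.log t / σ)) := by
  have hp : (0 : ℝ) < ((p : ℕ) : ℝ) := by exact_mod_cast p.2.pos
  have e1 : Real.exp (-(σ * (Real.log (p : ℕ) - Real.log t / σ))) = ((p : ℕ) : ℝ) ^ (-σ) * t := by
    have : -(σ * (Real.log (p : ℕ) - Real.log t / σ)) = Real.log (p : ℕ) * -σ + Real.log t := by
      field_simp; ring
    rw [this, Real.exp_add, Real.exp_log ht, Real.rpow_def_of_pos hp]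
  have e2 : Real.exp (Real.log (p : ℕ) - Real.log t / σ) = ((p : ℕ) : ℝ) * t ^ (-(1 / σ)) := by
    rw [sub_eq_add_neg, Real.exp_add, Real.exp_log hp, Real.rpow_def_of_pos ht]
    congr 2
    ring
  rw [besselProfile, e1, e2, Real.rpow_sub ht, Real.rpow_neg ht.le, Real.rpow_neg_one,
    Real.rpow_natCast, mul_pow]
  have := (Real.rpow_pos_of_pos ht (1 / σ)).ne'
  field_simp

lemma summable_pow_mul_iteratedDeriv_logI0 {σ : ℝ} (hσ : 1 / 2 < σ) (m : ℕ) {t : ℝ} (ht : 0 < t) :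
    Summable fun p : Nat.Primes =>
      (((p : ℕ) : ℝ) ^ (-σ)) ^ m * iteratedDeriv m RandomEuler.logI0 ((((p : ℕ) : ℝ) ^ (-σ)) * t) := by
  obtain ⟨C, hC0, hC⟩ := exists_abs_pow_mul_iteratedDeriv_logI0_le m
  refine Summable.of_norm_bounded (((summable_prime_rpow_sq hσ).mul_left (t⁻¹ ^ m * C * t ^ 2)))
    fun p => ?_
  set r := ((p : ℕ) : ℝ) ^ (-σ)
  have hr : 0 < r := prime_rpow_pos _ p
  have h := (hC (r * t) (by positivity)).trans (mul_le_mul_of_nonneg_left (min_le_right _ _) hC0)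
  have e : r ^ m * iteratedDeriv m RandomEuler.logI0 (r * t) =
      t⁻¹ ^ m * ((r * t) ^ m * iteratedDeriv m RandomEuler.logI0 (r * t)) := by
    rw [← mul_assoc, ← mul_pow]
    congr 2
    field_simp
  rw [e, norm_mul, Real.norm_eq_abs, Real.norm_eq_abs, abs_of_pos (by positivity)]
  calc _ ≤ t⁻¹ ^ m * (C * (r * t) ^ 2) := by gcongr
    _ = _ := by ring

/-- The asymptotic expansion of the sum over primes of the derivatives of the Euler factors. -/
theorem exists_abs_tsum_iteratedDeriv_eulerCgf_sub_le {σ : ℝ} (hσ : 1 / 2 < σ) (hσ' : σ < 1)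
    (m N : ℕ) : ∃ K : ℝ, ∀ t : ℝ, Real.exp 1 ≤ t →
      |∑' p : Nat.Primes, iteratedDeriv m (eulerCgf (((p : ℕ) : ℝ) ^ (-σ))) t -
        t ^ (1 / σ - m) / Real.log t *
          ∑ n ∈ Finset.range (N + 1), RandomEuler.coeff σ m n / Real.log t ^ n| ≤
        K * (t ^ (1 / σ - m) / Real.log t * (1 / Real.log t ^ (N + 1))) := by
  have hσ0 : 0 < σ := by linarith
  obtain ⟨C, δ, hδ, hC⟩ := exists_tsum_abs_iteratedDeriv_eulerCgf_sub_le hσ hσ' m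
  obtain ⟨K, hK⟩ := exists_abs_tsum_besselProfile_sub_le hσ hσ' m N
  refine ⟨|C| * ((N + 2)! / δ ^ (N + 2)) + K * σ ^ (N + 2), fun t ht => ?_⟩
  have ht0 : 0 < t := (Real.exp_pos 1).trans_le ht
  have ht1 : 1 ≤ t := (Real.one_le_exp zero_le_one).trans ht
  have hlog : 1 ≤ Real.log t := (Real.le_log_iff_exp_le ht0).mpr ht
  obtain ⟨hs1, hle⟩ := hC t ht1
  have hs2 := summable_pow_mul_iteratedDeriv_logI0 hσ m ht0
  set A : Nat.Primes → ℝ := fun p => iteratedDeriv m (eulerCgf (((p : ℕ) : ℝ) ^ (-σ))) t with hA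
  set B : Nat.Primes → ℝ := fun p => (((p : ℕ) : ℝ) ^ (-σ)) ^ m *
    iteratedDeriv m RandomEuler.logI0 ((((p : ℕ) : ℝ) ^ (-σ)) * t) with hB
  have hs3 : Summable fun p => A p - B p := hs1.of_abs
  have h1 : |∑' p, A p - ∑' p, B p| ≤ C * t ^ (1 / σ - m - δ) := by
    have hs4 : Summable A := by simpa using hs3.add hs2
    have hs5 : Summable fun p => ‖A p - B p‖ := hs1
    have hle' : ∑' p, ‖A p - B p‖ ≤ C * t ^ (1 / σ - m - δ) := hle
    rw [← hs4.tsum_sub hs2, ← Real.norm_eq_abs]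
    exact (norm_tsum_le_tsum_norm hs5).trans hle'
  have h2 : ∑' p, B p = t ^ (1 / σ - m) * ∑' p : Nat.Primes, (((p : ℕ) : ℝ) ^ (-1 : ℝ) *
        besselProfile σ m (Real.log (p : ℕ) - Real.log t / σ)) := by
    rw [← tsum_mul_left]
    exact tsum_congr fun p => pow_mul_iteratedDeriv_logI0_eq hσ0 m ht0 p
  have h3 := hK (Real.log t / σ) (by rw [le_div_iff₀ hσ0]; linarith)
  rw [mul_div_cancel₀ _ hσ0.ne'] at h3
  have h4 : ∑ n ∈ Finset.range (N + 1), RandomEuler.coeff σ m n / Real.log t ^ (n + 1) =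
      (∑ n ∈ Finset.range (N + 1), RandomEuler.coeff σ m n / Real.log t ^ n) / Real.log t := by
    rw [Finset.sum_div]
    exact Finset.sum_congr rfl fun n _ => by rw [pow_succ, div_div]
  rw [h4] at h3
  have hpow : 0 < t ^ (1 / σ - m) := Real.rpow_pos_of_pos ht0 _
  have h5 : |∑' p, B p - t ^ (1 / σ - m) / Real.log t *
      ∑ n ∈ Finset.range (N + 1), RandomEuler.coeff σ m n / Real.log t ^ n| ≤
      t ^ (1 / σ - m) * (K / (Real.log t / σ) ^ (N + 2)) := by
    rw [h2, div_mul_eq_mul_div, mul_div_assoc, ← mul_sub, abs_mul, abs_of_pos hpow]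
    gcongr
  -- The power saving from the comparison is absorbed into the required power of the logarithm.
  have h6 : t ^ (-δ) ≤ (N + 2)! / δ ^ (N + 2) / Real.log t ^ (N + 2) := by
    have := exp_neg_le_factorial_div_pow (y := δ * Real.log t) (by positivity) (N + 2)
    rw [mul_pow, ← div_div] at this
    rw [Real.rpow_def_of_pos ht0]
    convert! this using 2
    ring
  have h7 : C * t ^ (1 / σ - m - δ) ≤
      |C| * (t ^ (1 / σ - m) * ((N + 2)! / δ ^ (N + 2) / Real.log t ^ (N + 2))) := by
    rw [sub_eq_add_neg _ δ, Real.rpow_add ht0]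
    gcongr
    exact le_abs_self C
  refine (abs_sub_le _ (∑' p, B p) _).trans ((add_le_add (h1.trans h7) h5).trans_eq ?_)
  rw [div_pow, pow_succ (Real.log t) (N + 1)]
  field_simp

/-! ### Series of independent variables and convergence of expectations. -/

section IndepSums

variable {Ω : Type*} {m0 : MeasurableSpace Ω} {P : Measure Ω}

/-- The filtration generated by the random variables with index in a growing set. -/
def filtrationOfFinsets {ι : Type*} {V : ι → Ω → ℝ} (hV : ∀ i, Measurable (V i)) {s : ℕ → Finset ι}
    (hs : Monotone s) : Filtration ℕ m0 where
  seq n := ⨆ i ∈ (s n : Set ι), MeasurableSpace.comap (V i) inferInstance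
  mono' _ _ h := biSup_mono fun _ hi => hs h hi
  le' _ := iSup₂_le fun i _ => (hV i).comap_le

/-- A series of independent centred random variables with summable variances converges almost
surely. -/
theorem ae_exists_tendsto_sum_of_iIndepFun [IsProbabilityMeasure P] {ι : Type*} {V : ι → Ω → ℝ}
    (hV : ∀ i, Measurable (V i)) (hind : iIndepFun V P) (h2 : ∀ i, MemLp (V i) 2 P)
    (h0 : ∀ i, ∫ ω, V i ω ∂P = 0) {s : ℕ → Finset ι} (hs : Monotone s) {A : ℝ}
    (hA : ∀ n, ∑ i ∈ s n, ∫ ω, V i ω ^ 2 ∂P ≤ A) :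
    ∀ᵐ ω ∂P, ∃ l, Tendsto (fun n => ∑ i ∈ s n, V i ω) atTop (𝓝 l) := by
  classical
  set ℱ := filtrationOfFinsets hV hs
  set f : ℕ → Ω → ℝ := fun n ω => ∑ i ∈ s n, V i ω with hf
  have hint : ∀ i, Integrable (V i) P := fun i => (h2 i).integrable (by norm_num)
  have hmeas : ∀ (t u : Finset ι), t ⊆ u → StronglyMeasurable[⨆ i ∈ (u : Set ι),
      MeasurableSpace.comap (V i) inferInstance] (fun ω => ∑ i ∈ t, V i ω) := by
    intro t u htu
    refine Measurable.stronglyMeasurable (Finset.measurable_sum t fun i hi => ?_)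
    exact (comap_measurable (V i)).mono (le_iSup₂_of_le i (htu hi) le_rfl) le_rfl
  -- Each increment is a centred sum over new indices, hence independent of the past.
  have hmart : Martingale f ℱ P := by
    refine martingale_nat (fun n => hmeas (s n) (s n) subset_rfl)
      (fun n => integrable_finsetSum _ fun i _ => hint i) fun n => ?_
    set D : Ω → ℝ := fun ω => ∑ i ∈ s (n + 1) \ s n, V i ω with hD
    have hDint : Integrable D P := integrable_finsetSum _ fun i _ => hint i
    have hfint : Integrable (f n) P := integrable_finsetSum _ fun i _ => hint i
    have e : f (n + 1) = f n + D := by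
      ext ω
      simp only [hf, hD, Pi.add_apply]
      have := Finset.sum_sdiff (f := fun i => V i ω) (hs (Nat.le_succ n))
      rw [← this, add_comm]
    have hle : ∀ t : Set ι, (⨆ i ∈ t, MeasurableSpace.comap (V i) inferInstance) ≤ m0 := fun t =>
      iSup₂_le fun i _ => (hV i).comap_le
    have hindp : Indep (⨆ i ∈ ((s (n + 1) \ s n : Finset ι) : Set ι),
        MeasurableSpace.comap (V i) inferInstance) (ℱ n) P :=
      indep_iSup_of_disjoint (fun i => (hV i).comap_le) hind
        (by exact_mod_cast Finset.disjoint_coe.mpr Finset.sdiff_disjoint)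
    have h1 : P[D | ℱ n] =ᵐ[P] fun _ => ∫ ω, D ω ∂P :=
      condExp_indep_eq (hle _) (ℱ.le n) (hmeas _ _ subset_rfl) hindp
    have h3 : ∫ ω, D ω ∂P = 0 := by
      rw [hD, integral_finsetSum _ fun i _ => hint i]
      exact Finset.sum_eq_zero fun i _ => h0 i
    have h4 : P[f n | ℱ n] = f n :=
      condExp_of_stronglyMeasurable (ℱ.le n) (hmeas (s n) (s n) subset_rfl) hfint
    have h5 := condExp_add hfint hDint (ℱ n)
    rw [e]
    filter_upwards [h1, h5] with ω hω1 hω5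
    rw [hω5, Pi.add_apply, h4, hω1, h3, add_zero]
  refine hmart.submartingale.exists_ae_tendsto_of_bdd (R := (1 + A).toNNReal) fun n => ?_
  have hfL : MemLp (f n) 2 P := memLp_finsetSum _ fun i _ => h2 i
  have hsq : ∫ ω, f n ω ^ 2 ∂P ≤ A := by
    have hvar : variance (f n) P = ∫ ω, f n ω ^ 2 ∂P := by
      refine variance_of_integral_eq_zero hfL.aestronglyMeasurable.aemeasurable ?_
      rw [hf, integral_finsetSum _ fun i _ => hint i]
      exact Finset.sum_eq_zero fun i _ => h0 i
    have hsum : f n = ∑ i ∈ s n, V i := by ext ω; simp [hf]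
    rw [← hvar, hsum, IndepFun.variance_sum (fun i _ => h2 i)
      (fun i _ j _ hij => hind.indepFun hij)]
    refine le_trans (le_of_eq ?_) (hA n)
    exact Finset.sum_congr rfl fun i _ => variance_of_integral_eq_zero (hV i).aemeasurable (h0 i)
  have hfi : Integrable (f n) P := hfL.integrable (by norm_num)
  have hle : ∫ ω, ‖f n ω‖ ∂P ≤ 1 + A := by
    calc ∫ ω, ‖f n ω‖ ∂P ≤ ∫ ω, (1 + f n ω ^ 2) ∂P := by
          refine integral_mono hfi.norm ((integrable_const 1).add hfL.integrable_sq) fun ω => ?_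
          simp only [Real.norm_eq_abs]
          nlinarith [sq_abs (f n ω), sq_nonneg (|f n ω| - 1)]
      _ = 1 + ∫ ω, f n ω ^ 2 ∂P := by
          rw [integral_add (integrable_const 1) hfL.integrable_sq]; simp
      _ ≤ _ := by gcongr
  rw [eLpNorm_one_eq_lintegral_enorm, ← ofReal_integral_norm_eq_lintegral_enorm hfi]
  exact ENNReal.ofReal_le_ofReal hle

/-- Convergence of expectations for a sequence that is bounded in `L²`. -/
theorem tendsto_integral_of_ae_tendsto_of_sq_le [IsProbabilityMeasure P] {f : ℕ → Ω → ℝ}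
    {g : Ω → ℝ} {A : ℝ} (hf : ∀ n, MemLp (f n) 2 P) (hA : ∀ n, ∫ ω, f n ω ^ 2 ∂P ≤ A)
    (hlim : ∀ᵐ ω ∂P, Tendsto (fun n => f n ω) atTop (𝓝 (g ω))) :
    Integrable g P ∧ Tendsto (fun n => ∫ ω, f n ω ∂P) atTop (𝓝 (∫ ω, g ω ∂P)) := by
  have hA0 : 0 ≤ A := (integral_nonneg fun ω => sq_nonneg _).trans (hA 0)
  have hint : ∀ n, Integrable (f n) P := fun n => (hf n).integrable (by norm_num)
  -- Where `|f| ≥ (A+1)/ε` one has `|f| ≤ ε f² / (A+1)`; the `+ 1` keeps the cut-off positive when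
  -- `A = 0`.
  have hUI : UniformIntegrable f 1 P := by
    refine uniformIntegrable_of le_rfl ENNReal.one_ne_top (fun n => (hint n).aestronglyMeasurable)
      fun ε hε => ⟨((A + 1) / ε).toNNReal, fun n => ?_⟩
    have hM : 0 < (A + 1) / ε := by positivity
    rw [eLpNorm_one_eq_lintegral_enorm]
    calc ∫⁻ ω, ‖Set.indicator {x | ((A + 1) / ε).toNNReal ≤ ‖f n x‖₊} (f n) ω‖ₑ ∂P
        ≤ ∫⁻ ω, ENNReal.ofReal (ε / (A + 1) * f n ω ^ 2) ∂P := by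
          refine lintegral_mono fun ω => ?_
          by_cases hω : ((A + 1) / ε).toNNReal ≤ ‖f n ω‖₊
          · rw [Set.indicator_of_mem (show ω ∈ {x | ((A + 1) / ε).toNNReal ≤ ‖f n x‖₊} from hω),
              ← ofReal_norm]
            refine ENNReal.ofReal_le_ofReal ?_
            have h1 : (A + 1) / ε ≤ ‖f n ω‖ := by
              have := Real.toNNReal_le_iff_le_coe.mp hω
              simpa using this
            rw [div_le_iff₀ hε] at h1
            rw [div_mul_eq_mul_div, le_div_iff₀ (by positivity), ← sq_abs, ← Real.norm_eq_abs]
            nlinarith [norm_nonneg (f n ω)]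
          · rw [Set.indicator_of_notMem (show ω ∉ {x | ((A + 1) / ε).toNNReal ≤ ‖f n x‖₊} from hω)]
            simp
      _ = ENNReal.ofReal (∫ ω, ε / (A + 1) * f n ω ^ 2 ∂P) := by
          rw [ofReal_integral_eq_lintegral_ofReal ((hf n).integrable_sq.const_mul _)]
          exact Eventually.of_forall fun ω => by positivity
      _ ≤ ENNReal.ofReal ε := by
          refine ENNReal.ofReal_le_ofReal ?_
          rw [integral_const_mul, div_mul_eq_mul_div, div_le_iff₀ (by positivity)]
          have := hA n
          gcongr
          linarith
  have hg : Integrable g P := hUI.integrable_of_ae_tendsto hlim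
  refine ⟨hg, tendsto_integral_of_L1' g hg.aestronglyMeasurable (Eventually.of_forall hint) ?_⟩
  exact tendsto_Lp_finite_of_tendsto_ae le_rfl ENNReal.one_ne_top
    (fun n => (hint n).aestronglyMeasurable) (memLp_one_iff_integrable.mpr hg) hUI.unifIntegrable
    hlim

end IndepSums

/-! ### The random Euler product and its moments. -/

namespace RandomEuler

lemma uniformCircle_eq_map :
    uniformCircle = arcMeasure.map (fun θ : ℝ => Complex.exp (θ * Complex.I)) := rfl

lemma measurable_exp_mul_I : Measurable fun θ : ℝ => Complex.exp (θ * Complex.I) := by fun_prop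

lemma mem_primesUpTo {p : Nat.Primes} {y : ℕ} : p ∈ primesUpTo y ↔ (p : ℕ) ≤ y :=
  (Finset.mem_subtype (p := Nat.Prime) (s := Finset.range (y + 1)) (a := p)).trans
    (Finset.mem_range.trans Nat.lt_succ_iff)

lemma primesUpTo_mono : Monotone primesUpTo := by
  intro a b hab p hp
  rw [mem_primesUpTo] at hp ⊢
  exact hp.trans hab

lemma tendsto_primesUpTo : Tendsto primesUpTo atTop atTop := by
  refine tendsto_atTop_finset_of_monotone primesUpTo_mono fun p => ⟨(p : ℕ), ?_⟩
  rw [mem_primesUpTo]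

/-- `-log |1 - r z|`. -/
noncomputable def negLogNorm (r : ℝ) (z : ℂ) : ℝ := -Real.log ‖1 - (r : ℂ) * z‖

lemma measurable_negLogNorm (r : ℝ) : Measurable (negLogNorm r) := by
  unfold negLogNorm
  fun_prop

namespace IsUniformFamily

variable {Ω : Type*} [MeasurableSpace Ω] {P : Measure Ω} {X : Nat.Primes → Ω → ℂ}
  (hX : IsUniformFamily P X)
include hX

lemma integral_comp (p : Nat.Primes) {g : ℂ → ℝ} (hg : Measurable g) :
    ∫ ω, g (X p ω) ∂P = ∫ θ, g (Complex.exp (θ * Complex.I)) ∂arcMeasure := by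
  rw [← integral_map (hX.measurable p).aemeasurable hg.aestronglyMeasurable, hX.law,
    uniformCircle_eq_map,
    integral_map measurable_exp_mul_I.aemeasurable hg.aestronglyMeasurable]

lemma integrable_comp_iff (p : Nat.Primes) {g : ℂ → ℝ} (hg : Measurable g) :
    Integrable (fun ω => g (X p ω)) P ↔
      Integrable (fun θ : ℝ => g (Complex.exp (θ * Complex.I))) arcMeasure := by
  have h1 := integrable_map_measure (μ := P) (f := X p) hg.aestronglyMeasurable
    (hX.measurable p).aemeasurable
  have h2 := integrable_map_measure (μ := arcMeasure) (f := fun θ : ℝ => Complex.exp (θ * Complex.I))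
    hg.aestronglyMeasurable measurable_exp_mul_I.aemeasurable
  rw [hX.law, uniformCircle_eq_map] at h1
  exact h1.symm.trans h2

lemma ae_norm_eq_one : ∀ᵐ ω ∂P, ∀ p, ‖X p ω‖ = 1 := by
  rw [ae_all_iff]
  intro p
  have hms : MeasurableSet {z : ℂ | ‖z‖ = 1} := measurableSet_eq_fun measurable_norm measurable_const
  have h : ∀ᵐ z ∂(P.map (X p)), ‖z‖ = 1 := by
    rw [hX.law, uniformCircle_eq_map, ae_map_iff measurable_exp_mul_I.aemeasurable hms]
    exact Eventually.of_forall fun θ => Complex.norm_exp_ofReal_mul_I θ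
  exact (ae_map_iff (hX.measurable p).aemeasurable hms).mp h

/-- Meant for `g` the real or the imaginary part. The variances are at most `p^(-2σ)`, summable
because `σ > 1/2`. -/
lemma ae_exists_tendsto_sum_comp [IsProbabilityMeasure P] {σ : ℝ} (hσ : 1 / 2 < σ) {g : ℂ → ℝ}
    (hg : Measurable g) (hg1 : ∀ z, |g z| ≤ ‖z‖)
    (hg0 : ∫ θ : ℝ, g (Complex.exp (θ * Complex.I)) ∂arcMeasure = 0) :
    ∀ᵐ ω ∂P, ∃ l, Tendsto
      (fun y => ∑ p ∈ primesUpTo y, ((p : ℕ) : ℝ) ^ (-σ) * g (X p ω)) atTop (𝓝 l) := by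
  have hae : ∀ p : Nat.Primes,
      ∀ᵐ ω ∂P, ‖((p : ℕ) : ℝ) ^ (-σ) * g (X p ω)‖ ≤ ((p : ℕ) : ℝ) ^ (-σ) := by
    intro p
    filter_upwards [hX.ae_norm_eq_one] with ω hω
    rw [norm_mul, Real.norm_eq_abs, Real.norm_eq_abs, abs_of_pos (prime_rpow_pos _ p)]
    refine mul_le_of_le_one_right (prime_rpow_pos _ p).le ?_
    rw [← hω p]; exact hg1 _
  have hmeas : ∀ p : Nat.Primes, Measurable fun ω => ((p : ℕ) : ℝ) ^ (-σ) * g (X p ω) := fun p =>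
    (hg.comp (hX.measurable p)).const_mul _
  have hL2 : ∀ p : Nat.Primes, MemLp (fun ω => ((p : ℕ) : ℝ) ^ (-σ) * g (X p ω)) 2 P := fun p =>
    MemLp.of_bound (hmeas p).aestronglyMeasurable _ (hae p)
  refine ae_exists_tendsto_sum_of_iIndepFun (A := ∑' p : Nat.Primes, (((p : ℕ) : ℝ) ^ (-σ)) ^ 2)
    hmeas (hX.indep.comp (fun p z => ((p : ℕ) : ℝ) ^ (-σ) * g z) fun p => hg.const_mul _)
    hL2 (fun p => ?_) primesUpTo_mono fun n => ?_
  · rw [integral_const_mul, hX.integral_comp p hg, hg0, mul_zero]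
  · refine le_trans (Finset.sum_le_sum fun p _ => ?_)
      ((summable_prime_rpow_sq hσ).sum_le_tsum _ fun p _ => sq_nonneg _)
    calc _ ≤ ∫ _, (((p : ℕ) : ℝ) ^ (-σ)) ^ 2 ∂P := by
          refine integral_mono_ae (hL2 p).integrable_sq (integrable_const _) ?_
          filter_upwards [hae p] with ω hω
          rw [← sq_abs]
          gcongr
          exact hω
      _ = _ := by simp

lemma ae_exists_tendsto_sum [IsProbabilityMeasure P] {σ : ℝ} (hσ : 1 / 2 < σ) :
    ∀ᵐ ω ∂P, ∃ l, Tendsto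
      (fun y => ∑ p ∈ primesUpTo y, ((((p : ℕ) : ℝ) ^ (-σ) : ℝ) : ℂ) * X p ω) atTop (𝓝 l) := by
  have h1 := hX.ae_exists_tendsto_sum_comp hσ Complex.measurable_re Complex.abs_re_le_norm (by
    simp_rw [Complex.exp_ofReal_mul_I_re]; exact integral_cos_arcMeasure)
  have h2 := hX.ae_exists_tendsto_sum_comp hσ Complex.measurable_im Complex.abs_im_le_norm (by
    simp_rw [Complex.exp_ofReal_mul_I_im]; rw [integral_arcMeasure]; simp)
  filter_upwards [h1, h2] with ω ⟨a, ha⟩ ⟨b, hb⟩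
  refine ⟨(a : ℂ) + b * Complex.I, ?_⟩
  have ha' := (Complex.continuous_ofReal.tendsto a).comp ha
  have hb' := ((Complex.continuous_ofReal.tendsto b).comp hb).mul_const Complex.I
  refine (ha'.add hb').congr fun y => ?_
  simp only [Function.comp_apply]
  push_cast
  rw [Finset.sum_mul, ← Finset.sum_add_distrib]
  refine Finset.sum_congr rfl fun p _ => ?_
  conv_rhs => rw [← Complex.re_add_im (X p ω)]
  ring

omit hX in
lemma norm_prime_mul {σ : ℝ} (p : Nat.Primes) {z : ℂ} (hz : ‖z‖ = 1) :
    ‖((((p : ℕ) : ℝ) ^ (-σ) : ℝ) : ℂ) * z‖ = ((p : ℕ) : ℝ) ^ (-σ) := by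
  rw [norm_mul, hz, mul_one, Complex.norm_real, Real.norm_eq_abs, abs_of_pos (prime_rpow_pos _ p)]

omit hX in
lemma one_sub_prime_mul_ne_zero {σ : ℝ} (hσ : 1 / 2 < σ) (p : Nat.Primes) {z : ℂ} (hz : ‖z‖ = 1) :
    1 - ((((p : ℕ) : ℝ) ^ (-σ) : ℝ) : ℂ) * z ≠ 0 := by
  intro h
  have h1 : ‖((((p : ℕ) : ℝ) ^ (-σ) : ℝ) : ℂ) * z‖ = 1 := by rw [← sub_eq_zero.mp h, norm_one]
  rw [norm_prime_mul p hz] at h1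
  have := prime_rpow_neg_le hσ p
  linarith

omit [MeasurableSpace Ω] hX in
lemma partialL_eq (σ : ℝ) (y : ℕ) (ω : Ω) :
    partialL σ X y ω =
      ∏ p ∈ primesUpTo y, (1 - ((((p : ℕ) : ℝ) ^ (-σ) : ℝ) : ℂ) * X p ω)⁻¹ := by
  refine Finset.prod_congr rfl fun p _ => ?_
  rw [Real.rpow_neg (Nat.cast_nonneg _), Complex.ofReal_inv, div_eq_inv_mul]

omit [MeasurableSpace Ω] hX in
-- The series of `log (1 - z) + z = O(|z|²)` converges absolutely, so only the linear sum depends on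
-- the order `p ≤ y`. Exponentiating gives the product.
lemma exists_tendsto_partialL {σ : ℝ} (hσ : 1 / 2 < σ) {ω : Ω} (h1 : ∀ p, ‖X p ω‖ = 1) {l : ℂ}
    (hl : Tendsto (fun y => ∑ p ∈ primesUpTo y, ((((p : ℕ) : ℝ) ^ (-σ) : ℝ) : ℂ) * X p ω)
      atTop (𝓝 l)) : ∃ L, Tendsto (fun y => partialL σ X y ω) atTop (𝓝 L) := by
  set z : Nat.Primes → ℂ := fun p => ((((p : ℕ) : ℝ) ^ (-σ) : ℝ) : ℂ) * X p ω with hz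
  have hzn : ∀ p, ‖z p‖ = ((p : ℕ) : ℝ) ^ (-σ) := fun p => norm_prime_mul p (h1 p)
  have hsum : Summable fun p => Complex.log (1 + -z p) - -z p := by
    refine Summable.of_norm_bounded ((summable_prime_rpow_sq hσ).mul_left 2) fun p => ?_
    have hr := prime_rpow_neg_le hσ p
    have h := Complex.norm_log_one_add_sub_self_le (z := -z p) (by rw [norm_neg, hzn]; linarith)
    rw [norm_neg, hzn] at h
    refine h.trans ?_
    have h3 : (1 - ((p : ℕ) : ℝ) ^ (-σ))⁻¹ ≤ 4 := by
      rw [inv_le_comm₀ (by linarith) (by norm_num)]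
      linarith
    nlinarith [sq_nonneg (((p : ℕ) : ℝ) ^ (-σ))]
  obtain ⟨S, hS⟩ := hsum
  have hS' := (show Tendsto _ atTop _ from hS).comp tendsto_primesUpTo
  refine ⟨Complex.exp (-(S - l)), ?_⟩
  refine ((Complex.continuous_exp.tendsto _).comp (hS'.sub hl).neg).congr fun y => ?_
  simp only [Function.comp_apply]
  rw [partialL_eq, ← Finset.sum_sub_distrib, ← Finset.sum_neg_distrib, Complex.exp_sum]
  refine Finset.prod_congr rfl fun p _ => ?_
  have hne := one_sub_prime_mul_ne_zero hσ p (h1 p)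
  rw [show -(Complex.log (1 + -z p) - -z p - z p) = -Complex.log (1 - z p) by
    rw [← sub_eq_add_neg]; ring, Complex.exp_neg, Complex.exp_log hne]

lemma ae_tendsto_partialL [IsProbabilityMeasure P] {σ : ℝ} (hσ : 1 / 2 < σ) :
    ∀ᵐ ω ∂P, Tendsto (fun y : ℕ => partialL σ X y ω) atTop (𝓝 (randomL σ X ω)) := by
  filter_upwards [hX.ae_norm_eq_one, hX.ae_exists_tendsto_sum hσ] with ω h1 ⟨l, hl⟩
  obtain ⟨L, hL⟩ := exists_tendsto_partialL hσ h1 hl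
  exact tendsto_nhds_limUnder ⟨L, hL⟩

omit [MeasurableSpace Ω] hX in
lemma norm_partialL_rpow {σ : ℝ} (hσ : 1 / 2 < σ) {ω : Ω} (h1 : ∀ p, ‖X p ω‖ = 1) (κ : ℝ) (y : ℕ) :
    ‖partialL σ X y ω‖ ^ κ =
      Real.exp (κ * ∑ p ∈ primesUpTo y, negLogNorm (((p : ℕ) : ℝ) ^ (-σ)) (X p ω)) := by
  have h : ‖partialL σ X y ω‖ =
      Real.exp (∑ p ∈ primesUpTo y, negLogNorm (((p : ℕ) : ℝ) ^ (-σ)) (X p ω)) := by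
    rw [partialL_eq, norm_prod, Real.exp_sum]
    refine Finset.prod_congr rfl fun p _ => ?_
    rw [negLogNorm, Real.exp_neg,
      Real.exp_log (norm_pos_iff.mpr (one_sub_prime_mul_ne_zero hσ p (h1 p))), norm_inv]
  rw [h, ← Real.exp_mul, mul_comm]

lemma mgf_negLogNorm (p : Nat.Primes) (r t : ℝ) :
    mgf (fun ω => negLogNorm r (X p ω)) P t = mgf (eulerLog r) arcMeasure t := by
  have := hX.integral_comp p (g := fun z => Real.exp (t * negLogNorm r z))
    (((measurable_negLogNorm r).const_mul t).exp)
  exact this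

lemma integrable_exp_sum [IsProbabilityMeasure P] {σ : ℝ} (hσ : 1 / 2 < σ) (t : ℝ) (y : ℕ) :
    Integrable (fun ω => Real.exp (t * ∑ p ∈ primesUpTo y,
      negLogNorm (((p : ℕ) : ℝ) ^ (-σ)) (X p ω))) P := by
  have hind : iIndepFun (fun (p : Nat.Primes) ω => negLogNorm (((p : ℕ) : ℝ) ^ (-σ)) (X p ω)) P :=
    hX.indep.comp (fun p z => negLogNorm (((p : ℕ) : ℝ) ^ (-σ)) z) fun p => measurable_negLogNorm _
  have h := hind.integrable_exp_mul_sum (t := t) (s := primesUpTo y)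
    (fun p => (measurable_negLogNorm _).comp (hX.measurable p)) (fun p _ => ?_)
  · simpa using h
  · rw [hX.integrable_comp_iff p (g := fun z => Real.exp (t * negLogNorm (((p : ℕ) : ℝ) ^ (-σ)) z))
      (((measurable_negLogNorm _).const_mul t).exp)]
    exact integrable_exp_mul_of_abs_le
      (continuous_eulerLog (prime_rpow_pos _ p).le (prime_rpow_neg_le hσ p)).measurable
      (abs_eulerLog_le (prime_rpow_pos _ p).le (prime_rpow_neg_le hσ p)) t

lemma integral_exp_sum [IsProbabilityMeasure P] {σ : ℝ} (hσ : 1 / 2 < σ) (t : ℝ) (y : ℕ) :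
    ∫ ω, Real.exp (t * ∑ p ∈ primesUpTo y, negLogNorm (((p : ℕ) : ℝ) ^ (-σ)) (X p ω)) ∂P =
      Real.exp (∑ p ∈ primesUpTo y, eulerCgf (((p : ℕ) : ℝ) ^ (-σ)) t) := by
  have hind : iIndepFun (fun (p : Nat.Primes) ω => negLogNorm (((p : ℕ) : ℝ) ^ (-σ)) (X p ω)) P :=
    hX.indep.comp (fun p z => negLogNorm (((p : ℕ) : ℝ) ^ (-σ)) z) fun p => measurable_negLogNorm _
  have h := hind.mgf_sum (t := t) (fun p => (measurable_negLogNorm _).comp (hX.measurable p))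
    (primesUpTo y)
  rw [mgf] at h
  simp only [Finset.sum_apply] at h
  rw [h, Real.exp_sum]
  refine Finset.prod_congr rfl fun p _ => ?_
  rw [hX.mgf_negLogNorm p, eulerCgf, cgf, Real.exp_log]
  exact mgf_pos_of_abs_le
      (continuous_eulerLog (prime_rpow_pos _ p).le (prime_rpow_neg_le hσ p)).measurable
      (abs_eulerLog_le (prime_rpow_pos _ p).le (prime_rpow_neg_le hσ p)) t

omit hX in
lemma summable_eulerCgf {σ : ℝ} (hσ : 1 / 2 < σ) {t : ℝ} (ht : 0 ≤ t) :
    Summable fun p : Nat.Primes => |eulerCgf (((p : ℕ) : ℝ) ^ (-σ)) t| := by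
  refine Summable.of_nonneg_of_le (fun p => abs_nonneg _)
    (fun p => abs_eulerCgf_le (prime_rpow_pos _ p).le (prime_rpow_neg_le hσ p) ht)
    ((summable_prime_rpow_sq hσ).mul_left _)

/-- The moments of the random Euler product. -/
theorem integral_norm_randomL_rpow [IsProbabilityMeasure P] {σ : ℝ} (hσ : 1 / 2 < σ) {κ : ℝ}
    (hκ : 0 < κ) : Integrable (fun ω => ‖randomL σ X ω‖ ^ κ) P ∧
      ∫ ω, ‖randomL σ X ω‖ ^ κ ∂P =
        Real.exp (∑' p : Nat.Primes, eulerCgf (((p : ℕ) : ℝ) ^ (-σ)) κ) := by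
  set f : ℕ → Ω → ℝ := fun y ω =>
    Real.exp (κ * ∑ p ∈ primesUpTo y, negLogNorm (((p : ℕ) : ℝ) ^ (-σ)) (X p ω)) with hf
  have hsq : ∀ y, (fun ω => f y ω ^ 2) = fun ω =>
      Real.exp (2 * κ * ∑ p ∈ primesUpTo y, negLogNorm (((p : ℕ) : ℝ) ^ (-σ)) (X p ω)) := by
    intro y
    ext ω
    rw [hf, ← Real.exp_nat_mul]
    push_cast
    ring_nf
  have hL2 : ∀ y, MemLp (f y) 2 P := fun y => by
    rw [memLp_two_iff_integrable_sq (hX.integrable_exp_sum hσ κ y).aestronglyMeasurable, hsq y]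
    exact hX.integrable_exp_sum hσ (2 * κ) y
  -- The square of the `κ`-th power is the `2κ`-th power, whose expectation is explicit and bounded
  -- in `y`; this supplies the `L²` bound.
  have hA : ∀ y, ∫ ω, f y ω ^ 2 ∂P ≤
      Real.exp (∑' p : Nat.Primes, |eulerCgf (((p : ℕ) : ℝ) ^ (-σ)) (2 * κ)|) := fun y => by
    rw [hsq y, hX.integral_exp_sum hσ]
    refine Real.exp_le_exp.mpr ((Finset.sum_le_sum fun p _ => le_abs_self _).trans ?_)
    exact (summable_eulerCgf hσ (by positivity)).sum_le_tsum _ fun p _ => abs_nonneg _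
  have hlim : ∀ᵐ ω ∂P, Tendsto (fun y => f y ω) atTop (𝓝 (‖randomL σ X ω‖ ^ κ)) := by
    filter_upwards [hX.ae_norm_eq_one, hX.ae_tendsto_partialL hσ] with ω h1 h2
    refine (h2.norm.rpow_const (Or.inr hκ.le)).congr fun y => ?_
    exact norm_partialL_rpow hσ h1 κ y
  obtain ⟨hint, htend⟩ := tendsto_integral_of_ae_tendsto_of_sq_le hL2 hA hlim
  refine ⟨hint, tendsto_nhds_unique htend ?_⟩
  simp_rw [hf, hX.integral_exp_sum hσ]
  have h := (summable_eulerCgf hσ hκ.le).of_abs.hasSum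
  exact (Real.continuous_exp.tendsto _).comp ((show Tendsto _ atTop _ from h).comp tendsto_primesUpTo)

lemma logMoment_eq [IsProbabilityMeasure P] {σ : ℝ} (hσ : 1 / 2 < σ) {κ : ℝ} (hκ : 0 < κ) :
    logMoment P σ X κ = ∑' p : Nat.Primes, eulerCgf (((p : ℕ) : ℝ) ^ (-σ)) κ := by
  rw [logMoment, (hX.integral_norm_randomL_rpow hσ hκ).2, Real.log_exp]

end IsUniformFamily

end RandomEuler

/-! ### Termwise differentiation and the conclusion. -/

/-- The sum over the primes of the `m`-th derivatives of the cumulant generating functions of the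
Euler factors. -/
noncomputable def eulerCgfSum (σ : ℝ) (m : ℕ) (t : ℝ) : ℝ :=
  ∑' p : Nat.Primes, iteratedDeriv m (eulerCgf (((p : ℕ) : ℝ) ^ (-σ))) t

lemma hasDerivAt_iteratedDeriv_eulerCgf {σ : ℝ} (hσ : 1 / 2 < σ) (m : ℕ) (p : Nat.Primes) (t : ℝ) :
    HasDerivAt (iteratedDeriv m (eulerCgf (((p : ℕ) : ℝ) ^ (-σ))))
      (iteratedDeriv (m + 1) (eulerCgf (((p : ℕ) : ℝ) ^ (-σ))) t) t := by
  have h := contDiff_infty.mp (contDiff_eulerCgf (prime_rpow_pos (-σ) p).le (prime_rpow_neg_le hσ p))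
    (m + 1)
  rw [iteratedDeriv_succ]
  exact (h.differentiable_iteratedDeriv m (by exact_mod_cast Nat.lt_succ_self m) t).hasDerivAt

/-- Termwise differentiation on the bounded interval `(0, t + 1)`, where the derivatives are
`O(p^(-2σ))` uniformly; the bounds of order `0` and `1` grow with the argument. -/
lemma hasDerivAt_eulerCgfSum {σ : ℝ} (hσ : 1 / 2 < σ) (m : ℕ) {t : ℝ} (ht : 0 < t) :
    HasDerivAt (eulerCgfSum σ m) (eulerCgfSum σ (m + 1) t) t := by
  obtain ⟨C, hC0, hC⟩ := exists_abs_iteratedDeriv_eulerCgf_le_sq (m + 1) (t + 1)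
  obtain ⟨D, hD0, hD⟩ := exists_abs_iteratedDeriv_eulerCgf_le_sq m (t + 1)
  have hmem : t ∈ Set.Ioo 0 (t + 1) := ⟨ht, lt_add_one t⟩
  refine hasDerivAt_tsum_of_isPreconnected ((summable_prime_rpow_sq hσ).mul_left C) isOpen_Ioo
    isPreconnected_Ioo (fun p s _ => hasDerivAt_iteratedDeriv_eulerCgf hσ m p s)
    (fun p s hs => hC _ s (prime_rpow_pos _ p).le (prime_rpow_neg_le hσ p) hs.1.le hs.2.le) hmem
    ?_ hmem
  exact Summable.of_norm_bounded ((summable_prime_rpow_sq hσ).mul_left D) fun p =>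
    hD _ t (prime_rpow_pos _ p).le (prime_rpow_neg_le hσ p) ht.le hmem.2.le

lemma contDiffOn_eulerCgfSum {σ : ℝ} (hσ : 1 / 2 < σ) (n : ℕ) :
    ∀ m, ContDiffOn ℝ n (eulerCgfSum σ m) (Set.Ioi 0) := by
  induction n with
  | zero =>
    intro m
    simp only [Nat.cast_zero, contDiffOn_zero]
    exact fun t ht => (hasDerivAt_eulerCgfSum hσ m ht).continuousAt.continuousWithinAt
  | succ n ih =>
    intro m
    push_cast
    rw [contDiffOn_succ_iff_deriv_of_isOpen isOpen_Ioi]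
    refine ⟨fun t ht => (hasDerivAt_eulerCgfSum hσ m ht).differentiableAt.differentiableWithinAt,
      fun h => absurd h (by simp), (ih (m + 1)).congr fun t ht => ?_⟩
    exact (hasDerivAt_eulerCgfSum hσ m ht).deriv

namespace RandomEuler.IsUniformFamily

variable {Ω : Type*} [MeasurableSpace Ω] {P : Measure Ω} [IsProbabilityMeasure P]
  {X : Nat.Primes → Ω → ℂ} (hX : IsUniformFamily P X) {σ : ℝ} (hσ : 1 / 2 < σ)
include hX hσ

lemma logMoment_eqOn : Set.EqOn (logMoment P σ X) (eulerCgfSum σ 0) (Set.Ioi 0) := fun t ht => by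
  rw [hX.logMoment_eq hσ ht, eulerCgfSum]
  simp only [iteratedDeriv_zero]

lemma contDiffOn_logMoment : ContDiffOn ℝ (⊤ : ℕ∞) (logMoment P σ X) (Set.Ioi 0) :=
  (contDiffOn_infty.mpr fun n => contDiffOn_eulerCgfSum hσ n 0).congr (hX.logMoment_eqOn hσ)

lemma iteratedDeriv_logMoment (m : ℕ) :
    Set.EqOn (iteratedDeriv m (logMoment P σ X)) (eulerCgfSum σ m) (Set.Ioi 0) := by
  induction m with
  | zero => rw [iteratedDeriv_zero]; exact hX.logMoment_eqOn hσ
  | succ m ih =>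
    intro t ht
    rw [iteratedDeriv_succ, (ih.eventuallyEq_of_mem (Ioi_mem_nhds ht)).deriv_eq]
    exact (hasDerivAt_eulerCgfSum hσ m ht).deriv

end RandomEuler.IsUniformFamily

theorem proposition3 (σ : ℝ) (hσ : 1 / 2 < σ) (hσ' : σ < 1)
    {Ω : Type*} [MeasurableSpace Ω] (P : Measure Ω) [IsProbabilityMeasure P]
    (X : Nat.Primes → Ω → ℂ) (hX : RandomEuler.IsUniformFamily P X) :
    -- the objects are well defined: the product converges almost surely, its positive moments are
    -- finite and positive, `M` is smooth on `(0, ∞)`, `f` is smooth, the coefficients converge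
    (∀ᵐ ω ∂P, Tendsto (fun y : ℕ => RandomEuler.partialL σ X y ω) atTop
      (𝓝 (RandomEuler.randomL σ X ω))) ∧
    (∀ κ : ℝ, 0 < κ → Integrable (fun ω => ‖RandomEuler.randomL σ X ω‖ ^ κ) P ∧
      0 < ∫ ω, ‖RandomEuler.randomL σ X ω‖ ^ κ ∂P) ∧
    ContDiffOn ℝ (⊤ : ℕ∞) (RandomEuler.logMoment P σ X) (Set.Ioi 0) ∧
    ContDiff ℝ (⊤ : ℕ∞) RandomEuler.logI0 ∧
    (∀ m n : ℕ, IntegrableOn (RandomEuler.coeffIntegrand σ m n) (Set.Ioi 0)) ∧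
    -- the asymptotic expansions of `M` and of all its derivatives
    ∀ m N : ℕ,
      (fun κ : ℝ => iteratedDeriv m (RandomEuler.logMoment P σ X) κ -
          κ ^ (1 / σ - (m : ℝ)) / Real.log κ *
            ∑ n ∈ Finset.range (N + 1), RandomEuler.coeff σ m n / Real.log κ ^ n)
        =O[atTop] fun κ : ℝ =>
          κ ^ (1 / σ - (m : ℝ)) / Real.log κ * (1 / Real.log κ ^ (N + 1)) := by
  refine ⟨hX.ae_tendsto_partialL hσ, fun κ hκ => ?_, hX.contDiffOn_logMoment hσ, contDiff_logI0,
    integrableOn_coeffIntegrand hσ hσ', fun m N => ?_⟩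
  · obtain ⟨h1, h2⟩ := hX.integral_norm_randomL_rpow hσ hκ
    exact ⟨h1, h2 ▸ Real.exp_pos _⟩
  · obtain ⟨K, hK⟩ := exists_abs_tsum_iteratedDeriv_eulerCgf_sub_le hσ hσ' m N
    refine IsBigO.of_bound K ?_
    filter_upwards [eventually_ge_atTop (Real.exp 1)] with κ hκ
    have hκ0 : 0 < κ := (Real.exp_pos 1).trans_le hκ
    have hlog : 1 ≤ Real.log κ := (Real.le_log_iff_exp_le hκ0).mpr hκ
    rw [hX.iteratedDeriv_logMoment hσ m hκ0, Real.norm_eq_abs, Real.norm_eq_abs,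
      abs_of_nonneg (a := κ ^ (1 / σ - (m : ℝ)) / Real.log κ * (1 / Real.log κ ^ (N + 1)))
        (by positivity)]
    exact hK κ hκ
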